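/- **Theorem (correctness and complexity of Validate-$\pi$-RAM).** For a word $w$ let $\pi_w[i]$ be the length of the longest proper border of $w[1..i]$. An array $A[1..n]$ of non-negative integers is a *valid border array* if $A=\pi_w$ for some word $w$ over some alphabet. For such an array put $f[i]=A[i-1]+1$ for $i>1$ (the father of $i$ in a tree $T$ with root $1$; the root has $f[1]=0$, meaning no father), and let $f'[i]=\pi'_w[i-1]+1$ be the father of $i$ in the forest $T'$, where $\pi'_w[j]$ is the length of the longest proper border $u$ of $w[1..j]$ with $w[|u|+1]\ne w[j+1]$, or $-1$ if there is none, and $f'[i]=0$ means that $i$ is a root. Call $c$ a *valid candidate* for $\pi[i]$ if $A[1],\dots,A[i-1],c$ is a valid border array. The algorithm **Validate-$\pi$-RAM** reads $A[1],A[2],\dots$ one by one. At $i=1$ it reports an error if $A[1]\neq 0$, and otherwise sets $w[1]=\mathrm{alph}[1]=d[1]=d'[1]=\text{max-alph}=1$ and $\mathrm{Bcand}[1]=\emptyset$. At $i>1$ it puts $f=f[i]$ and: * sets $d[i]=d[f]+1$, and $d'[i]=d'[f]$ if $A[i]=f$, $d'[i]=d'[f]+1$ otherwise; * obtains the bit vector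 $\mathrm{Bcand}[i]$ from $\mathrm{Bcand}[f]$ by first clearing bit $d'[A[f]]$ (if $A[f]\ne0$) and then setting bit $d'[f]$; this encodes the recurrence $\mathrm{cand}[i]=\{0,f[i]\}\cup(\mathrm{cand}[f[i]]\setminus\{A[f[i]]\})$; * if $A[i]=0$, sets $w[i]=\mathrm{alph}[i]=\mathrm{alph}[f]+1$ and $\text{max-alph}=\max(\text{max-alph},\mathrm{alph}[i])$; * if $A[i]\neq0$, reports an error if $A[i]\ge i$; otherwise asks the level ancestor query $j=\mathrm{LA}(i,\,d[i]-d[A[i]]-1)$ in $T$ (a negative number of levels is read as $0$), reports an error if $f[j]\ne A[i]$, or if $j\neq i$ and $d'[j]=d'[A[i]]$, or if bit $d'[A[i]]$ of $\mathrm{Bcand}[i]$ is $0$; otherwise sets $w[i]=w[A[i]]$ and $\mathrm{alph}[i]=\mathrm{alph}[f]$. Then: 1. *(Online validation.)* For every $A$ and every $n\ge 0$, the algorithm processes $A[1..n]$ without an error if and only if $A[1..n]$ is a valid border array. 2. *(Minimal word.)* If it does, the computed word $w=w[1..n]$ satisfies $\pi_w=A[1..n]$, its letters lie in $\{1,\dots,\text{max-alph}\}$,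 and $\text{max-alph}$ is the minimum cardinality of an alphabet over which there is a word with failure function $A[1..n]$. Moreover $d[i]$ and $d'[i]$ are the depths of $i$ in $T$ and $T'$ (roots have depth $1$), and bit $e$ of $\mathrm{Bcand}[i]$ is $1$ if and only if there is a valid candidate $c>0$ for $\pi[i]$ with $d'[c]=e$. 3. *(Complexity.)* The algorithm, including the level ancestor queries in the growing tree, can be carried out online on the unit-cost RAM with $\Theta(\log n)$-bit words, with constant delay, in linear total time and with a linear number of machine words. Precisely: there are a RAM program and constants $C,q$ such that for all $n$, all word lengths $b\ge C(\lfloor\log_2 n\rfloor+1)$ (with $\log_2 0$ read as $0$) and all arrays $A[1..n]$ with entries $<2^b$, the program, which is told neither $n$ nor $b$, satisfies the following. It makes at most $C$ unit-time steps before it is ready to read $A[1]$, and, for each $k\le n$, at most $C$ steps from being ready to read $A[k]$ until it is ready to read the next value, hence at most $C(n+1)$ steps in total. At the end of the $k$-th phase, fixed registers contain the answer (valid/error) for $A[1..k]$ and, if it is valid, $w[k]$ and $\text{max-alph}$; then moreover for each $i\le k$ the values $A[i],w[i],\mathrm{alph}[i],d[i],d'[i],\mathrm{Bcand}[i]$ and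 the answer $j$ of the level ancestor query asked at $i$ ($0$ if none was asked) are stored in the memory words $qi,\dots,qi+6$. It accesses only memory words with addresses below $C(n+1)$, and all words in registers and memory have at most $b$ bits at all times. -/

import Mathlib

namespace BorderArray

/-! ### Borders, failure functions, border arrays

Positions are numbered from 1: the array `A[1..n]` is a function `A : ℕ → ℕ` of which only
`A 1, …, A n` matter, and the letter `w[i]` of a word `w : List α` is `w[i - 1]?`. -/

/-- `u` is a proper border of `w`: a prefix and a suffix of `w` that is shorter than `w`. -/
def IsProperBorder {α : Type} (u w : List α) : Prop :=
  u <+: w ∧ u <:+ w ∧ u.length < w.length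

/-- `w` has length `n` and `A[1..n] = π_w`: for every `i` in `[1..n]`, `A[i]` is the length of the
longest proper border of `w[1..i]`. -/
def IsFailureArray {α : Type} (w : List α) (A : ℕ → ℕ) (n : ℕ) : Prop :=
  w.length = n ∧ ∀ i, 1 ≤ i → i ≤ n →
    IsGreatest {m : ℕ | ∃ u : List α, IsProperBorder u (w.take i) ∧ u.length = m} (A i)

/-- `A[1..n]` is a valid border array: `A[1..n] = π_w` for some word `w` over some alphabet. -/
def IsBorderArray (A : ℕ → ℕ) (n : ℕ) : Prop :=
  ∃ (α : Type) (w : List α), IsFailureArray w A n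

/-- The sizes of the finite alphabets over which there is a word `w` with `π_w = A[1..n]`. -/
def alphabetSizes (A : ℕ → ℕ) (n : ℕ) : Set ℕ :=
  {m | ∃ (α : Type) (_ : Fintype α) (w : List α), Fintype.card α = m ∧ IsFailureArray w A n}

/-- `c` is a valid candidate for `π[i]`: `A[1..i-1]` followed by `c` is a valid border array. -/
def IsCandidate (A : ℕ → ℕ) (i c : ℕ) : Prop :=
  IsBorderArray (Function.update A i c) i

/-! ### The trees `T` and `T'`

Fathers are functions `ℕ → ℕ`, with value `0` where there is no father. -/

/-- The father in `T`: `f[i] = A[i-1] + 1` for `i > 1`; the root `1` has none. -/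
def father (A : ℕ → ℕ) (i : ℕ) : ℕ := if i ≤ 1 then 0 else A (i - 1) + 1

/-- The father in `T'`: `f'[i] = π'_w[i-1] + 1`, where `π'_w[i-1]` is the length of the longest
proper border `u` of `w[1..i-1]` with `w[|u|+1] ≠ w[i]`, and is `-1` if there is none (then
`f'[i] = 0`, the supremum of the empty set). -/
noncomputable def strongFather {α : Type} (w : List α) (i : ℕ) : ℕ :=
  sSup {c : ℕ | ∃ u : List α, IsProperBorder u (w.take (i - 1)) ∧ c = u.length + 1 ∧
    w[u.length]? ≠ w[i - 1]?}

/-- On the vertices `1, …, n`, `d` is the depth in the forest given by `fa`; roots have depth 1. -/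
def IsDepth (fa d : ℕ → ℕ) (n : ℕ) : Prop :=
  ∀ i, 1 ≤ i → i ≤ n → d i = if fa i = 0 then 1 else d (fa i) + 1

/-- The level ancestor query: the ancestor of `i` that is `Δ` levels above `i`. -/
def levelAncestor (fa : ℕ → ℕ) (i Δ : ℕ) : ℕ := fa^[Δ] i

/-! ### The algorithm Validate-π-RAM -/

/-- Set bit `e` of the bit vector `x` to 1. -/
def setBit (x e : ℕ) : ℕ := x ||| 2 ^ e

/-- Set bit `e` of the bit vector `x` to 0. -/
def clearBit (x e : ℕ) : ℕ := (x ||| 2 ^ e) ^^^ 2 ^ e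

/-- The variables of the algorithm: the number `len` of values read, the values themselves, and for
every position the letter `w`, the number `alph` of letters on the path to the root of `T`, the
depths `d` in `T` and `d'` in `T'`, the bit vector `Bcand` of the candidates (a set bit `e` stands
for a positive candidate of `T'`-depth `e`), and the answer `la` of the level ancestor query
(`0` if none was asked); finally the size `maxAlph` of the alphabet. -/
structure Tables where
  len : ℕ
  A : ℕ → ℕ
  w : ℕ → ℕ
  alph : ℕ → ℕ
  d : ℕ → ℕ
  d' : ℕ → ℕ
  Bcand : ℕ → ℕ
  la : ℕ → ℕ
  maxAlph : ℕ

def Tables.empty : Tables where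
  len := 0
  A := 0
  w := 0
  alph := 0
  d := 0
  d' := 0
  Bcand := 0
  la := 0
  maxAlph := 0

/-- The word `w[1..len]`. -/
def Tables.word (s : Tables) : List ℕ := (List.range s.len).map fun i => s.w (i + 1)

/-- Record the values computed for the next position. -/
def Tables.push (s : Tables) (a w alph d d' B la : ℕ) : Tables where
  len := s.len + 1
  A := Function.update s.A (s.len + 1) a
  w := Function.update s.w (s.len + 1) w
  alph := Function.update s.alph (s.len + 1) alph
  d := Function.update s.d (s.len + 1) d
  d' := Function.update s.d' (s.len + 1) d'
  Bcand := Function.update s.Bcand (s.len + 1) B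
  la := Function.update s.la (s.len + 1) la
  maxAlph := max s.maxAlph alph

/-- `Bcand[i]` for the next position `i`, by the recurrence
`cand[i] = {0, f[i]} ∪ (cand[f[i]] \ {A[f[i]]})`; the candidate `0` is not represented. -/
def Tables.nextBcand (s : Tables) : ℕ :=
  let f := father s.A (s.len + 1)
  setBit (if s.A f = 0 then s.Bcand f else clearBit (s.Bcand f) (s.d' (s.A f))) (s.d' f)

/-- Validate-π-RAM reads the next value `a = A[i]`; the result `none` is the error
"`A` not valid at `i`". -/
def validateStep (s : Tables) (a : ℕ) : Option Tables :=
  let i := s.len + 1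
  if i = 1 then
    if a = 0 then some (s.push 0 1 1 1 1 0 0) else none
  else
    let f := father s.A i
    let d := s.d f + 1
    let d' := if a = f then s.d' f else s.d' f + 1
    let B := s.nextBcand
    if a = 0 then
      some (s.push 0 (s.alph f + 1) (s.alph f + 1) d d' B 0)
    else if i ≤ a then none
    else
      let j := levelAncestor (father s.A) i (d - s.d a - 1)
      if a ≠ father s.A j then none
      else if j ≠ i ∧ s.d' j = s.d' a then none
      else if B.testBit (s.d' a) = false then none
      else some (s.push a (s.w a) (s.alph f) d d' B j)

/-- Validate-π-RAM on `A[1..n]`: the tables after the last value, or `none` after an error. -/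
def validate (A : ℕ → ℕ) : ℕ → Option Tables
  | 0 => some Tables.empty
  | n + 1 => (validate A n).bind fun s => validateStep s (A (n + 1))

/-! ### The unit-cost RAM -/

/-- The operations on machine words (subtraction is truncated at 0, `x / 0 = 0`, `x % 0 = x`). -/
inductive WordOp
  | add | sub | mul | div | mod | and | or | xor | shl | shr

def WordOp.eval : WordOp → ℕ → ℕ → ℕ
  | .add, x, y => x + y
  | .sub, x, y => x - y
  | .mul, x, y => x * y
  | .div, x, y => x / y
  | .mod, x, y => x % y
  | .and, x, y => x &&& y
  | .or, x, y => x ||| y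
  | .xor, x, y => x ^^^ y
  | .shl, x, y => x <<< y
  | .shr, x, y => x >>> y

/-- Instructions: load a constant, operate on registers, load and store with the address in a
register, jump if a register is zero, read the next input value. -/
inductive Instr
  | const (dst v : ℕ)
  | op (o : WordOp) (dst x y : ℕ)
  | load (dst adr : ℕ)
  | store (adr src : ℕ)
  | jumpZero (x target : ℕ)
  | read (dst : ℕ)

/-- A configuration: program counter, registers, memory, and the number of input values read. -/
structure Config where
  pc : ℕ
  reg : ℕ → ℕ
  mem : ℕ → ℕ
  pos : ℕ

def Config.init : Config where
  pc := 0
  reg := 0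
  mem := 0
  pos := 0

/-- One step, in unit time, of the program `P` on the input values `A 1, A 2, …`. The machine stops
where there is no instruction. -/
def Config.step (P : List Instr) (A : ℕ → ℕ) (c : Config) : Config :=
  match P[c.pc]? with
  | none => c
  | some (.const r v) => { c with pc := c.pc + 1, reg := Function.update c.reg r v }
  | some (.op o r x y) =>
      { c with pc := c.pc + 1, reg := Function.update c.reg r (o.eval (c.reg x) (c.reg y)) }
  | some (.load r x) =>
      { c with pc := c.pc + 1, reg := Function.update c.reg r (c.mem (c.reg x)) }
  | some (.store x y) =>
      { c with pc := c.pc + 1, mem := Function.update c.mem (c.reg x) (c.reg y) }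
  | some (.jumpZero x l) => { c with pc := if c.reg x = 0 then l else c.pc + 1 }
  | some (.read r) =>
      { c with pc := c.pc + 1, reg := Function.update c.reg r (A (c.pos + 1)), pos := c.pos + 1 }

/-- The configuration after `t` steps. -/
def configAt (P : List Instr) (A : ℕ → ℕ) (t : ℕ) : Config := (Config.step P A)^[t] Config.init

/-- The next step reads an input value. -/
def Config.Waiting (P : List Instr) (c : Config) : Prop := ∃ r, P[c.pc]? = some (.read r)

/-- The next step reads or writes the memory word with address `x`. -/
def Config.Accesses (P : List Instr) (c : Config) (x : ℕ) : Prop :=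
  ∃ u v, (P[c.pc]? = some (.load u v) ∧ c.reg v = x) ∨
    (P[c.pc]? = some (.store u v) ∧ c.reg u = x)

/-- All words in the configuration have at most `b` bits. -/
def Config.Fits (c : Config) (b : ℕ) : Prop := (∀ r, c.reg r < 2 ^ b) ∧ ∀ x, c.mem x < 2 ^ b

/-- The configuration holds the results `res` of Validate-π-RAM. Register 0 is the answer (1 for
"valid", 0 for "error"). If valid, registers 1 and 2 hold the last letter of the word and the size
of the alphabet, and the values of all the tables at position `i` are stored in the memory words
with the addresses `q * i, …, q * i + 6`. -/
def Config.Holds (c : Config) (q : ℕ) : Option Tables → Prop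
  | none => c.reg 0 = 0
  | some s => c.reg 0 = 1 ∧ c.reg 1 = s.w s.len ∧ c.reg 2 = s.maxAlph ∧
      ∀ i, 1 ≤ i → i ≤ s.len → (List.range 7).map (fun j => c.mem (q * i + j)) =
        [s.A i, s.w i, s.alph i, s.d i, s.d' i, s.Bcand i, s.la i]

/-- The program `P` carries out Validate-π-RAM on `A[1..n]` online, with delay at most `C`, in total
time at most `C * (n + 1)`, with `C * (n + 1)` words of memory, on a machine with `b`-bit words.
Here `T k` is the time at which the `k`-th value has been processed and the machine is about to
read the next one. -/
def RunsValidate (P : List Instr) (C q : ℕ) (A : ℕ → ℕ) (n b : ℕ) : Prop :=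
  ∃ T : ℕ → ℕ,
    (∀ k ≤ n, (configAt P A (T k)).pos = k ∧ (configAt P A (T k)).Waiting P ∧
      (configAt P A (T k)).Holds q (validate A k)) ∧
    T 0 ≤ C ∧ (∀ k < n, T k < T (k + 1) ∧ T (k + 1) ≤ T k + C) ∧
    T n ≤ C * (n + 1) ∧
    (∀ t < T n, ∀ x, (configAt P A t).Accesses P x → x < C * (n + 1)) ∧
    (∀ t ≤ T n, (configAt P A t).Fits b)

end BorderArray

/-! Everything is read off the tree T. The proper borders of `w[1..i-1]` are the longest one, the
longest one of that, and so on; their lengths plus one are the vertices strictly above `i` in T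
(`reach_iff_bd`). A positive `m` is a border length of `w[1..i]` if and only if it is such a vertex
and carries the letter of `i`. So `A` is the failure function of `w` if and only if each `A[i]` is
the nearest vertex above `i` with the letter of `i`, or `0` if there is none (`fa_iff_pathWord`).
This turns words into labellings of paths.

Given a valid `A[1..i-1]`, the positive candidates at `i` are the vertices `c` above `i` such that
no nearer vertex above `i` has the letter of `c`. They do not depend on the choice of the word. The
depth `d'` counts letter changes along a path of T, so two vertices of equal `d'` on a path lie in a
run of one letter, and only the vertex of the run nearest to `i` can be a candidate. Hence `d'` is
injective on candidates and `Bcand` loses no information. A set bit says only that some candidate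
has the depth of `A[i]`; the condition on the son `j` of `A[i]` says that `A[i]` is the nearest
vertex of its run (`accepted_iff_cand`). A value `0` forces a letter that is new on the path and
every other value repeats one, so the number of letters on a path is determined by `A`, and the
largest such number is the minimal alphabet (`isLeast_alphabetSizes`).

For the machine, two steps up in T' at least halve a position by a periodicity argument
(`PathWord.fatherS_add_le`), so T' has logarithmic height and bit vectors indexed by `d'` fit into
words. T itself can be a path, but its level ancestor queries reduce to T': in an accepted query
with `j ≠ i` the letter changes between `j` and `A[i]`, so `j` is the upper end of the run of `u`,
the son of `A[i]` on the T'-path from `f` (`accepted_iff_child`).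

Such sons are found in constant time in a growing forest by a partition into connected clusters.
Each vertex of a cluster owns one bit and stores the mask of the bits on its path from the cluster
root; bits increase downwards, so the son of `a` is given by the lowest bit of the mask above the
bit of `a`. A bit is translated into a vertex by reduction modulo a power of 3, which separates the
powers of 2 in question. Each vertex that joins a cluster also adds one entry to a table of the
ancestors of the cluster root; when the table is complete, further sons open new clusters. A query
therefore inspects at most two clusters, and the second has a complete table. The arrays of a
cluster grow by a factor of 3, with the names copied one per insertion, so that no insertion is
expensive; a potential function shows that the space is linear. The program is a loop-free body in a
read loop, verified by weakest preconditions (`Stmt.wp_sound`). -/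

namespace BorderArray

section

/-! ### Paths in a forest given by a father function -/

/-- `u` is on the path that starts in `v` and follows the fathers. -/
def Reach (g : ℕ → ℕ) (v u : ℕ) : Prop := ∃ k, g^[k] v = u

theorem Reach.refl (g : ℕ → ℕ) (v : ℕ) : Reach g v v := ⟨0, rfl⟩

theorem Reach.head {g : ℕ → ℕ} {v u : ℕ} (h : Reach g (g v) u) : Reach g v u := by
  obtain ⟨k, hk⟩ := h
  exact ⟨k + 1, by rw [Function.iterate_succ_apply]; exact hk⟩

theorem Reach.trans {g : ℕ → ℕ} {v u t : ℕ} (h : Reach g v u) (h' : Reach g u t) :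
    Reach g v t := by
  obtain ⟨k, hk⟩ := h
  obtain ⟨l, hl⟩ := h'
  exact ⟨l + k, by rw [Function.iterate_add_apply, hk, hl]⟩

theorem reach_iff {g : ℕ → ℕ} {v u : ℕ} : Reach g v u ↔ u = v ∨ Reach g (g v) u := by
  constructor
  · rintro ⟨k, hk⟩
    cases k with
    | zero => exact Or.inl hk.symm
    | succ k => exact Or.inr ⟨k, by rw [← hk, Function.iterate_succ_apply]⟩
  · rintro (rfl | h)
    · exact Reach.refl _ _
    · exact h.head

theorem Reach.father {g : ℕ → ℕ} {v u : ℕ} (h : Reach g v u) : Reach g (g v) (g u) := by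
  obtain ⟨k, hk⟩ := h
  refine ⟨k, ?_⟩
  rw [← Function.iterate_succ_apply, Function.iterate_succ_apply', hk]

/-- On the vertices `0, …, n`, fathers are smaller than their sons, and `0` stands for "none". -/
def Decr (g : ℕ → ℕ) (n : ℕ) : Prop := g 0 = 0 ∧ ∀ v, 1 ≤ v → v ≤ n → g v < v

theorem Decr.mono {g : ℕ → ℕ} {n m : ℕ} (h : Decr g n) (hm : m ≤ n) : Decr g m :=
  ⟨h.1, fun v h1 h2 => h.2 v h1 (h2.trans hm)⟩

theorem Decr.le {g : ℕ → ℕ} {n : ℕ} (h : Decr g n) {v : ℕ} (hv : v ≤ n) : g v ≤ v := by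
  rcases Nat.eq_zero_or_pos v with rfl | h0
  · exact h.1.le
  · exact (h.2 v h0 hv).le

theorem Decr.iterate_le {g : ℕ → ℕ} {n : ℕ} (h : Decr g n) {v : ℕ} (hv : v ≤ n) (k : ℕ) :
    g^[k] v ≤ v := by
  induction k with
  | zero => exact le_rfl
  | succ k ih =>
    rw [Function.iterate_succ_apply']
    exact (h.le (ih.trans hv)).trans ih

theorem Decr.reach_le {g : ℕ → ℕ} {n : ℕ} (h : Decr g n) {v u : ℕ} (hv : v ≤ n)
    (hr : Reach g v u) : u ≤ v := by
  obtain ⟨k, rfl⟩ := hr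
  exact h.iterate_le hv k

theorem Decr.reach_zero {g : ℕ → ℕ} {n : ℕ} (h : Decr g n) {u : ℕ} (hr : Reach g 0 u) : u = 0 :=
  Nat.le_zero.1 (h.reach_le (Nat.zero_le n) hr)

/-- The ancestors of a vertex form a chain, and since numbers decrease upwards, comparing numbers
tells which of two ancestors is above the other. -/
theorem Decr.reach_linear {g : ℕ → ℕ} {n : ℕ} (h : Decr g n) {v u t : ℕ} (hv : v ≤ n)
    (hu : Reach g v u) (ht : Reach g v t) (hle : t ≤ u) : Reach g u t := by
  obtain ⟨k, rfl⟩ := hu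
  obtain ⟨l, rfl⟩ := ht
  rcases le_total k l with hkl | hkl
  · exact ⟨l - k, by rw [← Function.iterate_add_apply, Nat.sub_add_cancel hkl]⟩
  · have e : g^[k] v = g^[k - l] (g^[l] v) := by
      rw [← Function.iterate_add_apply, Nat.sub_add_cancel hkl]
    have := h.iterate_le ((h.iterate_le hv l).trans hv) (k - l)
    rw [← e] at this
    rw [le_antisymm hle this]
    exact Reach.refl _ _

/-! ### Borders of functions -/

/-- `m` is the length of a proper border of `x[1..i]`. -/
def Bd {β : Type*} (x : ℕ → β) (i m : ℕ) : Prop :=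
  m < i ∧ ∀ k, 1 ≤ k → k ≤ m → x k = x (i - m + k)

theorem Bd.trans {β : Type*} {x : ℕ → β} {i m k : ℕ} (h : Bd x i m) (h' : Bd x m k) :
    Bd x i k := by
  refine ⟨h'.1.trans h.1, fun j h1 h2 => ?_⟩
  have := h'.1
  have := h.1
  rw [h'.2 j h1 h2, h.2 (m - k + j) (by omega) (by omega)]
  congr 1
  omega

theorem Bd.of_lt {β : Type*} {x : ℕ → β} {i m k : ℕ} (h : Bd x i m) (h' : Bd x i k)
    (hk : k < m) : Bd x m k := by
  refine ⟨hk, fun j h1 h2 => ?_⟩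
  have := h.1
  rw [h'.2 j h1 h2, h.2 (m - k + j) (by omega) (by omega)]
  congr 1
  omega

theorem bd_succ {β : Type*} {x : ℕ → β} {i m : ℕ} :
    Bd x (i + 1) (m + 1) ↔ Bd x i m ∧ x (m + 1) = x (i + 1) := by
  constructor
  · rintro ⟨h1, h2⟩
    refine ⟨⟨by omega, fun k hk hk' => ?_⟩, ?_⟩
    · rw [h2 k hk (by omega)]
      congr 1
      omega
    · rw [h2 (m + 1) (by omega) le_rfl]
      congr 1
      omega
  · rintro ⟨⟨h1, h2⟩, h3⟩
    refine ⟨by omega, fun k hk hk' => ?_⟩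
    rcases Nat.lt_or_ge k (m + 1) with h | h
    · rw [h2 k hk (by omega)]
      congr 1
      omega
    · obtain rfl : k = m + 1 := by omega
      rw [h3]
      congr 1
      omega

theorem bd_zero {β : Type*} {x : ℕ → β} {i : ℕ} (h : 1 ≤ i) : Bd x i 0 :=
  ⟨h, fun k h1 h2 => by omega⟩

/-- Passing to functions on the positions `1, 2, …`, here with values in `Option α`, turns the
periodicity arguments into index arithmetic. -/
theorem isProperBorder_iff {α : Type} (w : List α) {i m : ℕ} (hi : i ≤ w.length) :
    (∃ u : List α, IsProperBorder u (w.take i) ∧ u.length = m) ↔ Bd (fun k => w[k - 1]?) i m := by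
  have hlen : (w.take i).length = i := by simp [hi]
  constructor
  · rintro ⟨u, ⟨h1, h2, h3⟩, rfl⟩
    rw [hlen] at h3
    refine ⟨h3, fun k hk hk' => ?_⟩
    have e1 : u[k - 1]? = w[k - 1]? := by
      obtain ⟨t, ht⟩ := h1
      have : (w.take i)[k - 1]? = u[k - 1]? := by
        rw [← ht, List.getElem?_append_left (by omega)]
      rw [← this, List.getElem?_take_of_lt (by omega)]
    have e2 : u[k - 1]? = w[i - u.length + k - 1]? := by
      obtain ⟨t, ht⟩ := h2
      have hl : t.length + u.length = i := by rw [← hlen, ← ht]; simp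
      have : (w.take i)[i - u.length + k - 1]? = u[k - 1]? := by
        rw [← ht, List.getElem?_append_right (by omega)]
        congr 1
        omega
      rw [← this, List.getElem?_take_of_lt (by omega)]
    show w[k - 1]? = w[i - u.length + k - 1]?
    rw [← e1, e2]
  · rintro ⟨h1, h2⟩
    refine ⟨w.take m, ⟨?_, ?_, ?_⟩, by simp; omega⟩
    · exact List.take_prefix_take_left (by omega)
    · rw [List.suffix_iff_eq_drop, hlen, List.length_take, min_eq_left (by omega)]
      apply List.ext_getElem?
      intro k
      rcases Nat.lt_or_ge k m with hk | hk
      · rw [List.getElem?_take_of_lt hk, List.getElem?_drop, List.getElem?_take_of_lt (by omega)]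
        have := h2 (k + 1) (by omega) (by omega)
        simp only [Nat.add_sub_cancel] at this
        rw [this]
        congr 1
      · rw [List.getElem?_eq_none, List.getElem?_eq_none] <;> simp <;> omega
    · rw [hlen]
      simp
      omega

/-- `A[1..n]` is the failure function of `x[1..n]`. -/
def FA {β : Type*} (x : ℕ → β) (A : ℕ → ℕ) (n : ℕ) : Prop :=
  ∀ i, 1 ≤ i → i ≤ n → Bd x i (A i) ∧ ∀ m, Bd x i m → m ≤ A i

theorem isFailureArray_iff {α : Type} (w : List α) (A : ℕ → ℕ) (n : ℕ) :
    IsFailureArray w A n ↔ w.length = n ∧ FA (fun k => w[k - 1]?) A n := by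
  unfold IsFailureArray FA
  refine and_congr_right fun hn => forall_congr' fun i => forall_congr' fun h1 =>
    forall_congr' fun h2 => ?_
  have key := fun m => isProperBorder_iff w (i := i) (m := m) (by omega)
  constructor
  · rintro ⟨h, h'⟩
    exact ⟨(key _).1 h, fun m hm => h' ((key m).2 hm)⟩
  · rintro ⟨h, h'⟩
    exact ⟨(key _).2 h, fun m hm => h' m ((key m).1 hm)⟩

/-! ### Failure functions as labellings of the paths of T -/

theorem father_of_two_le (A : ℕ → ℕ) {i : ℕ} (h : 2 ≤ i) : father A i = A (i - 1) + 1 := by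
  unfold father
  rw [if_neg (by omega)]

theorem father_of_le_one (A : ℕ → ℕ) {i : ℕ} (h : i ≤ 1) : father A i = 0 := by
  unfold father
  rw [if_pos h]

theorem father_pos (A : ℕ → ℕ) {i : ℕ} (h : 2 ≤ i) : 1 ≤ father A i := by
  rw [father_of_two_le A h]; omega

theorem decr_father {A : ℕ → ℕ} {n : ℕ} (h : ∀ i, 1 ≤ i → i ≤ n → A i < i) :
    Decr (father A) (n + 1) := by
  refine ⟨father_of_le_one A (by omega), fun v h1 h2 => ?_⟩
  rcases Nat.lt_or_ge v 2 with hv | hv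
  · rw [father_of_le_one A (by omega)]; omega
  · rw [father_of_two_le A hv]
    have := h (v - 1) (by omega) (by omega)
    omega

/-- `A[1..n]` and the letters `x` on the paths of the tree `T` fit together: `A[i]` is the first
vertex above `i` that has the letter of `i`. -/
def PathWord {β : Type*} (A : ℕ → ℕ) (x : ℕ → β) (n : ℕ) : Prop :=
  ∀ i, 1 ≤ i → i ≤ n → A i < i ∧ (A i ≠ 0 → Reach (father A) (father A i) (A i) ∧ x (A i) = x i) ∧
    ∀ c, 1 ≤ c → Reach (father A) (father A i) c → x c = x i → c ≤ A i

theorem PathWord.mono {β : Type*} {A : ℕ → ℕ} {x : ℕ → β} {n m : ℕ} (h : PathWord A x n)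
    (hm : m ≤ n) : PathWord A x m := fun i h1 h2 => h i h1 (h2.trans hm)

theorem PathWord.lt {β : Type*} {A : ℕ → ℕ} {x : ℕ → β} {n : ℕ} (h : PathWord A x n) :
    ∀ i, 1 ≤ i → i ≤ n → A i < i := fun i h1 h2 => (h i h1 h2).1

theorem PathWord.decr {β : Type*} {A : ℕ → ℕ} {x : ℕ → β} {n : ℕ} (h : PathWord A x n) :
    Decr (father A) (n + 1) := decr_father h.lt

/-- The borders of a word are its longest border and the borders of that one. Adding one to the
lengths makes this chain the chain of fathers above `i`. -/
theorem reach_iff_bd {β : Type*} {A : ℕ → ℕ} {x : ℕ → β} {n : ℕ} (h : FA x A n) (i : ℕ)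
    (h2 : 2 ≤ i) (hn : i ≤ n + 1) (c : ℕ) (hc : 1 ≤ c) :
    Reach (father A) (father A i) c ↔ Bd x (i - 1) (c - 1) := by
  induction i using Nat.strong_induction_on with
  | _ i ih =>
    have hd := decr_father (fun i h1 h2 => (h i h1 h2).1.1)
    obtain ⟨hb, hmax⟩ := h (i - 1) (by omega) (by omega)
    rw [reach_iff, father_of_two_le A h2]
    have hlt := hb.1
    rcases Nat.eq_zero_or_pos (A (i - 1)) with h0 | h0
    · rw [h0, father_of_le_one A (by omega)]
      constructor
      · rintro (rfl | hr)
        · exact bd_zero (by omega)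
        · exact absurd (hd.reach_zero hr) (by omega)
      · intro hB
        have := hmax _ hB
        left
        omega
    · rw [ih (A (i - 1) + 1) (by omega) (by omega) (by omega), Nat.add_sub_cancel]
      constructor
      · rintro (rfl | hB)
        · exact hb
        · exact hb.trans hB
      · intro hB
        have := hmax _ hB
        rcases Nat.lt_or_ge (c - 1) (A (i - 1)) with hl | hl
        · exact Or.inr (hb.of_lt hB hl)
        · left
          omega

/-- By `bd_succ`, the positive border lengths at `i` are the vertices above `i` with the letter of
`i`. Induction on `n` is needed because the vertices above `i` describe borders only if the array is
already correct before `i`. -/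
theorem fa_iff_pathWord {β : Type*} {A : ℕ → ℕ} {x : ℕ → β} {n : ℕ} :
    FA x A n ↔ PathWord A x n := by
  induction n with
  | zero => exact ⟨fun _ i h1 h2 => by omega, fun _ i h1 h2 => by omega⟩
  | succ n ih =>
    have step : FA x A n → ((Bd x (n + 1) (A (n + 1)) ∧ ∀ m, Bd x (n + 1) m → m ≤ A (n + 1)) ↔
        (A (n + 1) < n + 1 ∧ (A (n + 1) ≠ 0 → Reach (father A) (father A (n + 1)) (A (n + 1)) ∧
          x (A (n + 1)) = x (n + 1)) ∧
        ∀ c, 1 ≤ c → Reach (father A) (father A (n + 1)) c → x c = x (n + 1) → c ≤ A (n + 1))) := by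
      intro hF
      have key : ∀ c, 1 ≤ c → (Bd x (n + 1) c ↔
          Reach (father A) (father A (n + 1)) c ∧ x c = x (n + 1)) := by
        intro c hc
        obtain ⟨c, rfl⟩ : ∃ c', c = c' + 1 := ⟨c - 1, by omega⟩
        rw [bd_succ]
        rcases Nat.eq_zero_or_pos n with rfl | hn
        · rw [father_of_le_one A (by omega)]
          have h0 : Decr (father A) 0 := ⟨father_of_le_one A (by omega), fun v _ _ => by omega⟩
          constructor
          · rintro ⟨h, _⟩
            exact absurd h.1 (by omega)
          · rintro ⟨h, _⟩
            exact absurd (h0.reach_zero h) (by omega)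
        · rw [reach_iff_bd hF (n + 1) (by omega) le_rfl (c + 1) hc]
          simp
      constructor
      · rintro ⟨hb, hm⟩
        refine ⟨hb.1, fun h0 => (key _ (by omega)).1 hb, fun c hc hr hx => hm c ?_⟩
        exact (key c hc).2 ⟨hr, hx⟩
      · rintro ⟨hlt, h1, h2⟩
        refine ⟨?_, fun m hm => ?_⟩
        · rcases Nat.eq_zero_or_pos (A (n + 1)) with h0 | h0
          · rw [h0]
            exact bd_zero (by omega)
          · exact (key _ h0).2 (h1 (by omega))
        · rcases Nat.eq_zero_or_pos m with h0 | h0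
          · omega
          · obtain ⟨hr, hx⟩ := (key m h0).1 hm
            exact h2 m h0 hr hx
    constructor
    · intro h
      have hF : FA x A n := fun i h1 h2 => h i h1 (by omega)
      intro i h1 h2
      rcases Nat.lt_or_ge i (n + 1) with hl | hl
      · exact ih.1 hF i h1 (by omega)
      · obtain rfl : i = n + 1 := by omega
        exact (step hF).1 (h _ h1 le_rfl)
    · intro h
      have hF : FA x A n := ih.2 (h.mono (by omega))
      intro i h1 h2
      rcases Nat.lt_or_ge i (n + 1) with hl | hl
      · exact hF i h1 (by omega)
      · obtain rfl : i = n + 1 := by omega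
        exact (step hF).2 (h _ h1 le_rfl)

/-- Only the pattern of equal letters matters, so a word can be moved to another alphabet. -/
theorem PathWord.of_letters {β γ : Type*} {A : ℕ → ℕ} {x : ℕ → β} {y : ℕ → γ} {n : ℕ}
    (h : PathWord A x n)
    (hxy : ∀ u v, 1 ≤ u → u ≤ n → 1 ≤ v → v ≤ n → (x u = x v ↔ y u = y v)) :
    PathWord A y n := by
  intro i h1 h2
  obtain ⟨hl, ha, hb⟩ := h i h1 h2
  have hd := h.decr
  refine ⟨hl, fun h0 => ⟨(ha h0).1, (hxy _ _ (by omega) (by omega) h1 h2).1 (ha h0).2⟩,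
    fun c hc hr hx => ?_⟩
  have h3 := hd.le (v := i) (by omega)
  have h4 := hd.reach_le (h3.trans (by omega)) hr
  exact hb c hc hr ((hxy _ _ hc (by omega) h1 h2).2 hx)

theorem isBorderArray_iff (A : ℕ → ℕ) (n : ℕ) :
    IsBorderArray A n ↔ ∃ (α : Type) (x : ℕ → α), PathWord A x n := by
  constructor
  · rintro ⟨α, w, hw⟩
    rw [isFailureArray_iff, fa_iff_pathWord] at hw
    exact ⟨_, _, hw.2⟩
  · rintro ⟨α, x, hx⟩
    refine ⟨α, (List.range n).map fun i => x (i + 1), ?_⟩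
    rw [isFailureArray_iff, fa_iff_pathWord]
    refine ⟨by simp, hx.of_letters fun u v h1 h2 h3 h4 => ?_⟩
    have : ∀ u, 1 ≤ u → u ≤ n → ((List.range n).map fun i => x (i + 1))[u - 1]? = some (x u) := by
      intro u h1 h2
      rw [List.getElem?_map, List.getElem?_range (by omega)]
      simp [Nat.sub_add_cancel h1]
    simp only [this u h1 h2, this v h3 h4, Option.some_inj]

end

section

/-! ### The tables of the algorithm as functions of the array -/

/-- The depth in `T`. -/
def depthT (A : ℕ → ℕ) (v : ℕ) : ℕ :=
  if v = 0 then 0 else if _h : father A v < v then depthT A (father A v) + 1 else 1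
termination_by v

/-- The depth in `T'`. -/
def depthS (A : ℕ → ℕ) (v : ℕ) : ℕ :=
  if v ≤ 1 then v else if _h : father A v < v then
    if A v = father A v then depthS A (father A v) else depthS A (father A v) + 1 else 1
termination_by v

/-- The last vertex on the path from `v` in `T` up to which the letter does not change. -/
def runEnd (A : ℕ → ℕ) (v : ℕ) : ℕ :=
  if v ≤ 1 then v else if _h : father A v < v then
    if A v = father A v then runEnd A (father A v) else v else v
termination_by v

/-- The father in `T'`. -/
def fatherS (A : ℕ → ℕ) (v : ℕ) : ℕ := father A (runEnd A v)

/-- The number of letters on the path from `v` to the root of `T`. -/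
def lettersT (A : ℕ → ℕ) (v : ℕ) : ℕ :=
  if v = 0 then 0 else if _h : father A v < v then
    if A v = 0 then lettersT A (father A v) + 1 else lettersT A (father A v) else 0
termination_by v

/-- The letter at position `v` of the minimal word. -/
def letterAt (A : ℕ → ℕ) (v : ℕ) : ℕ :=
  if v = 0 then 0 else if A v = 0 then lettersT A v else
    if _h : A v < v then letterAt A (A v) else 0
termination_by v

/-- The bit vector of the candidates. -/
def candBits (A : ℕ → ℕ) (v : ℕ) : ℕ :=
  if v ≤ 1 then 0 else if _h : father A v < v then
    setBit (if A (father A v) = 0 then candBits A (father A v)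
      else clearBit (candBits A (father A v)) (depthS A (A (father A v)))) (depthS A (father A v))
  else 0
termination_by v

/-- The answer of the level ancestor query. -/
def queryT (A : ℕ → ℕ) (v : ℕ) : ℕ :=
  if v ≤ 1 ∨ A v = 0 then 0
  else levelAncestor (father A) v (depthT A v - depthT A (A v) - 1)

variable {A : ℕ → ℕ} {n v : ℕ}

theorem depthT_zero : depthT A 0 = 0 := by rw [depthT]; simp

theorem depthT_eq (h : Decr (father A) n) (h1 : 1 ≤ v) (h2 : v ≤ n) :
    depthT A v = depthT A (father A v) + 1 := by
  rw [depthT, if_neg (by omega), dif_pos (h.2 v h1 h2)]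

theorem depthS_zero : depthS A 0 = 0 := by rw [depthS]; simp

theorem depthS_one : depthS A 1 = 1 := by rw [depthS]; simp

theorem depthS_eq (h : Decr (father A) n) (h1 : 2 ≤ v) (h2 : v ≤ n) :
    depthS A v =
      if A v = father A v then depthS A (father A v) else depthS A (father A v) + 1 := by
  rw [depthS, if_neg (by omega), dif_pos (h.2 v (by omega) h2)]

theorem runEnd_zero : runEnd A 0 = 0 := by rw [runEnd]; simp

theorem runEnd_one : runEnd A 1 = 1 := by rw [runEnd]; simp

theorem runEnd_eq (h : Decr (father A) n) (h1 : 2 ≤ v) (h2 : v ≤ n) :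
    runEnd A v = if A v = father A v then runEnd A (father A v) else v := by
  rw [runEnd, if_neg (by omega), dif_pos (h.2 v (by omega) h2)]

theorem fatherS_zero : fatherS A 0 = 0 := by
  rw [fatherS, runEnd_zero, father_of_le_one A (by omega)]

theorem fatherS_one : fatherS A 1 = 0 := by
  rw [fatherS, runEnd_one, father_of_le_one A (by omega)]

theorem fatherS_eq (h : Decr (father A) n) (h1 : 2 ≤ v) (h2 : v ≤ n) :
    fatherS A v = if A v = father A v then fatherS A (father A v) else father A v := by
  rw [fatherS, runEnd_eq h h1 h2]
  split_ifs <;> rfl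

theorem lettersT_zero : lettersT A 0 = 0 := by rw [lettersT]; simp

theorem lettersT_eq (h : Decr (father A) n) (h1 : 1 ≤ v) (h2 : v ≤ n) :
    lettersT A v =
      if A v = 0 then lettersT A (father A v) + 1 else lettersT A (father A v) := by
  rw [lettersT, if_neg (by omega), dif_pos (h.2 v h1 h2)]

theorem letterAt_zero : letterAt A 0 = 0 := by rw [letterAt]; simp

theorem letterAt_of_eq_zero (h1 : 1 ≤ v) (h2 : A v = 0) : letterAt A v = lettersT A v := by
  rw [letterAt, if_neg (by omega), if_pos h2]

theorem letterAt_of_ne_zero (h1 : A v ≠ 0) (h2 : A v < v) : letterAt A v = letterAt A (A v) := by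
  rw [letterAt, if_neg (by omega), if_neg h1, dif_pos h2]

theorem candBits_of_le_one (h : v ≤ 1) : candBits A v = 0 := by rw [candBits, if_pos h]

theorem candBits_eq (h : Decr (father A) n) (h1 : 2 ≤ v) (h2 : v ≤ n) :
    candBits A v = setBit (if A (father A v) = 0 then candBits A (father A v)
      else clearBit (candBits A (father A v)) (depthS A (A (father A v))))
      (depthS A (father A v)) := by
  rw [candBits, if_neg (by omega), dif_pos (h.2 v (by omega) h2)]

theorem queryT_of_eq_zero (h : A v = 0) : queryT A v = 0 := by
  rw [queryT, if_pos (Or.inr h)]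

theorem queryT_of_ne_zero (h1 : 2 ≤ v) (h : A v ≠ 0) :
    queryT A v = levelAncestor (father A) v (depthT A v - depthT A (A v) - 1) := by
  rw [queryT, if_neg (by omega)]

theorem testBit_setBit (x e k : ℕ) : (setBit x e).testBit k = (x.testBit k || decide (e = k)) := by
  rw [setBit, Nat.testBit_or, Nat.testBit_two_pow]

theorem testBit_clearBit (x e k : ℕ) :
    (clearBit x e).testBit k = (x.testBit k && decide (e ≠ k)) := by
  rw [clearBit, Nat.testBit_xor, Nat.testBit_or, Nat.testBit_two_pow]
  by_cases h : e = k <;> simp [h]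

/-! ### Depths and runs -/

theorem runEnd_spec (h : Decr (father A) n) (h1 : 1 ≤ v) (h2 : v ≤ n) :
    Reach (father A) v (runEnd A v) ∧ 1 ≤ runEnd A v ∧ runEnd A v ≤ v ∧
      depthS A (runEnd A v) = depthS A v ∧
      (2 ≤ runEnd A v → A (runEnd A v) ≠ father A (runEnd A v)) := by
  induction v using Nat.strong_induction_on with
  | _ v ih =>
    rcases Nat.lt_or_ge v 2 with hv | hv
    · obtain rfl : v = 1 := by omega
      rw [runEnd_one]
      exact ⟨Reach.refl _ _, le_rfl, le_rfl, rfl, fun h => by omega⟩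
    · have hlt := h.2 v h1 h2
      obtain ⟨a1, a2, a3, a4, a5⟩ := ih (father A v) hlt (father_pos A hv) (by omega)
      rw [runEnd_eq h hv h2]
      split_ifs with hA
      · refine ⟨a1.head, a2, by omega, ?_, a5⟩
        rw [a4, depthS_eq h hv h2, if_pos hA]
      · exact ⟨Reach.refl _ _, h1, le_rfl, rfl, fun _ => hA⟩

theorem decr_fatherS (h : Decr (father A) n) : Decr (fatherS A) n := by
  refine ⟨fatherS_zero, fun v h1 h2 => ?_⟩
  obtain ⟨_, a2, a3, _, _⟩ := runEnd_spec h h1 h2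
  have := h.2 (runEnd A v) a2 (by omega)
  rw [fatherS]
  omega

/-- The recurrence for `d'` adds one exactly where a run of equal letters ends, and the edges of T'
are those that lead out of the runs. -/
theorem depthS_fatherS (h : Decr (father A) n) (h1 : 1 ≤ v) (h2 : v ≤ n) :
    depthS A v = depthS A (fatherS A v) + 1 := by
  obtain ⟨_, a2, a3, a4, a5⟩ := runEnd_spec h h1 h2
  rw [← a4, fatherS]
  rcases Nat.lt_or_ge (runEnd A v) 2 with hv | hv
  · have e : runEnd A v = 1 := by omega
    rw [e, depthS_one, father_of_le_one A le_rfl, depthS_zero]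
  · rw [depthS_eq h hv (by omega), if_neg (a5 hv)]

theorem reach_fatherS (h : Decr (father A) n) (h1 : 1 ≤ v) (h2 : v ≤ n) :
    Reach (father A) (father A v) (fatherS A v) :=
  (runEnd_spec h h1 h2).1.father

theorem reach_of_fatherS (h : Decr (father A) n) {u : ℕ} (h2 : v ≤ n)
    (hr : Reach (fatherS A) v u) : Reach (father A) v u := by
  obtain ⟨k, rfl⟩ := hr
  induction k with
  | zero => exact Reach.refl _ _
  | succ k ih =>
    rw [Function.iterate_succ_apply']
    have hle := (decr_fatherS h).iterate_le h2 k
    rcases Nat.eq_zero_or_pos ((fatherS A)^[k] v) with h0 | h0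
    · rw [h0] at ih ⊢
      rw [fatherS_zero]
      exact ih
    · exact ih.trans (reach_fatherS h h0 (by omega)).head

/-- A vertex of the path in `T` at which the letter changes is the end of a run that the path
in `T'` meets. -/
theorem exists_runEnd_eq (h : Decr (father A) n) (h1 : 1 ≤ v) (h2 : v ≤ n) {j : ℕ} (hj : 2 ≤ j)
    (hr : Reach (father A) v j) (hA : A j ≠ father A j) :
    ∃ u, Reach (fatherS A) v u ∧ runEnd A u = j := by
  induction v using Nat.strong_induction_on with
  | _ v ih =>
    have hjv := h.reach_le h2 hr
    rcases reach_iff.1 hr with rfl | hr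
    · exact ⟨j, Reach.refl _ _, by rw [runEnd_eq h hj h2, if_neg hA]⟩
    · have hlt := h.2 v h1 h2
      have hv : 2 ≤ v := by omega
      obtain ⟨u, hu, hue⟩ := ih (father A v) hlt (father_pos A hv) (by omega) hr
      by_cases hA' : A v = father A v
      · rcases reach_iff.1 hu with rfl | hu
        · exact ⟨v, Reach.refl _ _, by rw [runEnd_eq h hv h2, if_pos hA', hue]⟩
        · refine ⟨u, Reach.head ?_, hue⟩
          rwa [fatherS_eq h hv h2, if_pos hA']
      · refine ⟨u, Reach.head ?_, hue⟩
        rwa [fatherS_eq h hv h2, if_neg hA']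

/-- Truncated subtraction is right: past the root the iterates are `0`, which has depth `0`. -/
theorem depthT_iterate (h : Decr (father A) n) (h2 : v ≤ n) (k : ℕ) :
    depthT A ((father A)^[k] v) = depthT A v - k := by
  induction k with
  | zero => rfl
  | succ k ih =>
    rw [Function.iterate_succ_apply']
    have hle := h.iterate_le h2 k
    rcases Nat.eq_zero_or_pos ((father A)^[k] v) with h0 | h0
    · rw [h0, depthT_zero] at ih
      rw [h0, h.1, depthT_zero]
      omega
    · have := depthT_eq h h0 (by omega)
      omega

theorem depthS_le_of_reach (h : Decr (father A) n) (h2 : v ≤ n) {u : ℕ}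
    (hr : Reach (father A) v u) : depthS A u ≤ depthS A v := by
  obtain ⟨k, rfl⟩ := hr
  induction k with
  | zero => exact le_rfl
  | succ k ih =>
    rw [Function.iterate_succ_apply']
    refine le_trans ?_ ih
    have hle := h.iterate_le h2 k
    generalize (father A)^[k] v = u at hle
    rcases Nat.lt_or_ge u 2 with hu | hu
    · rw [father_of_le_one A (by omega), depthS_zero]
      omega
    · rw [depthS_eq h hu (by omega)]
      split_ifs <;> omega

/-! ### Candidates -/

/-- `c` is a positive candidate at `i`: a vertex above `i` in `T` such that no vertex between
has the same letter. -/
def Cand {β : Type*} (A : ℕ → ℕ) (x : ℕ → β) (i c : ℕ) : Prop :=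
  1 ≤ c ∧ Reach (father A) (father A i) c ∧
    ∀ c', Reach (father A) (father A i) c' → 1 ≤ c' → x c' = x c → c' ≤ c

variable {β : Type*} {x : ℕ → β}

/-- In a path the depth in `T'` drops where the letter changes. -/
theorem PathWord.letter_eq (hx : PathWord A x n) (h2 : v ≤ n) {u : ℕ} (hu : 1 ≤ u)
    (hr : Reach (father A) v u) (hd : depthS A u = depthS A v) : x u = x v := by
  induction v using Nat.strong_induction_on with
  | _ v ih =>
    have h := hx.decr
    have huv := h.reach_le (h2.trans (by omega)) hr
    rcases reach_iff.1 hr with rfl | hr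
    · rfl
    · have hlt := h.2 v (by omega) (by omega)
      have hle := h.reach_le (n := n + 1) (by omega) hr
      have hv : 2 ≤ v := by omega
      have h3 := depthS_le_of_reach h (by omega) hr
      have h4 := depthS_eq h hv (by omega)
      split_ifs at h4 with hA
      · rw [ih _ hlt (by omega) hr (by omega), ← hA]
        exact ((hx v (by omega) h2).2.1 (by omega)).2
      · omega

/-- Equality of letters on a path depends on the array only. -/
theorem PathWord.letter_eq_iff {γ : Type*} {y : ℕ → γ} (hx : PathWord A x n)
    (hy : PathWord A y n) (h2 : v ≤ n) {u : ℕ} (hu : 1 ≤ u) (hr : Reach (father A) v u)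
    (he : x u = x v) : y u = y v := by
  induction v using Nat.strong_induction_on with
  | _ v ih =>
    have h := hx.decr
    have huv := h.reach_le (h2.trans (by omega)) hr
    rcases reach_iff.1 hr with rfl | hr
    · rfl
    · obtain ⟨hl, ha, hb⟩ := hx v (by omega) h2
      have hle := hb u hu hr he
      have hA := ha (by omega)
      have hy' := ((hy v (by omega) h2).2.1 (by omega)).2
      rw [← hy']
      have hf : father A v ≤ n + 1 := (h.le (by omega)).trans (by omega)
      exact ih _ hl (by omega) (h.reach_linear hf hA.1 hr hle) (by rw [he, hA.2])

/-- Being a candidate depends on equalities of letters on a single path, and the array determines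
these. -/
theorem Cand.of_pathWord {γ : Type*} {y : ℕ → γ} {i c : ℕ} (hx : PathWord A x n)
    (hy : PathWord A y n) (hi1 : 2 ≤ i) (hi : i ≤ n + 1) (hc : Cand A x i c) : Cand A y i c := by
  obtain ⟨h1, h2, h3⟩ := hc
  refine ⟨h1, h2, fun c' hr h1' he => ?_⟩
  by_contra hlt
  have h := hx.decr
  have hf := h.2 i (by omega) (by omega)
  have hr' := h.reach_linear (n := n + 1) (by omega) hr h2 (by omega)
  have := h.reach_le (n := n + 1) (by omega) hr
  exact hlt (h3 c' hr h1' (hy.letter_eq_iff hx (by omega) h1 hr' he.symm).symm)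

theorem pathWord_succ {γ : Type*} {y : ℕ → γ} (hx : PathWord A y n) :
    PathWord A y (n + 1) ↔ A (n + 1) < n + 1 ∧ (A (n + 1) ≠ 0 →
      Reach (father A) (father A (n + 1)) (A (n + 1)) ∧ y (A (n + 1)) = y (n + 1)) ∧
      ∀ c, 1 ≤ c → Reach (father A) (father A (n + 1)) c → y c = y (n + 1) → c ≤ A (n + 1) := by
  constructor
  · exact fun h => h _ (by omega) le_rfl
  · intro h i h1 h2
    rcases Nat.lt_or_ge i (n + 1) with hl | hl
    · exact hx i h1 (by omega)
    · obtain rfl : i = n + 1 := by omega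
      exact h

theorem PathWord.cand (hx : PathWord A x n) (h1 : 2 ≤ v) (h2 : v ≤ n) (h0 : A v ≠ 0) :
    Cand A x v (A v) := by
  obtain ⟨_, ha, hb⟩ := hx v (by omega) h2
  exact ⟨by omega, (ha h0).1, fun c' hr h1 he => hb c' h1 hr (he.trans (ha h0).2)⟩

theorem cand_father (hx : PathWord A x n) {i : ℕ} (h1 : 2 ≤ i) (h2 : i ≤ n + 1) :
    Cand A x i (father A i) := by
  have h := hx.decr
  have := h.2 i (by omega) h2
  exact ⟨father_pos A h1, Reach.refl _ _, fun c' hr _ _ => h.reach_le (by omega) hr⟩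

/-- The recurrence for the candidates. -/
theorem cand_iff (hx : PathWord A x n) {i c : ℕ} (h1 : 2 ≤ i) (h2 : i ≤ n + 1) :
    Cand A x i c ↔ c = father A i ∨
      (2 ≤ father A i ∧ Cand A x (father A i) c ∧ c ≠ A (father A i)) := by
  have h := hx.decr
  have hlt := h.2 i (by omega) h2
  have hp := father_pos A h1
  constructor
  · rintro ⟨hc, hr, hm⟩
    rcases reach_iff.1 hr with rfl | hr'
    · exact Or.inl rfl
    · right
      have hf2 : 2 ≤ father A i := by
        by_contra hf
        rw [father_of_le_one A (i := father A i) (by omega)] at hr'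
        exact absurd (h.reach_zero hr') (by omega)
      refine ⟨hf2, ⟨hc, hr', fun c' hr'' => hm c' hr''.head⟩, ?_⟩
      -- The father of `i` has the same letter as its value under `A` and is nearer to `i`.
      rintro rfl
      have := ((hx (father A i) (by omega) (by omega)).2.1 (by omega)).2
      have := hm _ (Reach.refl _ _) (by omega) this.symm
      have := hx.lt (father A i) (by omega) (by omega)
      omega
  · rintro (rfl | ⟨hf2, ⟨hc, hr, hm⟩, hne⟩)
    · exact cand_father hx h1 h2
    · refine ⟨hc, hr.head, fun c' hr' hc' he => ?_⟩
      rcases reach_iff.1 hr' with rfl | hr'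
      -- A candidate that has the letter of the father is the nearest vertex above the father with
      -- this letter, hence the value that was removed.
      · exfalso
        obtain ⟨hl, ha, hb⟩ := hx (father A i) (by omega) (by omega)
        have hle := hb c hc hr he.symm
        exact hne (le_antisymm hle (hm _ (ha (by omega)).1 (by omega) ((ha (by omega)).2.trans he)))
      · exact hm c' hr' hc' he

/-- Different candidates have different depths in `T'`. -/
theorem Cand.depthS_inj (hx : PathWord A x n) {i c c' : ℕ} (h1 : 2 ≤ i) (h2 : i ≤ n + 1)
    (hc : Cand A x i c) (hr : Reach (father A) (father A i) c') (hcc : c ≤ c')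
    (he : depthS A c = depthS A c') : c = c' := by
  have h := hx.decr
  have hlt := h.2 i (by omega) h2
  have hr' := h.reach_linear (n := n + 1) (by omega) hr hc.2.1 hcc
  have hle := h.reach_le (n := n + 1) (by omega) hr
  have := hx.letter_eq (by omega) hc.1 hr' he
  have h3 := hc.1
  exact le_antisymm hcc (hc.2.2 c' hr (by omega) this.symm)

/-- Clearing and setting bits mirrors `cand_iff`. Clearing the bit of one candidate removes no
other, because depths in T' separate candidates. -/
theorem testBit_candBits (hx : PathWord A x n) {i : ℕ} (h1 : 2 ≤ i) (h2 : i ≤ n + 1) (e : ℕ) :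
    (candBits A i).testBit e = true ↔ ∃ c, Cand A x i c ∧ depthS A c = e := by
  induction i using Nat.strong_induction_on generalizing e with
  | _ i ih =>
    have h := hx.decr
    have hlt := h.2 i (by omega) h2
    have hp := father_pos A h1
    rw [candBits_eq h h1 h2, testBit_setBit, Bool.or_eq_true, decide_eq_true_eq]
    have key : (if A (father A i) = 0 then candBits A (father A i) else
        clearBit (candBits A (father A i)) (depthS A (A (father A i)))).testBit e = true ↔
        ∃ c, (2 ≤ father A i ∧ Cand A x (father A i) c ∧ c ≠ A (father A i)) ∧
          depthS A c = e := by
      rcases Nat.lt_or_ge (father A i) 2 with hf | hf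
      · have e1 : father A i = 1 := by omega
        have := hx.lt 1 le_rfl (by omega)
        rw [e1, if_pos (by omega), candBits_of_le_one le_rfl]
        simp
      · have IH := ih (father A i) hlt hf (by omega)
        split_ifs with h0
        · rw [IH, h0]
          constructor
          · rintro ⟨c, hc, he⟩
            have := hc.1
            exact ⟨c, ⟨hf, hc, by omega⟩, he⟩
          · rintro ⟨c, hc, he⟩
            exact ⟨c, hc.2.1, he⟩
        · rw [testBit_clearBit, Bool.and_eq_true, decide_eq_true_eq, IH]
          constructor
          · rintro ⟨⟨c, hc, he⟩, hne⟩
            refine ⟨c, ⟨hf, hc, ?_⟩, he⟩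
            rintro rfl
            exact hne he
          · rintro ⟨c, ⟨_, hc, hne⟩, he⟩
            refine ⟨⟨c, hc, he⟩, fun he' => hne ?_⟩
            have hA := hx.cand hf (by omega) h0
            rcases le_total c (A (father A i)) with hle | hle
            · exact Cand.depthS_inj hx hf (by omega) hc hA.2.1 hle (by omega)
            · exact (Cand.depthS_inj hx hf (by omega) hA hc.2.1 hle (by omega)).symm
    rw [key]
    constructor
    · rintro (⟨c, hc, he⟩ | rfl)
      · exact ⟨c, (cand_iff hx h1 h2).2 (Or.inr hc), he⟩
      · exact ⟨_, cand_father hx h1 h2, rfl⟩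
    · rintro ⟨c, hc, he⟩
      rcases (cand_iff hx h1 h2).1 hc with rfl | hc
      · exact Or.inr he
      · exact Or.inl ⟨c, hc, he⟩

end

section

variable {A : ℕ → ℕ} {n v : ℕ} {β : Type*} {x : ℕ → β}

/-! ### The test of the algorithm -/

/-- Validate-π-RAM accepts the value `A[i]`. -/
def Accepted (A : ℕ → ℕ) (i : ℕ) : Prop :=
  if i = 1 then A 1 = 0 else A i = 0 ∨
    (A i < i ∧ A i = father A (queryT A i) ∧
      (queryT A i = i ∨ depthS A (queryT A i) ≠ depthS A (A i)) ∧
      (candBits A i).testBit (depthS A (A i)) = true)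

theorem Accepted.lt {i : ℕ} (h1 : 1 ≤ i) (h : Accepted A i) : A i < i := by
  unfold Accepted at h
  split_ifs at h with hi
  · subst hi
    omega
  · omega

/-- The level ancestor query finds the son of `a` on the path from `i`. -/
theorem levelAncestor_eq (h : Decr (father A) n) {i j : ℕ} (h2 : i ≤ n)
    (hr : Reach (father A) i j) (hj : 1 ≤ j) :
    levelAncestor (father A) i (depthT A i - depthT A (father A j) - 1) = j := by
  obtain ⟨k, rfl⟩ := hr
  have e := depthT_iterate h h2 k
  have hle := h.iterate_le h2 k
  have e' := depthT_eq h hj (by omega)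
  rw [levelAncestor]
  have : depthT A ((father A)^[k] i) ≠ 0 := by omega
  congr 1
  omega

/-- The bit only provides some candidate `c` with the depth of `A i`. If `c` is not nearer to `i`
than `A i`, injectivity of the depth gives equality. If it is nearer, the son `j` of `A i` lies
between them or equals `c`, and by monotonicity it has the same depth, which the test excludes.
Conversely, the query finds the son of a candidate; unless this is `i`, its letter differs from that
of the candidate, and so does its depth. -/
theorem accepted_iff_cand (hx : PathWord A x n) {i : ℕ} (h1 : 2 ≤ i) (h2 : i ≤ n + 1) :
    Accepted A i ↔ A i = 0 ∨ (A i ≠ 0 ∧ Cand A x i (A i)) := by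
  have h := hx.decr
  have hlt := h.2 i (by omega) h2
  unfold Accepted
  rw [if_neg (by omega)]
  by_cases h0 : A i = 0
  · simp [h0]
  simp only [h0, false_or, ne_eq, not_false_eq_true, true_and]
  constructor
  · rintro ⟨hl, hf, hd, hb⟩
    have hr : Reach (father A) i (queryT A i) := by
      rw [queryT_of_ne_zero h1 h0]
      exact ⟨_, rfl⟩
    generalize queryT A i = j at *
    rcases reach_iff.1 hr with rfl | hr'
    · rw [hf]
      exact cand_father hx h1 h2
    have hj := h.reach_le (n := n + 1) (by omega) hr'
    have hd' : depthS A j ≠ depthS A (A i) := by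
      rcases hd with rfl | hd
      · omega
      · exact hd
    have hra : Reach (father A) (father A i) (A i) := by
      rw [hf]
      exact hr'.trans (Reach.refl _ _).head
    obtain ⟨c, hc, he⟩ := (testBit_candBits hx h1 h2 _).1 hb
    rcases le_total c (A i) with hle | hle
    · rwa [← Cand.depthS_inj hx h1 h2 hc hra hle he]
    · rcases hle.eq_or_lt with heq | hlt'
      · rwa [heq]
      · exfalso
        -- the vertex `c` is above `j` or equal to it, or between `j` and its father
        have hcj : Reach (father A) c j := by
          refine h.reach_linear (n := n + 1) (by omega) hc.2.1 hr' ?_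
          by_contra hcj
          rcases reach_iff.1 (h.reach_linear (n := n + 1) (by omega) hr' hc.2.1 (by omega))
            with rfl | hr''
          · omega
          · have := h.reach_le (n := n + 1) ((h.le (by omega)).trans (by omega)) hr''
            omega
        have hc' := h.reach_le (n := n + 1) (by omega) hc.2.1
        have i1 := depthS_le_of_reach h (by omega) hcj
        have hja : Reach (father A) j (A i) := hf ▸ (Reach.refl _ _).head
        have i2 := depthS_le_of_reach h (by omega) hja
        omega
  · intro hc
    have hA := h.reach_le (n := n + 1) (by omega) hc.2.1
    -- the son of `A i` on the path
    obtain ⟨j, hr, hj, hf⟩ : ∃ j, Reach (father A) i j ∧ 1 ≤ j ∧ father A j = A i := by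
      obtain ⟨k, hk⟩ := hc.2.1
      rw [← Function.iterate_succ_apply, Function.iterate_succ_apply'] at hk
      refine ⟨_, ⟨k, rfl⟩, ?_, hk⟩
      by_contra hz
      rw [show (father A)^[k] i = 0 by omega, h.1] at hk
      omega
    have hq : queryT A i = j := by
      rw [queryT_of_ne_zero h1 h0, ← hf]
      exact levelAncestor_eq h h2 hr hj
    rw [hq]
    refine ⟨by omega, hf.symm, ?_, (testBit_candBits hx h1 h2 _).2 ⟨_, hc, rfl⟩⟩
    rcases reach_iff.1 hr with rfl | hr'
    · exact Or.inl rfl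
    right
    intro he
    have hj' := h.reach_le (n := n + 1) (by omega) hr'
    have hja : Reach (father A) j (A i) := hf ▸ (Reach.refl _ _).head
    have hl := hx.letter_eq (by omega) (by omega) hja he.symm
    have hm := hc.2.2 j hr' hj hl.symm
    have := h.2 j hj (by omega)
    omega

theorem PathWord.accepted (hx : PathWord A x n) {i : ℕ} (h1 : 1 ≤ i) (h2 : i ≤ n) :
    Accepted A i := by
  rcases Nat.lt_or_ge i 2 with hi | hi
  · obtain rfl : i = 1 := by omega
    have := hx.lt 1 le_rfl h2
    simp only [Accepted, if_true]
    omega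
  · rw [accepted_iff_cand hx hi (by omega)]
    by_cases h0 : A i = 0
    · exact Or.inl h0
    · exact Or.inr ⟨h0, hx.cand hi h2 h0⟩

/-! ### The minimal word -/

/-- The bound on the letters carries the induction: the path from the father uses only numbers up to
its `lettersT`, so at a value `0` the next number is new on the path. -/
theorem pathWord_letterAt (h : ∀ i, 1 ≤ i → i ≤ n → Accepted A i) :
    PathWord A (letterAt A) n ∧ ∀ v, v ≤ n → ∀ c, 1 ≤ c → Reach (father A) v c →
      1 ≤ letterAt A c ∧ letterAt A c ≤ lettersT A v := by
  induction n with
  | zero =>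
    refine ⟨fun i h1 h2 => by omega, fun v hv c hc hr => ?_⟩
    have h0 : Decr (father A) 0 := ⟨father_of_le_one A (by omega), fun v _ _ => by omega⟩
    obtain rfl : v = 0 := by omega
    exact absurd (h0.reach_zero hr) (by omega)
  | succ n ih =>
    obtain ⟨hx, hb⟩ := ih fun i h1 h2 => h i h1 (by omega)
    have hA := h (n + 1) (by omega) le_rfl
    have hlt := hA.lt (by omega)
    have hd := hx.decr
    have hf := hd.2 (n + 1) (by omega) le_rfl
    have hbf := hb (father A (n + 1)) (by omega)
    have hl := lettersT_eq hd (v := n + 1) (by omega) le_rfl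
    have hx' : PathWord A (letterAt A) (n + 1) := by
      rw [pathWord_succ hx]
      refine ⟨hlt, fun h0 => ?_, fun c hc hr he => ?_⟩
      · have h1 : 2 ≤ n + 1 := by omega
        refine ⟨?_, (letterAt_of_ne_zero h0 hlt).symm⟩
        have := (accepted_iff_cand hx h1 le_rfl).1 hA
        simp only [h0, false_or] at this
        exact this.2.2.1
      · by_cases h0 : A (n + 1) = 0
        · rw [letterAt_of_eq_zero (by omega) h0, hl, if_pos h0] at he
          have := hbf c hc hr
          omega
        · have h1 : 2 ≤ n + 1 := by omega
          have hC := (accepted_iff_cand hx h1 le_rfl).1 hA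
          simp only [h0, false_or] at hC
          rw [letterAt_of_ne_zero h0 hlt] at he
          exact hC.2.2.2 c hr hc he
    refine ⟨hx', fun v hv c hc hr => ?_⟩
    rcases Nat.lt_or_ge v (n + 1) with hv' | hv'
    · exact hb v (by omega) c hc hr
    · obtain rfl : v = n + 1 := by omega
      rcases reach_iff.1 hr with rfl | hr
      · by_cases h0 : A (n + 1) = 0
        · rw [letterAt_of_eq_zero (by omega) h0, hl, if_pos h0]
          omega
        · have := hx' (n + 1) (by omega) le_rfl
          rw [letterAt_of_ne_zero h0 hlt, hl, if_neg h0]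
          exact hbf _ (by omega) (this.2.1 h0).1
      · have := hbf c hc hr
        split_ifs at hl <;> omega

/-- On the path from `v` there are at least `lettersT A v` letters. -/
theorem exists_finset_letters (hx : PathWord A x n) (hv : v ≤ n) :
    ∃ S : Finset β, S.card = lettersT A v ∧ ∀ s ∈ S, ∃ c, 1 ≤ c ∧ Reach (father A) v c ∧ x c = s := by
  classical
  induction v using Nat.strong_induction_on with
  | _ v ih =>
    rcases Nat.eq_zero_or_pos v with rfl | hv0
    · exact ⟨∅, by simp [lettersT_zero], by simp⟩
    have hd := hx.decr
    have hf := hd.2 v hv0 (by omega)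
    obtain ⟨S, hS, hS'⟩ := ih _ hf (by omega)
    rw [lettersT_eq hd hv0 (by omega)]
    split_ifs with h0
    -- A value `0` says that no vertex above `v` has the letter of `v`.
    · refine ⟨insert (x v) S, ?_, ?_⟩
      · rw [Finset.card_insert_of_notMem, hS]
        intro hmem
        obtain ⟨c, hc, hr, he⟩ := hS' _ hmem
        have := (hx v hv0 hv).2.2 c hc hr he
        omega
      · intro s hs
        rcases Finset.mem_insert.1 hs with rfl | hs
        · exact ⟨v, hv0, Reach.refl _ _, rfl⟩
        · obtain ⟨c, hc, hr, he⟩ := hS' _ hs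
          exact ⟨c, hc, hr.head, he⟩
    · refine ⟨S, hS, fun s hs => ?_⟩
      obtain ⟨c, hc, hr, he⟩ := hS' _ hs
      exact ⟨c, hc, hr.head, he⟩

/-! ### Validity, candidates, and changes of the array -/

theorem isBorderArray_iff_accepted :
    IsBorderArray A n ↔ ∀ i, 1 ≤ i → i ≤ n → Accepted A i := by
  rw [isBorderArray_iff]
  exact ⟨fun ⟨_, _, hx⟩ i h1 h2 => hx.accepted h1 h2, fun h => ⟨_, _, (pathWord_letterAt h).1⟩⟩

theorem father_congr {B : ℕ → ℕ} {i : ℕ} (h : ∀ j, 1 ≤ j → j < i → A j = B j) :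
    father A i = father B i := by
  unfold father
  split_ifs
  · rfl
  · rw [h (i - 1) (by omega) (by omega)]

theorem iterate_congr {g g' : ℕ → ℕ} {m : ℕ} (hg : Decr g m) (he : ∀ v ≤ m, g v = g' v)
    (hv : v ≤ m) (k : ℕ) : g^[k] v = g'^[k] v := by
  induction k with
  | zero => rfl
  | succ k ih =>
    rw [Function.iterate_succ_apply', Function.iterate_succ_apply', ← ih]
    exact he _ (hg.iterate_le hv k |>.trans hv)

theorem reach_congr {g g' : ℕ → ℕ} {m u : ℕ} (hg : Decr g m) (he : ∀ v ≤ m, g v = g' v)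
    (hv : v ≤ m) : Reach g v u ↔ Reach g' v u := by
  unfold Reach
  simp only [iterate_congr hg he hv]

theorem PathWord.congr {B : ℕ → ℕ} (hx : PathWord A x n) (h : ∀ j, 1 ≤ j → j ≤ n → A j = B j) :
    PathWord B x n := by
  intro i h1 h2
  have hd := hx.decr
  have hf := hd.2 i h1 (by omega)
  have key : ∀ u, Reach (father A) (father A i) u ↔ Reach (father B) (father B i) u := by
    intro u
    rw [← father_congr (A := A) (B := B) (i := i) fun j a b => h j a (by omega)]
    exact reach_congr (hd.mono (m := n) (by omega))
      (fun v hv => father_congr fun j a b => h j a (by omega)) (by omega)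
  have := hx i h1 h2
  simp only [key, h i h1 h2] at this
  exact this

/-- The value at `i` has no influence on the path above `i`, so changing it preserves the
candidates. A candidate `c` is realised by giving position `i` the letter of `c`. -/
theorem isCandidate_iff (hx : PathWord A x n) {i c : ℕ} (h1 : 2 ≤ i) (h2 : i ≤ n + 1)
    (hc : 0 < c) : IsCandidate A i c ↔ Cand A x i c := by
  obtain ⟨m, rfl⟩ : ∃ m, i = m + 1 := ⟨i - 1, by omega⟩
  have hx := hx.mono (m := m) (by omega)
  have hd := hx.decr
  have hf := hd.2 (m + 1) (by omega) (by omega)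
  unfold IsCandidate
  set B := Function.update A (m + 1) c with hB
  have hBA : ∀ j, j ≠ m + 1 → B j = A j := fun j hj => by rw [hB, Function.update_of_ne hj]
  have hBc : B (m + 1) = c := by rw [hB, Function.update_self]
  have hff : father B (m + 1) = father A (m + 1) :=
    father_congr fun j a b => hBA j (by omega)
  have key : ∀ u, Reach (father A) (father A (m + 1)) u ↔
      Reach (father B) (father A (m + 1)) u := by
    intro u
    exact reach_congr (hd.mono (m := m) (by omega))
      (fun v hv => father_congr fun j a b => (hBA j (by omega)).symm) (by omega)
  rw [isBorderArray_iff]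
  constructor
  · rintro ⟨α, y, hy⟩
    have hyA : PathWord A y m :=
      (hy.mono (by omega)).congr fun j a b => hBA j (by omega)
    refine Cand.of_pathWord hyA hx (by omega) le_rfl ?_
    obtain ⟨_, ha, hb⟩ := hy (m + 1) (by omega) le_rfl
    rw [hBc, hff] at ha hb
    refine ⟨hc, (key _).2 (ha (by omega)).1, fun c' hr h1 he => hb c' h1 ((key _).1 hr) ?_⟩
    rw [he, (ha (by omega)).2]
  · intro hC
    -- The given word may live in another universe, whereas `IsBorderArray` asks for an alphabet in
    -- `Type`; the passage through `Accepted` provides one.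
    obtain ⟨α, y, hy⟩ : ∃ (α : Type) (y : ℕ → α), PathWord A y m := by
      rw [← isBorderArray_iff, isBorderArray_iff_accepted]
      exact fun i a b => hx.accepted a b
    have hC := hC.of_pathWord hx hy (by omega) le_rfl
    set z := Function.update y (m + 1) (y c) with hz
    have hzy : ∀ j, j ≠ m + 1 → z j = y j := fun j hj => by rw [hz, Function.update_of_ne hj]
    have hcm := (hd.reach_le (n := m + 1) (by omega) hC.2.1)
    refine ⟨α, z, ?_⟩
    have hBz : PathWord B z m := by
      refine (hy.of_letters fun u v a b c d => ?_).congr fun j a b => (hBA j (by omega)).symm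
      rw [hzy u (by omega), hzy v (by omega)]
    rw [pathWord_succ hBz, hBc, hff]
    have hzz : z (m + 1) = y c := by rw [hz, Function.update_self]
    refine ⟨by omega, fun _ => ⟨(key _).1 hC.2.1, ?_⟩, fun c' h1 hr he => ?_⟩
    · rw [hzz, hzy c (by omega)]
    · have hr := (key _).2 hr
      have := hd.reach_le (n := m + 1) (by omega) hr
      rw [hzz, hzy c' (by omega)] at he
      exact hC.2.2 c' hr h1 he

end

section

variable {A : ℕ → ℕ} {n v : ℕ} {β : Type*} {x : ℕ → β}

/-! ### The tables computed by the algorithm -/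

/-- The largest number of letters on a path in `T`. -/
def maxLetters (A : ℕ → ℕ) : ℕ → ℕ
  | 0 => 0
  | n + 1 => max (maxLetters A n) (lettersT A (n + 1))

/-- The tables `s` are those for `A[1..n]`. -/
structure Agree (A : ℕ → ℕ) (n : ℕ) (s : Tables) : Prop where
  len : s.len = n
  maxAlph : s.maxAlph = maxLetters A n
  zero : s.A 0 = 0 ∧ s.w 0 = 0 ∧ s.alph 0 = 0 ∧ s.d 0 = 0 ∧ s.d' 0 = 0 ∧ s.Bcand 0 = 0
  val : ∀ i, 1 ≤ i → i ≤ n → s.A i = A i ∧ s.w i = letterAt A i ∧ s.alph i = lettersT A i ∧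
    s.d i = depthT A i ∧ s.d' i = depthS A i ∧ s.Bcand i = candBits A i ∧ s.la i = queryT A i

theorem agree_push {s : Tables} (h : Agree A n s) :
    Agree A (n + 1) (s.push (A (n + 1)) (letterAt A (n + 1)) (lettersT A (n + 1))
      (depthT A (n + 1)) (depthS A (n + 1)) (candBits A (n + 1)) (queryT A (n + 1))) := by
  obtain ⟨h1, h2, h3, h4⟩ := h
  subst h1
  refine ⟨rfl, by simp [Tables.push, maxLetters, h2], by simp [Tables.push, h3], fun i hi hi' => ?_⟩
  rcases Nat.lt_or_ge i (s.len + 1) with hl | hl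
  · have hne : i ≠ s.len + 1 := by omega
    simpa [Tables.push, Function.update_of_ne hne] using h4 i hi (by omega)
  · obtain rfl : i = s.len + 1 := by omega
    simp [Tables.push]

/-- The tests are those of `Accepted`, on stored values. When the test is made, the entry of `d'` at
`i` is not stored yet, so the guard `j ≠ i` is essential. -/
theorem validateStep_eq {s : Tables} (h : Agree A n s)
    (hA : ∀ i, 1 ≤ i → i ≤ n → A i < i) :
    (Accepted A (n + 1) → validateStep s (A (n + 1)) =
      some (s.push (A (n + 1)) (letterAt A (n + 1)) (lettersT A (n + 1))
        (depthT A (n + 1)) (depthS A (n + 1)) (candBits A (n + 1)) (queryT A (n + 1)))) ∧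
    (¬ Accepted A (n + 1) → validateStep s (A (n + 1)) = none) := by
  have hd := decr_father hA
  obtain ⟨h1, h2, h3, h4⟩ := h
  subst h1
  unfold validateStep
  rcases Nat.eq_zero_or_pos s.len with h0 | h0
  · rw [h0] at hd ⊢
    simp only [Accepted, zero_add, if_true]
    constructor
    · intro ha
      rw [if_pos ha, ha, letterAt_of_eq_zero le_rfl ha, depthT_eq hd le_rfl le_rfl, depthS_one,
        lettersT_eq hd le_rfl le_rfl, if_pos ha, candBits_of_le_one le_rfl, queryT_of_eq_zero ha,
        father_of_le_one A le_rfl, lettersT_zero, depthT_zero]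
    · intro ha
      rw [if_neg ha]
  have hfA : ∀ v, v ≤ s.len + 1 → father A v = father s.A v := by
    intro v hv
    exact father_congr fun j a b => (h4 j a (by omega)).1.symm
  have hf2 := hd.2 (s.len + 1) (by omega) le_rfl
  have hf1 := father_pos A (i := s.len + 1) (by omega)
  have hf := h4 (father A (s.len + 1)) hf1 (by omega)
  have hdT : depthT A (s.len + 1) = s.d (father A (s.len + 1)) + 1 := by
    rw [depthT_eq hd (by omega) le_rfl, hf.2.2.2.1]
  have hdS : depthS A (s.len + 1) = if A (s.len + 1) = father A (s.len + 1) then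
      s.d' (father A (s.len + 1)) else s.d' (father A (s.len + 1)) + 1 := by
    rw [depthS_eq hd (by omega) le_rfl, hf.2.2.2.2.1]
  have hB : candBits A (s.len + 1) = s.nextBcand := by
    rw [candBits_eq hd (by omega) le_rfl, Tables.nextBcand]
    simp only [← hfA _ le_rfl]
    rw [hf.1, hf.2.2.2.2.1, hf.2.2.2.2.2.1]
    split_ifs with hz
    · rfl
    · have := hA (father A (s.len + 1)) hf1 (by omega)
      rw [(h4 (A (father A (s.len + 1))) (by omega) (by omega)).2.2.2.2.1]
  have hne : s.len + 1 ≠ 1 := by omega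
  simp only [hne, if_false, ← hfA _ le_rfl, Accepted]
  by_cases ha : A (s.len + 1) = 0
  · simp only [ha, if_true, true_or, forall_const, not_true_eq_false, false_imp_iff, and_true]
    rw [letterAt_of_eq_zero (by omega) ha, lettersT_eq hd (by omega) le_rfl, if_pos ha,
      queryT_of_eq_zero ha, hf.2.2.1, hB, hdT, hdS, ha]
  simp only [ha, if_false, false_or]
  by_cases hl : s.len + 1 ≤ A (s.len + 1)
  · simp only [hl, if_true]
    exact ⟨fun h => by omega, fun _ => trivial⟩
  simp only [hl, if_false]
  have hAA := h4 (A (s.len + 1)) (by omega) (by omega)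
  have hq : levelAncestor (father s.A) (s.len + 1)
      (s.d (father A (s.len + 1)) + 1 - s.d (A (s.len + 1)) - 1) = queryT A (s.len + 1) := by
    rw [queryT_of_ne_zero (by omega) ha, hdT, ← hAA.2.2.2.1]
    exact (iterate_congr hd hfA le_rfl _).symm
  rw [hq]
  have hqr : Reach (father A) (s.len + 1) (queryT A (s.len + 1)) := by
    rw [queryT_of_ne_zero (by omega) ha]
    exact ⟨_, rfl⟩
  have hql := hd.reach_le le_rfl hqr
  rw [← hfA _ hql, ← hB, hAA.2.2.2.2.1]
  by_cases c1 : A (s.len + 1) = father A (queryT A (s.len + 1))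
  · rw [if_neg (by simpa using c1)]
    have hq0 : 1 ≤ queryT A (s.len + 1) := by
      by_contra hc
      rw [father_of_le_one A (by omega)] at c1
      exact ha c1
    have hdq : queryT A (s.len + 1) ≠ s.len + 1 →
        s.d' (queryT A (s.len + 1)) = depthS A (queryT A (s.len + 1)) := fun hne =>
      (h4 _ hq0 (by omega)).2.2.2.2.1
    by_cases c2 : queryT A (s.len + 1) = s.len + 1 ∨
        depthS A (queryT A (s.len + 1)) ≠ depthS A (A (s.len + 1))
    · rw [if_neg (by
        rintro ⟨n1, n2⟩
        rw [hdq n1] at n2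
        tauto)]
      by_cases c3 : (candBits A (s.len + 1)).testBit (depthS A (A (s.len + 1))) = true
      · rw [if_neg (by simp [c3])]
        refine ⟨fun _ => ?_, fun hn => absurd ⟨by omega, c1, c2, c3⟩ hn⟩
        rw [letterAt_of_ne_zero ha (by omega), lettersT_eq hd (by omega) le_rfl, if_neg ha,
          hf.2.2.1, hdT, hdS, hAA.2.1]
      · rw [if_pos (by simpa using c3)]
        exact ⟨fun h => absurd h.2.2.2 c3, fun _ => rfl⟩
    · push Not at c2
      rw [if_pos ⟨c2.1, by rw [hdq c2.1]; exact c2.2⟩]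
      refine ⟨fun h => ?_, fun _ => rfl⟩
      rcases h.2.2.1 with h | h
      · exact absurd h c2.1
      · exact absurd c2.2 h
  · rw [if_pos c1]
    exact ⟨fun h => absurd h.2.1 c1, fun _ => rfl⟩

theorem validate_spec (A : ℕ → ℕ) (n : ℕ) :
    ((∀ i, 1 ≤ i → i ≤ n → Accepted A i) ∧ ∃ s, validate A n = some s ∧ Agree A n s) ∨
    (¬ (∀ i, 1 ≤ i → i ≤ n → Accepted A i) ∧ validate A n = none) := by
  induction n with
  | zero =>
    refine Or.inl ⟨fun i h1 h2 => by omega, Tables.empty, rfl, rfl, rfl, ?_, fun i h1 h2 => by omega⟩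
    simp [Tables.empty]
  | succ n ih =>
    rcases ih with ⟨h, s, hs, ha⟩ | ⟨h, hs⟩
    · have hlt : ∀ i, 1 ≤ i → i ≤ n → A i < i := fun i h1 h2 => (h i h1 h2).lt h1
      have hst := validateStep_eq ha hlt
      by_cases hA : Accepted A (n + 1)
      · left
        refine ⟨fun i h1 h2 => ?_, _, ?_, agree_push ha⟩
        · rcases Nat.lt_or_ge i (n + 1) with hl | hl
          · exact h i h1 (by omega)
          · obtain rfl : i = n + 1 := by omega
            exact hA
        · rw [validate, hs, Option.bind_some, hst.1 hA]
      · right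
        refine ⟨fun h' => hA (h' _ (by omega) le_rfl), ?_⟩
        rw [validate, hs, Option.bind_some, hst.2 hA]
    · right
      refine ⟨fun h' => h fun i h1 h2 => h' i h1 (by omega), ?_⟩
      rw [validate, hs, Option.bind_none]

theorem validate_isSome_iff (A : ℕ → ℕ) (n : ℕ) :
    (validate A n).isSome = true ↔ IsBorderArray A n := by
  rw [isBorderArray_iff_accepted]
  rcases validate_spec A n with ⟨h, s, hs, _⟩ | ⟨h, hs⟩
  · simpa [hs] using h
  · simpa only [hs, Option.isSome_none, Bool.false_eq_true, false_iff] using h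

/-! ### The minimal alphabet and the fathers in T' -/

theorem maxLetters_ge {i : ℕ} (h1 : 1 ≤ i) (h2 : i ≤ n) : lettersT A i ≤ maxLetters A n := by
  induction n with
  | zero => omega
  | succ n ih =>
    rw [maxLetters]
    rcases Nat.lt_or_ge i (n + 1) with hl | hl
    · exact (ih (by omega)).trans (le_max_left _ _)
    · obtain rfl : i = n + 1 := by omega
      exact le_max_right _ _

theorem maxLetters_le {m : ℕ} (h : ∀ i, 1 ≤ i → i ≤ n → lettersT A i ≤ m) :
    maxLetters A n ≤ m := by
  induction n with
  | zero => exact Nat.zero_le _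
  | succ n ih =>
    exact max_le (ih fun i h1 h2 => h i h1 (by omega)) (h _ (by omega) le_rfl)

theorem word_getElem? (s : Tables) {k : ℕ} (h1 : 1 ≤ k) (h2 : k ≤ s.len) :
    s.word[k - 1]? = some (s.w k) := by
  rw [Tables.word, List.getElem?_map, List.getElem?_range (by omega)]
  simp [Nat.sub_add_cancel h1]

/-- The minimal word, shifted by one, uses `Fin` of this size. Conversely, a path with the most
letters has that many in every word. -/
theorem isLeast_alphabetSizes (h : ∀ i, 1 ≤ i → i ≤ n → Accepted A i) :
    IsLeast (alphabetSizes A n) (maxLetters A n) := by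
  obtain ⟨hx, hb⟩ := pathWord_letterAt h
  constructor
  · have hb' : ∀ c, 1 ≤ c → c ≤ n → 1 ≤ letterAt A c ∧ letterAt A c ≤ maxLetters A n :=
      fun c h1 h2 => by
        have := hb c h2 c h1 (Reach.refl _ _)
        exact ⟨this.1, this.2.trans (maxLetters_ge h1 h2)⟩
    refine ⟨Fin (maxLetters A n), inferInstance,
      List.ofFn (n := n) fun i => ⟨letterAt A (i + 1) - 1, ?_⟩, by simp, ?_⟩
    · have := hb' (i + 1) (by omega) (by omega)
      omega
    · rw [isFailureArray_iff, fa_iff_pathWord]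
      refine ⟨by simp, hx.of_letters fun u v h1 h2 h3 h4 => ?_⟩
      have b1 := hb' u h1 h2
      have b2 := hb' v h3 h4
      simp only [List.getElem?_ofFn, show u - 1 < n by omega, show v - 1 < n by omega, dif_pos,
        Option.some_inj, Fin.mk.injEq, Nat.sub_add_cancel h1, Nat.sub_add_cancel h3]
      omega
  · rintro m ⟨α, hα, w, rfl, hw⟩
    rw [isFailureArray_iff, fa_iff_pathWord] at hw
    refine maxLetters_le fun i h1 h2 => ?_
    obtain ⟨S, hS, hS'⟩ := exists_finset_letters hw.2 h2
    classical
    rw [← hS]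
    -- The positions on the path are inside the word, so the letters in `S` are all of the form
    -- `some a`.
    refine (Finset.card_le_card (t := Finset.univ.image some) fun s hs => ?_).trans
      (Finset.card_image_le.trans (by simp))
    obtain ⟨c, hc, hr, he⟩ := hS' s hs
    have := hw.2.decr.reach_le (n := n + 1) (by omega) hr
    have hc' : c - 1 < w.length := by omega
    simp only [List.getElem?_eq_getElem hc'] at he
    simp [← he]

/-- The borders in question belong to the vertices above `v` with a letter other than that of `v`,
and the nearest of these is the vertex right above the run of `v`. -/
theorem strongFather_eq {α : Type} {w : List α} (hw : w.length = n)
    (hx : PathWord A (fun k => w[k - 1]?) n) (h1 : 1 ≤ v) (h2 : v ≤ n) :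
    strongFather w v = fatherS A v := by
  have hF := fa_iff_pathWord.2 hx
  have hd := hx.decr
  have hset : ∀ v, 1 ≤ v → v ≤ n → {c : ℕ | ∃ u : List α, IsProperBorder u (w.take (v - 1)) ∧
      c = u.length + 1 ∧ w[u.length]? ≠ w[v - 1]?} =
      {c | 1 ≤ c ∧ Reach (father A) (father A v) c ∧ w[c - 1]? ≠ w[v - 1]?} := by
    intro v h1 h2
    ext c
    simp only [Set.mem_ofPred_eq]
    rcases Nat.lt_or_ge v 2 with hv | hv
    · obtain rfl : v = 1 := by omega
      constructor
      · rintro ⟨u, hu, _⟩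
        exact absurd hu.2.2 (by simp)
      · rintro ⟨hc, hr, _⟩
        rw [father_of_le_one A le_rfl] at hr
        exact absurd (hd.reach_zero hr) (by omega)
    constructor
    · rintro ⟨u, hu, rfl, hne⟩
      refine ⟨by omega, ?_, by simpa using hne⟩
      rw [reach_iff_bd hF v hv (by omega) _ (by omega)]
      exact (isProperBorder_iff w (by omega)).1 ⟨u, hu, rfl⟩
    · rintro ⟨hc, hr, hne⟩
      rw [reach_iff_bd hF v hv (by omega) _ hc] at hr
      obtain ⟨u, hu, hl⟩ := (isProperBorder_iff w (by omega)).2 hr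
      exact ⟨u, hu, by omega, by rw [hl]; exact hne⟩
  rw [strongFather, hset v h1 h2]
  induction v using Nat.strong_induction_on with
  | _ v ih =>
    have hf := hd.2 v h1 (by omega)
    rcases Nat.lt_or_ge v 2 with hv | hv
    · obtain rfl : v = 1 := by omega
      rw [fatherS_one, father_of_le_one A le_rfl]
      -- Vertex 1 has no father in T': the supremum of the empty set is `0`.
      refine Eq.trans (congrArg sSup ?_) (csSup_empty (α := ℕ))
      ext c
      simp only [Set.mem_ofPred_eq, Set.mem_empty_iff_false, iff_false]
      rintro ⟨hc, hr, _⟩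
      exact absurd (hd.reach_zero hr) (by omega)
    · have hp := father_pos A hv
      obtain ⟨hl, ha, hb⟩ := hx v h1 h2
      rw [fatherS_eq hd hv (by omega)]
      split_ifs with hA
      · have hxe := (ha (by omega)).2
        simp only at hxe
        rw [← ih _ hf hp (by omega)]
        congr 1
        ext c
        simp only [Set.mem_ofPred_eq]
        rw [← hA, hxe, hA]
        refine and_congr_right fun hc => ?_
        constructor
        · rintro ⟨hr, hne⟩
          rcases reach_iff.1 hr with rfl | hr
          · rw [← hA] at hne
            exact absurd hxe hne
          · exact ⟨hr, hne⟩
        · rintro ⟨hr, hne⟩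
          exact ⟨hr.head, hne⟩
      · refine IsGreatest.csSup_eq ⟨⟨hp, Reach.refl _ _, fun he => hA ?_⟩, fun c hc => ?_⟩
        · have h3 := hb _ hp (Reach.refl _ _) he
          have h4 := hd.reach_le (n := n + 1) (by omega) (ha (by omega)).1
          omega
        · exact hd.reach_le (n := n + 1) (by omega) hc.2.1

theorem validate_tables {s : Tables} (hs : validate A n = some s) :
    IsFailureArray s.word A n ∧ (∀ x ∈ s.word, 1 ≤ x ∧ x ≤ s.maxAlph) ∧
      IsLeast (alphabetSizes A n) s.maxAlph ∧ IsDepth (father A) s.d n ∧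
      IsDepth (strongFather s.word) s.d' n ∧
      (∀ i, 1 ≤ i → i ≤ n → ∀ e : ℕ, (s.Bcand i).testBit e = true ↔
        ∃ c, 0 < c ∧ IsCandidate A i c ∧ s.d' c = e) := by
  rcases validate_spec A n with ⟨h, s', hs', ha⟩ | ⟨_, hn⟩
  swap
  · rw [hn] at hs
    cases hs
  obtain rfl : s' = s := Option.some_inj.1 (hs'.symm.trans hs)
  clear hs'
  obtain ⟨hx, hb⟩ := pathWord_letterAt h
  have hd := hx.decr
  have hlen : s'.word.length = n := by simp [Tables.word, ha.len]
  have hxw : PathWord A (fun k => s'.word[k - 1]?) n := by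
    refine hx.of_letters fun u v h1 h2 h3 h4 => ?_
    rw [word_getElem? s' h1 (by rw [ha.len]; exact h2),
      word_getElem? s' h3 (by rw [ha.len]; exact h4), Option.some_inj,
      (ha.val u h1 h2).2.1, (ha.val v h3 h4).2.1]
  refine ⟨?_, ?_, ?_, ?_, ?_, ?_⟩
  · rw [isFailureArray_iff, fa_iff_pathWord]
    exact ⟨hlen, hxw⟩
  · intro y hy
    rw [Tables.word, List.mem_map] at hy
    obtain ⟨i, hi, rfl⟩ := hy
    rw [List.mem_range, ha.len] at hi
    rw [(ha.val (i + 1) (by omega) (by omega)).2.1, ha.maxAlph]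
    have := hb (i + 1) (by omega) (i + 1) (by omega) (Reach.refl _ _)
    exact ⟨this.1, this.2.trans (maxLetters_ge (by omega) (by omega))⟩
  · rw [ha.maxAlph]
    exact isLeast_alphabetSizes h
  · intro i h1 h2
    have hf := hd.2 i h1 (by omega)
    rw [(ha.val i h1 h2).2.2.2.1, depthT_eq hd h1 (by omega)]
    split_ifs with h0
    · rw [h0, depthT_zero]
    · rw [(ha.val (father A i) (by omega) (by omega)).2.2.2.1]
  · intro i h1 h2
    have hf := (decr_fatherS hd).2 i h1 (by omega)
    rw [strongFather_eq hlen hxw h1 h2, (ha.val i h1 h2).2.2.2.2.1,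
      depthS_fatherS hd h1 (by omega)]
    split_ifs with h0
    · rw [h0, depthS_zero]
    · rw [(ha.val (fatherS A i) (by omega) (by omega)).2.2.2.2.1]
  · intro i h1 h2 e
    rw [(ha.val i h1 h2).2.2.2.2.2.1]
    rcases Nat.lt_or_ge i 2 with hi | hi
    · obtain rfl : i = 1 := by omega
      rw [candBits_of_le_one le_rfl, Nat.zero_testBit]
      simp only [Bool.false_eq_true, false_iff, not_exists, not_and]
      intro c hc hcand
      obtain ⟨α, y, hy⟩ := (isBorderArray_iff _ _).1 hcand
      have := hy.lt 1 le_rfl le_rfl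
      rw [Function.update_self] at this
      omega
    · rw [testBit_candBits hx hi (by omega)]
      have hf := hd.2 i h1 (by omega)
      have key : ∀ c, Cand A (letterAt A) i c → s'.d' c = depthS A c := fun c hc =>
        (ha.val c hc.1 (by
          have := hd.reach_le (n := n + 1) (by omega) hc.2.1
          omega)).2.2.2.2.1
      constructor
      · rintro ⟨c, hc, he⟩
        exact ⟨c, hc.1, (isCandidate_iff hx hi (by omega) hc.1).2 hc, by rw [key c hc, he]⟩
      · rintro ⟨c, h0, hc, he⟩
        have hc := (isCandidate_iff hx hi (by omega) h0).1 hc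
        exact ⟨c, hc, by rw [← key c hc, he]⟩

/-! ### The height of `T'` -/

/-- All letters of a run are equal, and if the vertex above it had the same letter, the run would
not end there. -/
theorem PathWord.letter_fatherS_ne (hx : PathWord A x n) (h2 : v ≤ n) (h0 : 1 ≤ fatherS A v) :
    x (fatherS A v) ≠ x v := by
  have hd := hx.decr
  have hv : 1 ≤ v := by
    by_contra hc
    rw [show v = 0 by omega, fatherS_zero] at h0
    omega
  obtain ⟨a1, a2, a3, a4, a5⟩ := runEnd_spec hd hv (by omega)
  have he := hx.letter_eq h2 a2 a1 a4
  rw [← he]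
  have hj : 2 ≤ runEnd A v := by
    by_contra hc
    rw [fatherS, father_of_le_one A (by omega)] at h0
    omega
  intro hc
  obtain ⟨hl, ha, hb⟩ := hx (runEnd A v) a2 (by omega)
  have h3 := hb _ h0 (Reach.refl _ _) hc
  have h4 := hd.reach_le (n := n + 1) ((hd.le (by omega)).trans (by omega)) (ha (by omega)).1
  exact a5 hj (le_antisymm h4 h3)

/-- Two steps up in `T'` at least halve a position: periods overlap too little. -/
theorem PathWord.fatherS_add_le (hx : PathWord A x n) (h2 : v ≤ n) :
    fatherS A v + fatherS A (fatherS A v) ≤ v := by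
  have hd := hx.decr
  have hF := fa_iff_pathWord.2 hx
  have hle := (decr_fatherS hd).le (v := v) (by omega)
  rcases Nat.eq_zero_or_pos (fatherS A (fatherS A v)) with h0 | h0
  · omega
  have hv1 : 1 ≤ fatherS A v := by
    by_contra hc
    rw [show fatherS A v = 0 by omega, fatherS_zero] at h0
    omega
  have hlt1 := (decr_fatherS hd).2 v (by omega) (by omega)
  have hlt2 := (decr_fatherS hd).2 _ hv1 (by omega)
  have b1 := (reach_iff_bd hF v (by omega) (by omega) _ hv1).1 (reach_fatherS hd (by omega) (by omega))
  have b2 := (reach_iff_bd hF (fatherS A v) (by omega) (by omega) _ h0).1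
    (reach_fatherS hd hv1 (by omega))
  have hne := hx.letter_fatherS_ne (v := fatherS A v) (by omega) h0
  generalize fatherS A (fatherS A v) = v2 at *
  generalize fatherS A v = v1 at *
  by_contra hlt
  apply hne
  -- `q = v1 + v2 - v` is a position
  have e1 := b1.2 (v1 + v2 - v) (by omega) (by omega)
  have e2 := b2.2 (v1 + v2 - v) (by omega) (by omega)
  have e4 := b1.2 v2 (by omega) (by omega)
  have f1 : v - 1 - (v1 - 1) + (v1 + v2 - v) = v2 := by omega
  have f2 : v1 - 1 - (v2 - 1) + (v1 + v2 - v) = v1 + v1 - v := by omega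
  rw [f1] at e1
  rw [f2] at e2
  have e5 := b1.2 (v1 + v1 - v) (by omega) (by omega)
  have f3 : v - 1 - (v1 - 1) + (v1 + v1 - v) = v1 := by omega
  rw [f3] at e5
  -- Write `v`, `v1`, `v2` for the path. Shifting by the periods `v - v1`, `v1 - v2`, `v - v1` shows
  -- that `q` has the letter of `v2`, of `2 * v1 - v`, and finally of `v1`.
  rw [← e1, e2, e5]

/-- Two levels cost a factor of 2 in the position, hence a factor of 4 in its square; the leading 4
pays for the last one or two levels. -/
theorem PathWord.two_pow_depthS_le (hx : PathWord A x n) (h1 : 1 ≤ v) (h2 : v ≤ n) :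
    2 ^ depthS A v ≤ 4 * v ^ 2 := by
  induction v using Nat.strong_induction_on with
  | _ v ih =>
    have hd := hx.decr
    have hs := hx.fatherS_add_le h2
    have hl := (decr_fatherS hd).2 v h1 (by omega)
    have e1 := depthS_fatherS hd h1 (by omega)
    have hv : 1 ≤ v ^ 2 := Nat.one_le_pow _ _ h1
    rcases Nat.eq_zero_or_pos (fatherS A v) with h0 | h0
    · rw [e1, h0, depthS_zero]
      omega
    have hl2 := (decr_fatherS hd).2 _ h0 (by omega)
    have e2 := depthS_fatherS hd h0 (by omega)
    rcases Nat.eq_zero_or_pos (fatherS A (fatherS A v)) with h0' | h0'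
    · rw [e1, e2, h0', depthS_zero]
      omega
    have := ih (fatherS A (fatherS A v)) (by omega) h0' (by omega)
    rw [e1, e2, pow_succ, pow_succ]
    have h4 : 2 * fatherS A (fatherS A v) ≤ v := by omega
    have := Nat.pow_le_pow_left h4 2
    rw [mul_pow] at this
    omega

end

section

/-! ### Loop-free programs for the RAM -/

/-- Runs of the machine with `b`-bit words that access only addresses below `X`. -/
inductive Run (P : List Instr) (A : ℕ → ℕ) (b X : ℕ) : Config → ℕ → Config → Prop
  | refl {c : Config} (h : c.Fits b) : Run P A b X c 0 c
  | step {c c' : Config} {t : ℕ} (h : c.Fits b) (ha : ∀ x, c.Accesses P x → x < X)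
      (hr : Run P A b X (c.step P A) t c') : Run P A b X c (t + 1) c'

section Run
variable {P : List Instr} {A : ℕ → ℕ} {b X : ℕ}

theorem Run.trans {c c' c'' : Config} {t t' : ℕ} (h : Run P A b X c t c')
    (h' : Run P A b X c' t' c'') : Run P A b X c (t + t') c'' := by
  induction h with
  | refl _ => simpa using h'
  | step hf ha _ ih => 
    rw [Nat.add_right_comm]
    exact Run.step hf ha (ih h')

theorem Run.fits {c c' : Config} {t : ℕ} (h : Run P A b X c t c') : c'.Fits b := by
  induction h with
  | refl h => exact h
  | step _ _ _ ih => exact ih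

theorem Run.spec {c c' : Config} {t : ℕ} (h : Run P A b X c t c') :
    (Config.step P A)^[t] c = c' ∧ (∀ u < t, ∀ x, ((Config.step P A)^[u] c).Accesses P x → x < X) ∧
      ∀ u ≤ t, ((Config.step P A)^[u] c).Fits b := by
  induction h with
  | refl h =>
    refine ⟨rfl, fun u hu => by omega, fun u hu => ?_⟩
    obtain rfl : u = 0 := by omega
    exact h
  | step hf ha _ ih =>
    obtain ⟨h1, h2, h3⟩ := ih
    refine ⟨h1, fun u hu => ?_, fun u hu => ?_⟩
    · cases u with
      | zero => exact ha
      | succ u => exact h2 u (by omega)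
    · cases u with
      | zero => exact hf
      | succ u => exact h3 u (by omega)

theorem Config.Fits.update_reg {c : Config} (h : c.Fits b) {r v pc pos : ℕ} (hv : v < 2 ^ b) :
    Config.Fits { c with pc := pc, reg := Function.update c.reg r v, pos := pos } b := by
  refine ⟨fun s => ?_, h.2⟩
  by_cases hs : s = r
  · subst hs
    simpa using hv
  · simpa [Function.update_of_ne hs] using h.1 s

theorem run_const {c : Config} {r v : ℕ} (hp : P[c.pc]? = some (.const r v)) (h : c.Fits b)
    (hv : v < 2 ^ b) :
    Run P A b X c 1 { c with pc := c.pc + 1, reg := Function.update c.reg r v } := by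
  refine Run.step h (fun x hx => ?_) ?_
  · obtain ⟨u, v, h | h⟩ := hx <;> simp [hp] at h
  · simp only [Config.step, hp]
    exact Run.refl (h.update_reg hv)

theorem run_op {c : Config} {o : WordOp} {r x y : ℕ} (hp : P[c.pc]? = some (.op o r x y))
    (h : c.Fits b) (hv : o.eval (c.reg x) (c.reg y) < 2 ^ b) :
    Run P A b X c 1 { c with
      pc := c.pc + 1, reg := Function.update c.reg r (o.eval (c.reg x) (c.reg y)) } := by
  refine Run.step h (fun x hx => ?_) ?_
  · obtain ⟨u, v, h | h⟩ := hx <;> simp [hp] at h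
  · simp only [Config.step, hp]
    exact Run.refl (h.update_reg hv)

theorem run_load {c : Config} {r x : ℕ} (hp : P[c.pc]? = some (.load r x)) (h : c.Fits b)
    (hv : c.reg x < X) :
    Run P A b X c 1 { c with
      pc := c.pc + 1, reg := Function.update c.reg r (c.mem (c.reg x)) } := by
  refine Run.step h (fun y hy => ?_) ?_
  · obtain ⟨u, v, h | h⟩ := hy <;> simp [hp] at h
    obtain ⟨⟨_, rfl⟩, rfl⟩ := h
    exact hv
  · simp only [Config.step, hp]
    exact Run.refl (h.update_reg (h.2 _))

theorem run_store {c : Config} {x y : ℕ} (hp : P[c.pc]? = some (.store x y)) (h : c.Fits b)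
    (hv : c.reg x < X) :
    Run P A b X c 1 { c with
      pc := c.pc + 1, mem := Function.update c.mem (c.reg x) (c.reg y) } := by
  refine Run.step h (fun z hz => ?_) ?_
  · obtain ⟨u, v, h | h⟩ := hz <;> simp [hp] at h
    obtain ⟨⟨rfl, _⟩, rfl⟩ := h
    exact hv
  · simp only [Config.step, hp]
    refine Run.refl ⟨h.1, fun z => ?_⟩
    by_cases hs : z = c.reg x
    · subst hs
      simpa using h.1 y
    · simpa [Function.update_of_ne hs] using h.2 z

theorem run_jumpZero {c : Config} {x l : ℕ} (hp : P[c.pc]? = some (.jumpZero x l)) (h : c.Fits b) :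
    Run P A b X c 1 { c with pc := if c.reg x = 0 then l else c.pc + 1 } := by
  refine Run.step h (fun z hz => ?_) ?_
  · obtain ⟨u, v, h | h⟩ := hz <;> simp [hp] at h
  · simp only [Config.step, hp]
    exact Run.refl h

theorem run_read {c : Config} {r : ℕ} (hp : P[c.pc]? = some (.read r)) (h : c.Fits b)
    (hv : A (c.pos + 1) < 2 ^ b) :
    Run P A b X c 1 { c with
      pc := c.pc + 1, reg := Function.update c.reg r (A (c.pos + 1)), pos := c.pos + 1 } := by
  refine Run.step h (fun x hx => ?_) ?_
  · obtain ⟨u, v, h | h⟩ := hx <;> simp [hp] at h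
  · simp only [Config.step, hp]
    exact Run.refl (h.update_reg hv)

end Run

/-- Loop-free programs. The memory is seen as 20 columns: `ld d k x` and `st k x y` access the cell
of column `k` whose index is in register `x`. -/
inductive Stmt
  | const (r v : ℕ)
  | op (o : WordOp) (d x y : ℕ)
  | ld (d k x : ℕ)
  | st (k x y : ℕ)
  | seq (s t : Stmt)
  | ite (x : ℕ) (s t : Stmt)

/-- Registers and columns. -/
structure St where
  reg : ℕ → ℕ
  col : ℕ → ℕ → ℕ

def St.set (σ : St) (r v : ℕ) : St := { σ with reg := Function.update σ.reg r v }

def St.put (σ : St) (k m v : ℕ) : St :=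
  { σ with col := Function.update σ.col k (Function.update (σ.col k) m v) }

/-- The programs use registers below 60 and columns below 20 only. -/
def Stmt.wf : Stmt → Bool
  | .const r _ => decide (r < 60)
  | .op _ d x y => decide (d < 60) && decide (x < 60) && decide (y < 60)
  | .ld d k x => decide (d < 60) && decide (k < 20) && decide (x < 60)
  | .st k x y => decide (k < 20) && decide (x < 60) && decide (y < 60)
  | .seq s t => s.wf && t.wf
  | .ite x s t => decide (x < 60) && s.wf && t.wf

/-- The number of instructions. -/
def Stmt.size : Stmt → ℕ
  | .const _ _ => 1
  | .op _ _ _ _ => 1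
  | .ld _ _ _ => 5
  | .st _ _ _ => 5
  | .seq s t => s.size + t.size
  | .ite _ s t => t.size + s.size + 3

/-- The instructions at position `l` of a program, with the cell of index `x` in column `k` at
address `20 * x + k`. -/
def Stmt.compile : Stmt → ℕ → List Instr
  | .const r v, _ => [.const r v]
  | .op o d x y, _ => [.op o d x y]
  | .ld d k x, _ =>
      [.const 60 20, .op .mul 60 60 x, .const 61 k, .op .add 60 60 61, .load d 60]
  | .st k x y, _ =>
      [.const 60 20, .op .mul 60 60 x, .const 61 k, .op .add 60 60 61, .store 60 y]
  | .seq s t, l => s.compile l ++ t.compile (l + s.size)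
  | .ite x s t, l => [.jumpZero x (l + t.size + 3)] ++ t.compile (l + 1) ++
      [.const 60 0, .jumpZero 60 (l + t.size + s.size + 3)] ++ s.compile (l + t.size + 3)

theorem Stmt.length_compile (s : Stmt) (l : ℕ) : (s.compile l).length = s.size := by
  induction s generalizing l with
  | seq s t hs ht => simp [compile, size, hs, ht]
  | ite x s t hs ht => simp [compile, size, hs, ht]; omega
  | _ => rfl

/-- Operations that can make words longer. -/
def WordOp.Fine (b : ℕ) : WordOp → ℕ → ℕ → Prop
  | .add, x, y => x + y < 2 ^ b
  | .mul, x, y => x * y < 2 ^ b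
  | .shl, x, y => x <<< y < 2 ^ b
  | _, _, _ => True

theorem WordOp.Fine.eval_lt {b : ℕ} {o : WordOp} {x y : ℕ} (h : o.Fine b x y) (hx : x < 2 ^ b)
    (hy : y < 2 ^ b) : o.eval x y < 2 ^ b := by
  cases o with
  | add => exact h
  | mul => exact h
  | shl => exact h
  | sub => exact (Nat.sub_le _ _).trans_lt hx
  | div => exact (Nat.div_le_self _ _).trans_lt hx
  | mod => exact (Nat.mod_le _ _).trans_lt hx
  | and => exact Nat.and_lt_two_pow _ hy
  | or => exact Nat.or_lt_two_pow hx hy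
  | xor => exact Nat.xor_lt_two_pow hx hy
  | shr =>
    simp only [eval, Nat.shiftRight_eq_div_pow]
    exact (Nat.div_le_self _ _).trans_lt hx

/-- The program `s` can be run from the state with words of `b` bits and indices at most `N`, and
then `Q` holds. -/
def Stmt.wp (b N : ℕ) : Stmt → (St → Prop) → St → Prop
  | .const r v, Q, σ => v < 2 ^ b ∧ Q (σ.set r v)
  | .op o d x y, Q, σ => o.Fine b (σ.reg x) (σ.reg y) ∧ Q (σ.set d (o.eval (σ.reg x) (σ.reg y)))
  | .ld d k x, Q, σ => σ.reg x ≤ N ∧ Q (σ.set d (σ.col k (σ.reg x)))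
  | .st k x y, Q, σ => σ.reg x ≤ N ∧ Q (σ.put k (σ.reg x) (σ.reg y))
  | .seq s t, Q, σ => s.wp b N (t.wp b N Q) σ
  | .ite x s t, Q, σ => if σ.reg x = 0 then s.wp b N Q σ else t.wp b N Q σ

/-- The configuration shows the state. -/
def Sim (c : Config) (σ : St) : Prop :=
  (∀ r < 60, c.reg r = σ.reg r) ∧ ∀ x, c.mem x = σ.col (x % 20) (x / 20)

/-- The code is at position `l` of the program. -/
def CodeAt (P : List Instr) (l : ℕ) (code : List Instr) : Prop :=
  ∀ k < code.length, P[l + k]? = code[k]?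

theorem CodeAt.left {P : List Instr} {l : ℕ} {u v : List Instr} (h : CodeAt P l (u ++ v)) :
    CodeAt P l u := by
  intro k hk
  rw [h k (by simp; omega), List.getElem?_append_left hk]

theorem CodeAt.right {P : List Instr} {l : ℕ} {u v : List Instr} (h : CodeAt P l (u ++ v)) :
    CodeAt P (l + u.length) v := by
  intro k hk
  rw [add_assoc, h (u.length + k) (by simp; omega), List.getElem?_append_right (by omega),
    Nat.add_sub_cancel_left]

theorem codeAt_append (u v t : List Instr) : CodeAt (u ++ v ++ t) u.length v := by
  intro k hk
  rw [List.append_assoc, List.getElem?_append_right (by omega), Nat.add_sub_cancel_left,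
    List.getElem?_append_left hk]

section Sound
variable {P : List Instr} {A : ℕ → ℕ} {b N X : ℕ}

theorem Sim.set {c : Config} {σ : St} (h : Sim c σ) (r v pc pos : ℕ) :
    Sim { c with pc := pc, reg := Function.update c.reg r v, pos := pos } (σ.set r v) := by
  refine ⟨fun s hs => ?_, h.2⟩
  simp only [St.set, Function.update_apply]
  split_ifs
  · rfl
  · exact h.1 s hs

theorem Sim.scratch {c : Config} {σ : St} (h : Sim c σ) (r v pc pos : ℕ) (hr : 60 ≤ r) :
    Sim { c with pc := pc, reg := Function.update c.reg r v, pos := pos } σ := by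
  refine ⟨fun s hs => ?_, h.2⟩
  simp only [Function.update_of_ne (show s ≠ r by omega)]
  exact h.1 s hs

/-- The code that computes the address of a cell. -/
theorem run_address {c : Config} {σ : St} {k x : ℕ} (hsim : Sim c σ) (hk : k < 20) (hx : x < 60)
    (hX : 20 * (N + 1) < X) (hb : X ≤ 2 ^ b) (hf : c.Fits b) (hxN : σ.reg x ≤ N)
    (hp0 : P[c.pc]? = some (.const 60 20)) (hp1 : P[c.pc + 1]? = some (.op .mul 60 60 x))
    (hp2 : P[c.pc + 2]? = some (.const 61 k)) (hp3 : P[c.pc + 3]? = some (.op .add 60 60 61)) :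
    ∃ c', Run P A b X c 4 c' ∧ c'.pc = c.pc + 4 ∧ c'.pos = c.pos ∧ Sim c' σ ∧
      c'.reg 60 = 20 * σ.reg x + k := by
  have r1 := run_const (A := A) (X := X) hp0 hf (by omega)
  have r2 := run_op (A := A) (X := X) (c := { c with
    pc := c.pc + 1, reg := Function.update c.reg 60 20 }) hp1 r1.fits (by
      simp only [WordOp.eval, Function.update_self, Function.update_of_ne (show x ≠ 60 by omega),
        hsim.1 x hx]
      omega)
  have r3 := run_const (A := A) (X := X) hp2 r2.fits (by omega)
  have r4 := run_op (A := A) (X := X) hp3 r3.fits (by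
      simp only [WordOp.eval, Function.update_self, Function.update_of_ne (show 60 ≠ 61 by omega),
        Function.update_of_ne (show x ≠ 60 by omega), hsim.1 x hx]
      omega)
  refine ⟨_, r1.trans (r2.trans (r3.trans r4)), rfl, rfl, ⟨fun s hs => ?_, hsim.2⟩, ?_⟩
  · simp only [Function.update_of_ne (show s ≠ 60 by omega),
      Function.update_of_ne (show s ≠ 61 by omega), hsim.1 s hs]
  simp only [WordOp.eval, Function.update_self, Function.update_of_ne (show 60 ≠ 61 by omega),
    Function.update_of_ne (show x ≠ 60 by omega), hsim.1 x hx]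

/-- All jumps lead forwards, so the running time is at most the number of instructions. The bounds
`hX` and `hb` ensure that the address of a cell with an index up to `N` fits into a word. -/
theorem Stmt.wp_sound (hX : 20 * (N + 1) < X) (hb : X ≤ 2 ^ b) (s : Stmt) (hwf : s.wf = true)
    {l : ℕ} (hc : CodeAt P l (s.compile l)) {c : Config} {σ : St} (hsim : Sim c σ) (hpc : c.pc = l)
    (hf : c.Fits b) {Q : St → Prop} (hwp : s.wp b N Q σ) :
    ∃ t c' σ', t ≤ s.size ∧ Run P A b X c t c' ∧ c'.pc = l + s.size ∧ c'.pos = c.pos ∧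
      Sim c' σ' ∧ Q σ' := by
  induction s generalizing l c σ Q with
  | const r v =>
    have h0 := hc 0 (by simp [compile])
    simp only [compile, add_zero, ← hpc] at h0
    exact ⟨1, _, _, le_rfl, run_const h0 hf hwp.1, by simp [hpc, size], rfl, hsim.set _ _ _ _,
      hwp.2⟩
  | op o d x y =>
    have h0 := hc 0 (by simp [compile])
    simp only [compile, add_zero, ← hpc] at h0
    simp only [wf, Bool.and_eq_true, decide_eq_true_eq] at hwf
    have e1 := hsim.1 x hwf.1.2
    have e2 := hsim.1 y hwf.2
    refine ⟨1, _, _, le_rfl, run_op h0 hf ?_, by simp [hpc, size], rfl, ?_, hwp.2⟩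
    · rw [e1, e2]
      exact hwp.1.eval_lt (by rw [← e1]; exact hf.1 _) (by rw [← e2]; exact hf.1 _)
    · rw [e1, e2]
      exact hsim.set _ _ _ _
  | ld d k x =>
    simp only [wf, Bool.and_eq_true, decide_eq_true_eq] at hwf
    have h := fun j hj => hc j (by simpa [compile] using hj)
    obtain ⟨c', hr, hpc', hpos, hs', ha⟩ := run_address (P := P) (A := A) hsim hwf.1.2 hwf.2 hX hb
      hf hwp.1 (by rw [hpc]; exact h 0 (by omega)) (by rw [hpc]; exact h 1 (by omega))
      (by rw [hpc]; exact h 2 (by omega)) (by rw [hpc]; exact h 3 (by omega))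
    have h4 : P[c'.pc]? = some (.load d 60) := by
      rw [hpc', hpc]; exact h 4 (by omega)
    have hN := hwp.1
    have r5 := run_load (A := A) (X := X) h4 hr.fits (by omega)
    refine ⟨5, _, _, le_rfl, hr.trans r5, by simp [hpc, hpc', size], hpos, ?_, hwp.2⟩
    have e : c'.mem (c'.reg 60) = σ.col k (σ.reg x) := by
      rw [ha, hs'.2, show (20 * σ.reg x + k) % 20 = k by omega,
        show (20 * σ.reg x + k) / 20 = σ.reg x by omega]
    rw [e]
    exact hs'.set _ _ _ _
  | st k x y =>
    simp only [wf, Bool.and_eq_true, decide_eq_true_eq] at hwf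
    have h := fun j hj => hc j (by simpa [compile] using hj)
    obtain ⟨c', hr, hpc', hpos, hs', ha⟩ := run_address (P := P) (A := A) hsim hwf.1.1 hwf.1.2 hX hb
      hf hwp.1 (by rw [hpc]; exact h 0 (by omega)) (by rw [hpc]; exact h 1 (by omega))
      (by rw [hpc]; exact h 2 (by omega)) (by rw [hpc]; exact h 3 (by omega))
    have h4 : P[c'.pc]? = some (.store 60 y) := by
      rw [hpc', hpc]; exact h 4 (by omega)
    have hN := hwp.1
    have r5 := run_store (A := A) (X := X) h4 hr.fits (by omega)
    refine ⟨5, _, σ.put k (σ.reg x) (σ.reg y), le_rfl, hr.trans r5, by simp [hpc, hpc', size], hpos,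
      ⟨hs'.1, fun z => ?_⟩, hwp.2⟩
    simp only [St.put, Function.update_apply, ha]
    rw [hs'.1 y hwf.2]
    by_cases hz : z = 20 * σ.reg x + k
    · subst hz
      simp [show (20 * σ.reg x + k) % 20 = k by omega,
        show (20 * σ.reg x + k) / 20 = σ.reg x by omega]
    · rw [if_neg hz, hs'.2]
      by_cases hk : z % 20 = k
      · rw [if_pos hk, Function.update_apply, if_neg (by omega), hk]
      · rw [if_neg hk]
  | seq s t hs ht =>
    simp only [wf, Bool.and_eq_true] at hwf
    obtain ⟨t1, c1, σ1, h1, r1, p1, q1, s1, w1⟩ := hs hwf.1 hc.left hsim hpc hf hwp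
    have hc2 := hc.right
    rw [length_compile] at hc2
    obtain ⟨t2, c2, σ2, h2, r2, p2, q2, s2, w2⟩ := ht hwf.2 hc2 s1 p1 r1.fits w1
    exact ⟨t1 + t2, c2, σ2, by simp only [size]; omega, r1.trans r2, by simp only [size]; omega,
      by omega, s2, w2⟩
  | ite x s t hs ht =>
    simp only [wf, Bool.and_eq_true, decide_eq_true_eq] at hwf
    simp only [compile] at hc
    subst hpc
    have hcs := hc.right
    have hcj := hc.left.right
    have hct := hc.left.left.right
    have hc0 := hc.left.left.left 0 (by simp)
    simp only [List.length_append, List.length_cons, List.length_nil, length_compile] at hcs hcj hct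
    rw [show c.pc + (0 + 1 + t.size + (0 + 1 + 1)) = c.pc + t.size + 3 by omega] at hcs
    rw [add_zero] at hc0
    have r0 := run_jumpZero (A := A) (X := X) hc0 hf
    simp only [wp] at hwp
    rw [← hsim.1 x hwf.1.1] at hwp
    have hsim0 : Sim { c with pc := if c.reg x = 0 then c.pc + t.size + 3 else c.pc + 1 } σ := hsim
    split_ifs at hwp r0 hsim0 with h0
    · obtain ⟨t1, c1, σ1, h1, r1, p1, q1, s1, w1⟩ :=
        hs hwf.1.2 hcs hsim0 (by simp only) r0.fits hwp
      exact ⟨1 + t1, c1, σ1, by simp only [size]; omega, r0.trans r1,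
        by simp only [size]; omega, q1, s1, w1⟩
    · obtain ⟨t1, c1, σ1, h1, r1, p1, q1, s1, w1⟩ :=
        ht hwf.2 hct hsim0 (by simp only) r0.fits hwp
      have j0 := hcj 0 (by simp)
      have j1 := hcj 1 (by simp)
      rw [show c.pc + (0 + 1 + t.size) + 0 = c1.pc by omega] at j0
      rw [show c.pc + (0 + 1 + t.size) + 1 = c1.pc + 1 by omega] at j1
      -- A conditional jump on a register just set to `0` serves as the unconditional jump over the
      -- other branch.
      have r2 := run_const (A := A) (X := X) j0 r1.fits (Nat.two_pow_pos b)
      have r3 := run_jumpZero (A := A) (X := X) j1 r2.fits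
      simp only [Function.update_self, if_true] at r3
      refine ⟨1 + (t1 + (1 + 1)), _, σ1, by simp only [size]; omega,
        r0.trans (r1.trans (r2.trans r3)), by simp only [size]; omega, q1, ?_, w1⟩
      exact s1.scratch _ _ _ _ le_rfl

end Sound

end

section

/-! ### Arithmetic of bit names -/

/-- Lifting the exponent: `2 ^ d ≡ 1` modulo 3 forces `d = 2 * e`, and the 3-adic valuation of `4 ^
e - 1` exceeds that of `e` by one. -/
theorem three_pow_dvd_of_dvd {k d : ℕ} (h : 3 ^ (k + 1) ∣ 2 ^ d - 1) : 3 ^ k ∣ d := by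
  rcases Nat.eq_zero_or_pos d with rfl | hd
  · exact dvd_zero _
  -- the exponent is even, since `2 ^ d` is `1` modulo `3`
  have h3 : 3 ∣ 2 ^ d - 1 := (dvd_pow_self 3 (by omega)).trans h
  have hm : ∀ e, 2 ^ (2 * e) % 3 = 1 := by
    intro e
    rw [pow_mul, Nat.pow_mod]
    norm_num
  obtain ⟨e, rfl | rfl⟩ : ∃ e, d = 2 * e ∨ d = 2 * e + 1 := ⟨d / 2, by omega⟩
  · have hp : 1 ≤ 2 ^ (2 * e) := Nat.one_le_two_pow
    have : Fact (Nat.Prime 3) := ⟨Nat.prime_three⟩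
    have hv := padicValNat.pow_sub_pow (p := 3) (x := 4) (y := 1) (by decide) (by omega)
      (by norm_num) (by norm_num) (n := e) (by omega)
    rw [one_pow, show (4 - 1 : ℕ) = 3 from rfl, padicValNat_self] at hv
    have h4 : 3 ^ (k + 1) ∣ 4 ^ e - 1 := by
      rwa [show (4 : ℕ) = 2 ^ 2 from rfl, ← pow_mul]
    have hne : 4 ^ e - 1 ≠ 0 := by
      have : 4 ^ 1 ≤ 4 ^ e := Nat.pow_le_pow_right (by norm_num) (by omega)
      omega
    rw [padicValNat_dvd_iff_le hne, hv] at h4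
    refine Dvd.dvd.mul_left ?_ 2
    rw [padicValNat_dvd_iff_le (by omega)]
    omega
  · have := hm e
    rw [pow_succ] at h3
    omega

/-- This is a perfect hash function: single bits with exponents below `3 ^ k` get distinct cells
among `3 ^ (k + 1)`, without computing the exponents. -/
theorem two_pow_mod_inj {k i j : ℕ} (hi : i < 3 ^ k) (hj : j < 3 ^ k)
    (h : 2 ^ i % 3 ^ (k + 1) = 2 ^ j % 3 ^ (k + 1)) : i = j := by
  wlog hij : i ≤ j generalizing i j
  · exact (this hj hi h.symm (by omega)).symm
  have h1 : 3 ^ (k + 1) ∣ 2 ^ j - 2 ^ i := (Nat.modEq_iff_dvd' (Nat.pow_le_pow_right (by norm_num) hij)).1 h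
  have h2 : 2 ^ j - 2 ^ i = 2 ^ i * (2 ^ (j - i) - 1) := by
    rw [Nat.mul_sub, ← pow_add, mul_one, Nat.add_sub_cancel' hij]
  rw [h2] at h1
  have h3 : Nat.Coprime (3 ^ (k + 1)) (2 ^ i) := Nat.Coprime.pow _ _ (by norm_num)
  have h4 := three_pow_dvd_of_dvd (h3.dvd_of_dvd_mul_left h1)
  have h5 := Nat.eq_zero_of_dvd_of_lt h4 (by omega)
  omega

/-- The lowest set bit. -/
def lowBit (y : ℕ) : ℕ := y ^^^ (y &&& (y - 1))

theorem lowBit_two_pow (s : ℕ) : lowBit (2 ^ s) = 2 ^ s := by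
  rw [lowBit, Nat.and_two_pow_sub_one_eq_mod, Nat.mod_self, Nat.xor_zero]

/-- Going down to a son adds a bit on top of the mask; this leaves the lowest set bit alone. -/
theorem lowBit_add_two_pow {y s : ℕ} (h0 : y ≠ 0) (h : y < 2 ^ s) :
    lowBit (y + 2 ^ s) = lowBit y := by
  have e1 : y + 2 ^ s = 2 ^ s ||| y := by
    have := Nat.two_pow_add_eq_or_of_lt h 1
    rw [mul_one] at this
    omega
  have e2 : y + 2 ^ s - 1 = 2 ^ s ||| (y - 1) := by
    have := Nat.two_pow_add_eq_or_of_lt (show y - 1 < 2 ^ s by omega) 1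
    rw [mul_one] at this
    omega
  rw [lowBit, lowBit, e2, e1]
  apply Nat.eq_of_testBit_eq
  intro t
  simp only [Nat.testBit_xor, Nat.testBit_and, Nat.testBit_or, Nat.testBit_two_pow]
  by_cases ht : s = t
  · subst ht
    simp [Nat.testBit_lt_two_pow h]
  · simp [ht]

/-! ### Clusters -/

/-- The data structure for the forest `T'`: for every vertex its cluster (named by the root of the
cluster), its own bit and the mask of the bits on the path from the root of the cluster; for every
cluster the bit `nb` for the next vertex, and two arrays of names, at `bo` for the bits below `lo`
and at `bn` for the bits below `ln`. The second one is followed by a table of the vertices above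
the root, which is complete up to (and without) the vertex `cur`. -/
structure CS where
  cl : ℕ → ℕ
  mask : ℕ → ℕ
  bit : ℕ → ℕ
  nb : ℕ → ℕ
  M : ℕ → ℕ
  lo : ℕ → ℕ
  ln : ℕ → ℕ
  bo : ℕ → ℕ
  bn : ℕ → ℕ
  cur : ℕ → ℕ
  aux : ℕ → ℕ
  free : ℕ

/-- The forest with fathers `g` and depths `D` on the vertices `1, …, n`. -/
structure IsForest (g D : ℕ → ℕ) (n : ℕ) : Prop where
  decr : Decr g n
  zero : D 0 = 0
  depth : ∀ v, 1 ≤ v → v ≤ n → D v = D (g v) + 1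

/-- The invariant of the clusters: cluster `r` is in stage `k r`, in which its arrays serve the
exponents below `3 ^ k r` of bits; its table has `tc r` entries; `own` tells which cluster and which
stage a cell belongs to. The search for sons uses that the powers of two with exponents below
`3 ^ k` are distinct modulo `3 ^ (k + 1)`. -/
structure CInv (g D : ℕ → ℕ) (n : ℕ) (S : CS) (k tc : ℕ → ℕ) (own : ℕ → ℕ × ℕ) : Prop where
  cl_zero : S.cl 0 = 0
  cur_zero : S.cur 0 = 0
  cl : ∀ v, 1 ≤ v → v ≤ n → 1 ≤ S.cl v ∧ S.cl v ≤ v ∧ S.cl (S.cl v) = S.cl v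
  inner : ∀ v, 1 ≤ v → v ≤ n → S.cl v ≠ v → S.cl (g v) = S.cl v ∧
    ∃ l, S.bit v = 2 ^ l ∧ S.mask (g v) < 2 ^ l ∧ S.mask v = S.mask (g v) + 2 ^ l
  root : ∀ v, 1 ≤ v → v ≤ n → S.cl v = v → S.mask v = 1 ∧ S.bit v = 1 ∧ S.cur (S.cl (g v)) = 0
  lt : ∀ v, 1 ≤ v → v ≤ n → S.bit v < S.nb (S.cl v)
  old : ∀ v, 1 ≤ v → v ≤ n → S.bit v < S.lo (S.cl v) →
    S.aux (S.bo (S.cl v) + S.bit v % (S.M (S.cl v) / 3)) = v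
  copied : ∀ v, 1 ≤ v → v ≤ n → S.bit v < S.lo (S.cl v) →
    S.bit v * S.lo (S.cl v) < S.nb (S.cl v) →
    S.aux (S.bn (S.cl v) + S.bit v % S.M (S.cl v)) = v
  new : ∀ v, 1 ≤ v → v ≤ n → S.lo (S.cl v) ≤ S.bit v →
    S.aux (S.bn (S.cl v) + S.bit v % S.M (S.cl v)) = v
  stage : ∀ r, 1 ≤ r → r ≤ n → S.cl r = r → 1 ≤ k r ∧ S.M r = 3 ^ (k r + 1) ∧
    S.lo r = 2 ^ 3 ^ (k r - 1) ∧ S.ln r = 2 ^ 3 ^ k r ∧ S.nb r = 2 ^ (3 ^ (k r - 1) + tc r) ∧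
    3 ^ (k r - 1) + tc r ≤ 3 ^ k r ∧ 3 ^ k r ≤ 5 * D r
  table : ∀ r, 1 ≤ r → r ≤ n → S.cl r = r → tc r ≤ D r ∧ S.cur r = g^[tc r] r ∧
    ∀ t < tc r, S.aux (S.bn r + S.M r + t) = g^[t] r
  room : ∀ r, 1 ≤ r → r ≤ n → S.cl r = r →
    S.bn r + 2 * S.M r ≤ S.free ∧ S.bo r + S.M r / 3 ≤ S.free
  own_old : ∀ r, 1 ≤ r → r ≤ n → S.cl r = r → ∀ y < S.M r / 3, own (S.bo r + y) = (r, k r - 1)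
  own_new : ∀ r, 1 ≤ r → r ≤ n → S.cl r = r → ∀ y < 2 * S.M r, own (S.bn r + y) = (r, k r)
  space : S.free + ∑ v ∈ Finset.Icc 1 n, (if S.cl v = v then 27 * tc v + 6 else 0) ≤ 27 * n

/-! ### Queries in the clusters -/

section Query
variable {g D : ℕ → ℕ} {n : ℕ} {S : CS} {k tc : ℕ → ℕ} {own : ℕ → ℕ × ℕ}

theorem IsForest.iterate (hF : IsForest g D n) {v : ℕ} (hv : v ≤ n) (m : ℕ) :
    D (g^[m] v) = D v - m := by
  induction m with
  | zero => rfl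
  | succ m ih =>
    rw [Function.iterate_succ_apply']
    have hle := hF.decr.iterate_le hv m
    rcases Nat.eq_zero_or_pos (g^[m] v) with h0 | h0
    · rw [h0, hF.zero] at ih
      rw [h0, hF.decr.1, hF.zero]
      omega
    · have := hF.depth _ h0 (by omega)
      omega

theorem IsForest.eq_zero (hF : IsForest g D n) {v : ℕ} (hv : v ≤ n) (h : D v = 0) : v = 0 := by
  by_contra h0
  have := hF.depth v (by omega) hv
  omega

/-- A vertex gets a bit above the whole mask of its father, so its own bit is the top bit of its
mask. -/
theorem CInv.bit_pow (h : CInv g D n S k tc own) {v : ℕ} (h1 : 1 ≤ v) (h2 : v ≤ n) :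
    ∃ l, S.bit v = 2 ^ l ∧ 2 ^ l ≤ S.mask v ∧ S.mask v < 2 ^ (l + 1) := by
  by_cases hr : S.cl v = v
  · obtain ⟨a, b, _⟩ := h.root v h1 h2 hr
    exact ⟨0, by simp [b], by simp [a], by simp [a]⟩
  · obtain ⟨_, l, a, b, c⟩ := h.inner v h1 h2 hr
    exact ⟨l, a, by omega, by rw [pow_succ]; omega⟩

theorem CInv.reach_cl (h : CInv g D n S k tc own) (hF : IsForest g D n) {v : ℕ} (h1 : 1 ≤ v)
    (h2 : v ≤ n) : Reach g v (S.cl v) := by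
  induction v using Nat.strong_induction_on with
  | _ v ih =>
    by_cases hr : S.cl v = v
    · rw [hr]
      exact Reach.refl _ _
    · have hi := (h.inner v h1 h2 hr).1
      have hlt := hF.decr.2 v h1 h2
      have hc := (h.cl v h1 h2).1
      have h0 : 1 ≤ g v := by
        by_contra h0
        rw [show g v = 0 by omega, h.cl_zero] at hi
        omega
      rw [← hi]
      exact (ih (g v) hlt h0 (by omega)).head

/-- Clusters are connected, so a path leaves a cluster only through its root. -/
theorem CInv.reach_cases (h : CInv g D n S k tc own) (hF : IsForest g D n) {v a : ℕ}
    (h1 : 1 ≤ v) (h2 : v ≤ n) (ha : 1 ≤ a) (hr : Reach g v a) :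
    S.cl a = S.cl v ∨ Reach g (g (S.cl v)) a := by
  induction v using Nat.strong_induction_on with
  | _ v ih =>
    rcases reach_iff.1 hr with rfl | hr
    · exact Or.inl rfl
    · have hlt := hF.decr.2 v h1 h2
      have := hF.decr.reach_le (n := n) (by omega) hr
      by_cases hc : S.cl v = v
      · rw [hc]
        exact Or.inr hr
      · rw [← (h.inner v h1 h2 hc).1]
        exact ih (g v) hlt (by omega) (by omega) hr

theorem CInv.bit_le_mask (h : CInv g D n S k tc own) (hF : IsForest g D n) {v a : ℕ}
    (h1 : 1 ≤ v) (h2 : v ≤ n) (ha : 1 ≤ a) (hr : Reach g v a) (hc : S.cl a = S.cl v) :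
    S.bit a ≤ S.mask v := by
  induction v using Nat.strong_induction_on with
  | _ v ih =>
    rcases reach_iff.1 hr with rfl | hr
    · obtain ⟨l, e1, e2, _⟩ := h.bit_pow h1 h2
      omega
    · have hlt := hF.decr.2 v h1 h2
      have hle := hF.decr.reach_le (n := n) (by omega) hr
      by_cases hv : S.cl v = v
      · have := (h.cl a ha (by omega)).2.1
        omega
      · obtain ⟨e1, l, e2, e3, e4⟩ := h.inner v h1 h2 hv
        have := ih (g v) hlt (by omega) (by omega) hr (by rw [hc, e1])
        omega

/-- In a cluster the son of `a` on the path from `v` has the lowest bit of the mask above the bit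
of `a`. -/
theorem CInv.exists_child (h : CInv g D n S k tc own) (hF : IsForest g D n) {v a : ℕ}
    (h1 : 1 ≤ v) (h2 : v ≤ n) (ha1 : 1 ≤ a) (ha2 : a ≤ n) (hc : S.cl a = S.cl v) :
    (Reach g (g v) a → S.mask v / (2 * S.bit a) ≠ 0) ∧
    (S.mask v / (2 * S.bit a) ≠ 0 → ∃ u, 1 ≤ u ∧ Reach g v u ∧ S.cl u = S.cl v ∧
      S.bit u = lowBit (S.mask v / (2 * S.bit a)) * (2 * S.bit a) ∧
      (Reach g (g v) a → g u = a)) := by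
  obtain ⟨m, hm, hm1, hm2⟩ := h.bit_pow ha1 ha2
  have hpm : 2 * S.bit a = 2 ^ (m + 1) := by rw [hm, pow_succ]; omega
  rw [hpm]
  induction v using Nat.strong_induction_on with
  | _ v ih =>
    have hlt := hF.decr.2 v h1 h2
    by_cases hv : S.cl v = v
    · obtain ⟨e1, e2, _⟩ := h.root v h1 h2 hv
      rw [e1, Nat.div_eq_of_lt (Nat.one_lt_two_pow (by omega))]
      refine ⟨fun hr => ?_, fun h => absurd rfl h⟩
      have := hF.decr.reach_le (n := n) (by omega) hr
      have := (h.cl a ha1 ha2).2.1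
      omega
    · obtain ⟨e1, l, e2, e3, e4⟩ := h.inner v h1 h2 hv
      have h0 : 1 ≤ g v := by
        by_contra h0
        rw [show g v = 0 by omega, h.cl_zero] at e1
        have := (h.cl v h1 h2).1
        omega
      obtain ⟨ih1, ih2⟩ := ih (g v) hlt h0 (by omega) (by rw [hc, e1])
      have hbm : Reach g (g v) a → m < l := by
        intro hr
        have := h.bit_le_mask hF h0 (by omega) ha1 hr (by rw [hc, e1])
        rw [hm] at this
        exact (Nat.pow_lt_pow_iff_right (by norm_num)).1 (this.trans_lt e3)
      rcases Nat.lt_or_ge m l with hl | hl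
      · obtain ⟨s, rfl⟩ : ∃ s, l = m + 1 + s := ⟨l - (m + 1), by omega⟩
        have hdiv : S.mask v / 2 ^ (m + 1) = S.mask (g v) / 2 ^ (m + 1) + 2 ^ s := by
          rw [e4, pow_add, Nat.add_mul_div_left _ _ (Nat.two_pow_pos _)]
        have hys : S.mask (g v) / 2 ^ (m + 1) < 2 ^ s := by
          rw [Nat.div_lt_iff_lt_mul (Nat.two_pow_pos _), ← pow_add, add_comm]
          exact e3
        have hpos := Nat.two_pow_pos s
        rw [hdiv]
        refine ⟨fun _ => (Nat.add_pos_right _ hpos).ne', fun _ => ?_⟩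
        -- If the father of `v` has no bit above that of `a`, the lowest such bit belongs to `v`;
        -- otherwise the answer is the same as for the father.
        by_cases hy : S.mask (g v) / 2 ^ (m + 1) = 0
        · refine ⟨v, h1, Reach.refl _ _, rfl, ?_, fun hr => ?_⟩
          · rw [hy, zero_add, lowBit_two_pow, e2, ← pow_add, add_comm]
          · rcases reach_iff.1 hr with rfl | hr
            · rfl
            · exact absurd hy (ih1 hr)
        · rw [lowBit_add_two_pow hy hys]
          obtain ⟨u, u1, u2, u3, u4, u5⟩ := ih2 hy
          refine ⟨u, u1, u2.head, by rw [u3, e1], u4, fun hr => u5 ?_⟩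
          rcases reach_iff.1 hr with rfl | hr
          · exact absurd (Nat.div_eq_of_lt hm2) hy
          · exact hr
      · have hy : S.mask v / 2 ^ (m + 1) = 0 := by
          refine Nat.div_eq_of_lt ?_
          have : 2 ^ l ≤ 2 ^ m := Nat.pow_le_pow_right (by norm_num) hl
          rw [pow_succ]
          omega
        rw [hy]
        refine ⟨fun hr => ?_, fun h => absurd rfl h⟩
        have := hbm hr
        omega

/-- The vertex of cluster `r` with a given bit. -/
def CS.lookup (S : CS) (r x : ℕ) : ℕ :=
  if x < S.lo r then S.aux (S.bo r + x % (S.M r / 3)) else S.aux (S.bn r + x % S.M r)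

theorem CInv.lookup (h : CInv g D n S k tc own) {u : ℕ} (h1 : 1 ≤ u) (h2 : u ≤ n) :
    S.lookup (S.cl u) (S.bit u) = u := by
  rw [CS.lookup]
  split_ifs with hl
  · exact h.old u h1 h2 hl
  · exact h.new u h1 h2 (by omega)

/-- Where the search for the son of `a` starts. -/
def CS.start (S : CS) (g D : ℕ → ℕ) (f a : ℕ) : ℕ :=
  if S.cl a ≠ S.cl f ∧ D a + 1 < D (S.cl f) then g (S.cl f) else f

/-- The son of `a` on the path from `v`, for `a` in the cluster of `v` or above the whole of it. -/
def CS.childFrom (S : CS) (D : ℕ → ℕ) (v a : ℕ) : ℕ :=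
  if S.cl a = S.cl v then
    if S.mask v / (2 * S.bit a) = 0 then 0
    else S.lookup (S.cl v) (lowBit (S.mask v / (2 * S.bit a)) * (2 * S.bit a))
  else if D (S.cl v) ≤ D a + 1 then S.cl v
  else S.aux (S.bn (S.cl v) + S.M (S.cl v) + (D (S.cl v) - (D a + 1)))

/-- The search moves at most once, to the father of the cluster root. A cluster has other clusters
below it only if its table is complete, so after a move the table may be used; without a move it is
not needed. -/
theorem CInv.start_spec (h : CInv g D n S k tc own) (hF : IsForest g D n) {f a : ℕ}
    (h1 : 1 ≤ f) (h2 : f ≤ n) (ha1 : 1 ≤ a) (ha2 : a ≤ n) :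
    1 ≤ S.start g D f a ∧ S.start g D f a ≤ n ∧ Reach g f (S.start g D f a) ∧
      (Reach g (g f) a → Reach g (g (S.start g D f a)) a) ∧
      (S.cl a ≠ S.cl (S.start g D f a) → D a + 1 < D (S.cl (S.start g D f a)) →
        S.cur (S.cl (S.start g D f a)) = 0) := by
  unfold CS.start
  split_ifs with hc
  · obtain ⟨c1, c2, c3⟩ := h.cl f h1 h2
    have hd := hF.depth _ c1 (by omega)
    have hlt := hF.decr.2 _ c1 (by omega)
    have hr := h.reach_cl hF h1 h2
    refine ⟨?_, by omega, hr.trans (Reach.refl _ _).head, fun hra => ?_, fun _ _ =>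
      (h.root _ c1 (by omega) c3).2.2⟩
    · by_contra h0
      rw [show g (S.cl f) = 0 by omega, hF.zero] at hd
      omega
    · rcases h.reach_cases hF h1 h2 ha1 hra.head with hh | hh
      · exact absurd hh hc.1
      · rcases reach_iff.1 hh with rfl | hh
        · omega
        · exact hh
  · refine ⟨h1, h2, Reach.refl _ _, id, fun c1 c2 => absurd ⟨c1, c2⟩ hc⟩

/-- The vertex `a` need not be above `v`. Even then the answer is `0` or a vertex on the path, so
that comparing its father with `a` afterwards decides the matter. -/
theorem CInv.childFrom_spec (h : CInv g D n S k tc own) (hF : IsForest g D n) {v a : ℕ}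
    (h1 : 1 ≤ v) (h2 : v ≤ n) (ha1 : 1 ≤ a) (ha2 : a ≤ n)
    (hfull : S.cl a ≠ S.cl v → D a + 1 < D (S.cl v) → S.cur (S.cl v) = 0) :
    (S.childFrom D v a = 0 ∨ Reach g v (S.childFrom D v a)) ∧
      (Reach g (g v) a → 1 ≤ S.childFrom D v a ∧ g (S.childFrom D v a) = a) := by
  unfold CS.childFrom
  obtain ⟨c1, c2, c3⟩ := h.cl v h1 h2
  have hrc := h.reach_cl hF h1 h2
  split_ifs with hc hy hd
  · exact ⟨Or.inl rfl, fun hr => absurd hy ((h.exists_child hF h1 h2 ha1 ha2 hc).1 hr)⟩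
  · obtain ⟨u, u1, u2, u3, u4, u5⟩ := (h.exists_child hF h1 h2 ha1 ha2 hc).2 hy
    have hu := hF.decr.reach_le h2 u2
    rw [← u4, ← u3, h.lookup u1 (by omega)]
    exact ⟨Or.inr u2, fun hr => ⟨u1, u5 hr⟩⟩
  · refine ⟨Or.inr hrc, fun hr => ⟨c1, ?_⟩⟩
    rcases h.reach_cases hF h1 h2 ha1 hr.head with hh | ⟨m, hm⟩
    · exact absurd hh hc
    · have hlt := hF.decr.2 _ c1 (by omega)
      have e1 := hF.iterate (v := g (S.cl v)) (by omega) m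
      have e2 := hF.depth _ c1 (by omega)
      have e3 := hF.depth _ ha1 ha2
      rw [hm] at e1
      obtain rfl : m = 0 := by omega
      exact hm
  · have hcur := hfull hc (by omega)
    obtain ⟨t1, t2, t3⟩ := h.table _ c1 (by omega) c3
    have e1 := hF.iterate (v := S.cl v) (by omega) (tc (S.cl v))
    rw [← t2, hcur, hF.zero] at e1
    rw [t3 _ (by omega)]
    refine ⟨Or.inr (hrc.trans ⟨_, rfl⟩), fun hr => ?_⟩
    rcases h.reach_cases hF h1 h2 ha1 hr.head with hh | ⟨m, hm⟩
    · exact absurd hh hc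
    · rw [← Function.iterate_succ_apply] at hm
      have e2 := hF.iterate (v := S.cl v) (by omega) (m + 1)
      have e3 := hF.depth _ ha1 ha2
      rw [hm] at e2
      obtain rfl : m = D (S.cl v) - (D a + 1) := by omega
      rw [Function.iterate_succ_apply'] at hm
      refine ⟨?_, hm⟩
      by_contra h0
      rw [show g^[D (S.cl v) - (D a + 1)] (S.cl v) = 0 by omega, hF.decr.1] at hm
      omega

/-- The son of `a` on the path from `f`. -/
def CS.child (S : CS) (g D : ℕ → ℕ) (f a : ℕ) : ℕ := S.childFrom D (S.start g D f a) a

theorem CInv.child_spec (h : CInv g D n S k tc own) (hF : IsForest g D n) {f a : ℕ}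
    (h1 : 1 ≤ f) (h2 : f ≤ n) (ha1 : 1 ≤ a) (ha2 : a ≤ n) :
    (S.child g D f a = 0 ∨ Reach g f (S.child g D f a)) ∧
      (Reach g (g f) a → 1 ≤ S.child g D f a ∧ g (S.child g D f a) = a) := by
  obtain ⟨s1, s2, s3, s4, s5⟩ := h.start_spec hF h1 h2 ha1 ha2
  obtain ⟨c1, c2⟩ := h.childFrom_spec hF s1 s2 ha1 ha2 s5
  exact ⟨c1.imp id s3.trans, fun hr => c2 (s4 hr)⟩

end Query

end

section

/-! ### Insertion of a vertex into the clusters -/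

/-- Vertex `i` becomes the root of a new cluster. -/
def CS.newCluster (S : CS) (i : ℕ) : CS where
  cl := Function.update S.cl i i
  mask := Function.update S.mask i 1
  bit := Function.update S.bit i 1
  nb := Function.update S.nb i 2
  M := Function.update S.M i 9
  lo := Function.update S.lo i 2
  ln := Function.update S.ln i 8
  bo := Function.update S.bo i S.free
  bn := Function.update S.bn i (S.free + 3)
  cur := Function.update S.cur i i
  aux := Function.update S.aux (S.free + 1) i
  free := S.free + 21

/-- Cluster `r` gets new, larger arrays. -/
def CS.grow (S : CS) (r : ℕ) : CS :=
  { S with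
    M := Function.update S.M r (3 * S.M r)
    lo := Function.update S.lo r (S.ln r)
    ln := Function.update S.ln r (S.ln r * S.ln r * S.ln r)
    bo := Function.update S.bo r (S.bn r)
    bn := Function.update S.bn r S.free
    cur := Function.update S.cur r r
    free := S.free + 2 * (3 * S.M r) }

/-- The cells of cluster `r` after vertex `i` has joined it. -/
def CS.joinAux (S : CS) (D : ℕ → ℕ) (r i : ℕ) : ℕ → ℕ :=
  let a := Function.update S.aux (S.bn r + S.nb r % S.M r) i
  let cp := S.nb r / S.lo r
  let a' := if S.lo r - cp = 0 then a
    else Function.update a (S.bn r + cp % S.M r) (S.aux (S.bo r + cp % (S.M r / 3)))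
  Function.update a' (S.bn r + S.M r + (D r - D (S.cur r))) (S.cur r)

/-- Vertex `i` joins the cluster `r` of its father. -/
def CS.join (S : CS) (g D : ℕ → ℕ) (r i : ℕ) : CS :=
  { S with
    cl := Function.update S.cl i r
    mask := Function.update S.mask i (S.mask (g i) ||| S.nb r)
    bit := Function.update S.bit i (S.nb r)
    nb := Function.update S.nb r (S.nb r + S.nb r)
    cur := Function.update S.cur r (g (S.cur r))
    aux := S.joinAux D r i }

theorem sum_update_add {s : Finset ℕ} {f f' : ℕ → ℕ} {r : ℕ} (hr : r ∈ s)
    (h : ∀ v ∈ s, v ≠ r → f' v = f v) : ∑ v ∈ s, f' v + f r = ∑ v ∈ s, f v + f' r := by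
  rw [← Finset.sum_erase_add s f hr, ← Finset.sum_erase_add s f' hr,
    Finset.sum_congr rfl fun v hv => h v (Finset.mem_of_mem_erase hv) (Finset.ne_of_mem_erase hv)]
  ring

theorem sum_Icc_succ (f : ℕ → ℕ) (n : ℕ) :
    ∑ v ∈ Finset.Icc 1 (n + 1), f v = ∑ v ∈ Finset.Icc 1 n, f v + f (n + 1) :=
  Finset.sum_Icc_succ_top (by omega) f

section Insert
variable {g D : ℕ → ℕ} {n : ℕ} {S : CS} {k tc : ℕ → ℕ} {own : ℕ → ℕ × ℕ}

theorem CInv.M_eq (h : CInv g D n S k tc own) {r : ℕ} (h1 : 1 ≤ r) (h2 : r ≤ n)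
    (hr : S.cl r = r) : S.M r = 3 * 3 ^ k r ∧ S.M r / 3 = 3 ^ k r ∧ 0 < 3 ^ k r ∧
      3 ^ k r = 3 * 3 ^ (k r - 1) := by
  obtain ⟨e1, e2, _⟩ := h.stage r h1 h2 hr
  rw [e2, pow_succ]
  have : 0 < 3 ^ k r := by positivity
  have e3 : 3 ^ k r = 3 ^ (k r - 1 + 1) := by rw [Nat.sub_add_cancel e1]
  rw [pow_succ] at e3
  omega

theorem CInv.addr_old (h : CInv g D n S k tc own) {r : ℕ} (h1 : 1 ≤ r) (h2 : r ≤ n)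
    (hr : S.cl r = r) (x : ℕ) : x % (S.M r / 3) < S.M r / 3 ∧
      S.bo r + x % (S.M r / 3) < S.free := by
  obtain ⟨e1, e2, e3, _⟩ := h.M_eq h1 h2 hr
  have := (h.room r h1 h2 hr).2
  have := Nat.mod_lt x (show S.M r / 3 > 0 by omega)
  omega

theorem CInv.addr_new (h : CInv g D n S k tc own) {r : ℕ} (h1 : 1 ≤ r) (h2 : r ≤ n)
    (hr : S.cl r = r) (x : ℕ) : x % S.M r < S.M r ∧ S.bn r + x % S.M r < S.free := by
  obtain ⟨e1, e2, e3, _⟩ := h.M_eq h1 h2 hr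
  have := (h.room r h1 h2 hr).1
  have := Nat.mod_lt x (show S.M r > 0 by omega)
  omega

theorem CInv.addr_table (h : CInv g D n S k tc own) {r : ℕ} (h1 : 1 ≤ r) (h2 : r ≤ n)
    (hr : S.cl r = r) {t : ℕ} (ht : t ≤ tc r) : S.M r + t < 2 * S.M r ∧
      S.bn r + S.M r + t < S.free := by
  obtain ⟨e1, e2, e3, _⟩ := h.M_eq h1 h2 hr
  have := (h.room r h1 h2 hr).1
  have := (h.stage r h1 h2 hr).2.2.2.2.2.1
  omega

/-- As long as `cur` is a vertex, the table is incomplete, and its length is a difference of two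
depths; so the program need not store it. -/
theorem CInv.tc_lt (h : CInv g D n S k tc own) (hF : IsForest g D n) {r : ℕ} (h1 : 1 ≤ r)
    (h2 : r ≤ n) (hr : S.cl r = r) (hc : S.cur r ≠ 0) :
    tc r < D r ∧ D r - D (S.cur r) = tc r := by
  obtain ⟨e1, e2, _⟩ := h.table r h1 h2 hr
  have e3 := hF.iterate h2 (tc r)
  rw [← e2] at e3
  refine ⟨?_, by omega⟩
  by_contra hl
  refine hc (hF.eq_zero ?_ (by omega))
  rw [e2]
  exact (hF.decr.iterate_le h2 _).trans h2

/-- Roots of the forest are included, since the entries of `cl` and `cur` at `0` are `0`. The root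
has bit 1, below `lo = 2`, so its name goes to cell `1 % 3` of the old array of 3 cells; the new
array with its table takes 18 cells. These 21 cells and the 6 in the potential make up the 27
allowed for a vertex. -/
theorem CInv.newCluster (h : CInv g D n S k tc own) (hF : IsForest g D (n + 1))
    (hfull : S.cur (S.cl (g (n + 1))) = 0) :
    CInv g D (n + 1) (S.newCluster (n + 1)) (Function.update k (n + 1) 1)
      (Function.update tc (n + 1) 0)
      (fun y => if y < S.free then own y else if y < S.free + 3 then (n + 1, 0) else (n + 1, 1)) := by
  have hu : ∀ (f : ℕ → ℕ) (a v : ℕ), v ≤ n → Function.update f (n + 1) a v = f v :=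
    fun f a v hv => Function.update_of_ne (by omega) _ _
  have hcl : ∀ v, v ≤ n → S.cl v ≤ n := by
    intro v hv
    rcases Nat.eq_zero_or_pos v with rfl | h0
    · rw [h.cl_zero]; omega
    · have := (h.cl v h0 hv).2.1
      omega
  have hg : ∀ v, v ≤ n + 1 → g v ≤ n := by
    intro v hv
    rcases Nat.eq_zero_or_pos v with rfl | h0
    · rw [hF.decr.1]; omega
    · have := hF.decr.2 v h0 hv
      omega
  have haux : ∀ y, y < S.free → Function.update S.aux (S.free + 1) (n + 1) y = S.aux y :=
    fun y hy => Function.update_of_ne (by omega) _ _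
  have split : ∀ v, v ≤ n + 1 → v ≤ n ∨ v = n + 1 := fun v hv => by omega
  constructor
  · simp only [CS.newCluster, hu _ _ 0 (Nat.zero_le n), h.cl_zero]
  · simp only [CS.newCluster, hu _ _ 0 (Nat.zero_le n), h.cur_zero]
  · intro v h1 h2
    rcases split v h2 with hv | rfl
    · simpa only [CS.newCluster, hu _ _ v hv, hu _ _ _ (hcl v hv)] using h.cl v h1 hv
    · simp [CS.newCluster]
  · intro v h1 h2
    rcases split v h2 with hv | rfl
    · simpa only [CS.newCluster, hu _ _ v hv, hu _ _ _ (hg v h2)] using h.inner v h1 hv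
    · simp [CS.newCluster]
  · intro v h1 h2
    rcases split v h2 with hv | rfl
    · simpa only [CS.newCluster, hu _ _ v hv, hu _ _ _ (hg v h2), hu _ _ _ (hcl _ (hg v h2))]
        using h.root v h1 hv
    · simp only [CS.newCluster, hu _ _ _ (hg _ h2), hu _ _ _ (hcl _ (hg _ h2)), hfull]
      simp
  · intro v h1 h2
    rcases split v h2 with hv | rfl
    · simpa only [CS.newCluster, hu _ _ v hv, hu _ _ _ (hcl v hv)] using h.lt v h1 hv
    · simp [CS.newCluster]
  · intro v h1 h2
    rcases split v h2 with hv | rfl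
    · obtain ⟨c1, _, c3⟩ := h.cl v h1 hv
      simpa only [CS.newCluster, hu _ _ v hv, hu _ _ _ (hcl v hv),
        haux _ (h.addr_old c1 (hcl v hv) c3 _).2] using h.old v h1 hv
    · simp [CS.newCluster]
  · intro v h1 h2
    rcases split v h2 with hv | rfl
    · obtain ⟨c1, _, c3⟩ := h.cl v h1 hv
      simpa only [CS.newCluster, hu _ _ v hv, hu _ _ _ (hcl v hv),
        haux _ (h.addr_new c1 (hcl v hv) c3 _).2] using h.copied v h1 hv
    · simp [CS.newCluster]
  · intro v h1 h2
    rcases split v h2 with hv | rfl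
    · obtain ⟨c1, _, c3⟩ := h.cl v h1 hv
      simpa only [CS.newCluster, hu _ _ v hv, hu _ _ _ (hcl v hv),
        haux _ (h.addr_new c1 (hcl v hv) c3 _).2] using h.new v h1 hv
    · simp [CS.newCluster]
  · intro v h1 h2
    rcases split v h2 with hv | rfl
    · simpa only [CS.newCluster, hu _ _ v hv] using h.stage v h1 hv
    · have := hF.depth (n + 1) h1 h2
      simp only [CS.newCluster, Function.update_self]
      norm_num
      omega
  · intro v h1 h2
    rcases split v h2 with hv | rfl
    · simp only [CS.newCluster, hu _ _ v hv]
      intro hr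
      obtain ⟨t1, t2, t3⟩ := h.table v h1 hv hr
      refine ⟨t1, t2, fun t ht => ?_⟩
      rw [haux _ (h.addr_table h1 hv hr ht.le).2, t3 t ht]
    · simp [CS.newCluster]
  · intro v h1 h2
    rcases split v h2 with hv | rfl
    · simp only [CS.newCluster, hu _ _ v hv]
      intro hr
      have := h.room v h1 hv hr
      omega
    · simp only [CS.newCluster, Function.update_self]
      omega
  · intro v h1 h2
    rcases split v h2 with hv | rfl
    · simp only [CS.newCluster, hu _ _ v hv]
      intro hr y hy
      have := (h.room v h1 hv hr).2
      rw [if_pos (by omega)]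
      exact h.own_old v h1 hv hr y hy
    · simp only [CS.newCluster, Function.update_self]
      intro _ y hy
      rw [if_neg (by omega), if_pos (by omega)]
  · intro v h1 h2
    rcases split v h2 with hv | rfl
    · simp only [CS.newCluster, hu _ _ v hv]
      intro hr y hy
      have := (h.room v h1 hv hr).1
      rw [if_pos (by omega)]
      exact h.own_new v h1 hv hr y hy
    · simp only [CS.newCluster, Function.update_self]
      intro _ y hy
      rw [if_neg (by omega), if_neg (by omega)]
  · rw [sum_Icc_succ]
    have e : ∑ v ∈ Finset.Icc 1 n, (if (S.newCluster (n + 1)).cl v = v then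
        27 * Function.update tc (n + 1) 0 v + 6 else 0) =
        ∑ v ∈ Finset.Icc 1 n, (if S.cl v = v then 27 * tc v + 6 else 0) := by
      refine Finset.sum_congr rfl fun v hv => ?_
      rw [Finset.mem_Icc] at hv
      simp only [CS.newCluster, hu _ _ v hv.2]
    have := h.space
    rw [e]
    simp only [CS.newCluster, Function.update_self, if_true]
    omega

/-- In a full stage `tc = 2 * 3 ^ (k - 1)`. These are enough insertions for all `3 ^ (k - 1)` old
names to have been copied, so the new array can take over the role of the old one. The new block has
`6 * 3 ^ (k + 1) = 27 * tc` cells, which is the potential released when the table starts again at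
length `0`. -/
theorem CInv.grow (h : CInv g D n S k tc own) (hF : IsForest g D n) {r : ℕ} (h1 : 1 ≤ r)
    (h2 : r ≤ n) (hr : S.cl r = r) (hc : S.cur r ≠ 0) (hnb : S.nb r = S.ln r) :
    CInv g D n (S.grow r) (Function.update k r (k r + 1)) (Function.update tc r 0)
      (fun y => if y < S.free then own y else (r, k r + 1)) := by
  obtain ⟨s1, s2, s3, s4, s5, s6, s7⟩ := h.stage r h1 h2 hr
  obtain ⟨m1, m2, m3, m4⟩ := h.M_eq h1 h2 hr
  obtain ⟨t1, t2⟩ := h.tc_lt hF h1 h2 hr hc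
  have hM3 : 3 * S.M r / 3 = S.M r := by omega
  have htc : 3 ^ (k r - 1) + tc r = 3 ^ k r := by
    rw [s5, s4] at hnb
    exact Nat.pow_right_injective le_rfl hnb
  have hlo : S.lo r * S.lo r ≤ S.ln r := by
    rw [s3, s4, ← pow_add]
    exact Nat.pow_le_pow_right (by norm_num) (by omega)
  constructor
  · exact h.cl_zero
  · simp only [CS.grow]
    rw [Function.update_of_ne (by omega), h.cur_zero]
  · exact h.cl
  · exact h.inner
  · intro v hv1 hv2 hv
    obtain ⟨a, b, c⟩ := h.root v hv1 hv2 hv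
    refine ⟨a, b, ?_⟩
    simp only [CS.grow]
    -- Restarting the table of `r` does no harm: it was incomplete, so no cluster hangs below `r`
    -- yet.
    rw [Function.update_of_ne, c]
    rintro he
    rw [he] at c
    exact hc c
  · exact h.lt
  · intro v hv1 hv2
    simp only [CS.grow]
    by_cases he : S.cl v = r
    · rw [he]
      simp only [Function.update_self, hM3]
      intro _
      have e1 := h.copied v hv1 hv2
      have e2 := h.new v hv1 hv2
      rw [he] at e1 e2
      rcases Nat.lt_or_ge (S.bit v) (S.lo r) with hb | hb
      · refine e1 hb ?_
        rw [hnb]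
        refine lt_of_lt_of_le (Nat.mul_lt_mul_of_pos_right hb (by omega)) hlo
      · exact e2 hb
    · simpa only [Function.update_of_ne he] using h.old v hv1 hv2
  · intro v hv1 hv2
    simp only [CS.grow]
    by_cases he : S.cl v = r
    · rw [he]
      simp only [Function.update_self]
      intro _ hb
      obtain ⟨l, e1, _⟩ := h.bit_pow hv1 hv2
      have := Nat.two_pow_pos l
      rw [hnb, e1] at hb
      have := Nat.le_mul_of_pos_left (S.ln r) this
      omega
    · simpa only [Function.update_of_ne he] using h.copied v hv1 hv2
  · intro v hv1 hv2
    simp only [CS.grow]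
    by_cases he : S.cl v = r
    · rw [he]
      simp only [Function.update_self]
      intro hb
      have := h.lt v hv1 hv2
      rw [he] at this
      omega
    · simpa only [Function.update_of_ne he] using h.new v hv1 hv2
  · intro v hv1 hv2 hv
    simp only [CS.grow]
    by_cases he : v = r
    · subst he
      simp only [Function.update_self, Nat.add_sub_cancel, add_zero]
      refine ⟨by omega, by rw [s2]; ring, s4, ?_, by rw [hnb, s4], ?_, ?_⟩
      · rw [s4, ← pow_add, ← pow_add, pow_succ]
        congr 1
        ring
      · exact Nat.pow_le_pow_right (by norm_num) (by omega)
      -- Here `3 ^ (k + 1)` is `9 / 2` times `tc`, and `tc < D r`; this explains the constant 5.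
      · rw [pow_succ]
        omega
    · simpa only [Function.update_of_ne he] using h.stage v hv1 hv2 hv
  · intro v hv1 hv2 hv
    simp only [CS.grow]
    by_cases he : v = r
    · subst he
      simp
    · simpa only [Function.update_of_ne he] using h.table v hv1 hv2 hv
  · intro v hv1 hv2 hv
    simp only [CS.grow]
    by_cases he : v = r
    · subst he
      simp only [Function.update_self]
      have := (h.room v hv1 hv2 hv).1
      omega
    · have := h.room v hv1 hv2 hv
      simp only [Function.update_of_ne he]
      omega
  · intro v hv1 hv2 hv
    simp only [CS.grow]
    by_cases he : v = r
    · subst he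
      simp only [Function.update_self, hM3, Nat.add_sub_cancel]
      intro y hy
      have := (h.room v hv1 hv2 hv).1
      rw [if_pos (by omega)]
      exact h.own_new v hv1 hv2 hv y (by omega)
    · simp only [Function.update_of_ne he]
      intro y hy
      have := (h.room v hv1 hv2 hv).2
      rw [if_pos (by omega)]
      exact h.own_old v hv1 hv2 hv y hy
  · intro v hv1 hv2 hv
    simp only [CS.grow]
    by_cases he : v = r
    · subst he
      simp only [Function.update_self]
      intro y hy
      rw [if_neg (by omega)]
    · simp only [Function.update_of_ne he]
      intro y hy
      have := (h.room v hv1 hv2 hv).1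
      rw [if_pos (by omega)]
      exact h.own_new v hv1 hv2 hv y hy
  · have := h.space
    have e := sum_update_add (s := Finset.Icc 1 n) (r := r)
      (f := fun v => if S.cl v = v then 27 * tc v + 6 else 0)
      (f' := fun v => if S.cl v = v then 27 * Function.update tc r 0 v + 6 else 0)
      (Finset.mem_Icc.2 ⟨h1, h2⟩) (fun v _ hv => by simp only [Function.update_of_ne hv])
    simp only [hr, if_true, Function.update_self] at e
    have e' : ∑ v ∈ Finset.Icc 1 n, (if (S.grow r).cl v = v then
        27 * Function.update tc r 0 v + 6 else 0) =
        ∑ v ∈ Finset.Icc 1 n, (if S.cl v = v then 27 * Function.update tc r 0 v + 6 else 0) := rfl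
    rw [e']
    simp only [CS.grow]
    omega

/-- All writes go to the current block of cluster `r`; the owners of the cells show that nothing
else is touched. -/
theorem CInv.joinAux_eq (h : CInv g D n S k tc own) (hF : IsForest g D n) {r i y : ℕ}
    (h1 : 1 ≤ r) (h2 : r ≤ n) (hr : S.cl r = r) (hc : S.cur r ≠ 0) (hy : own y ≠ (r, k r)) :
    S.joinAux D r i y = S.aux y := by
  have hn := fun x => h.own_new r h1 h2 hr x
  have n1 : y ≠ S.bn r + S.M r + (D r - D (S.cur r)) := by
    rintro rfl
    rw [(h.tc_lt hF h1 h2 hr hc).2, add_assoc] at hy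
    exact hy (hn _ (h.addr_table h1 h2 hr le_rfl).1)
  have n2 : ∀ x, y ≠ S.bn r + x % S.M r := by
    rintro x rfl
    have := (h.addr_new h1 h2 hr x).1
    exact hy (hn _ (by omega))
  rw [CS.joinAux]
  simp only [Function.update_of_ne n1]
  split_ifs <;> simp only [Function.update_of_ne (n2 _)]

/-- An insertion writes the name of the new vertex, copies the old name with exponent `tc` while
there is one, and adds an ancestor of the root to the table. All exponents stay below `3 ^ k`, where
the cells are distinct, so no name in use is overwritten. The vertex pays 27 for the longer table.
-/
theorem CInv.join (h : CInv g D n S k tc own) (hF : IsForest g D (n + 1)) {r : ℕ}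
    (hr : S.cl (g (n + 1)) = r) (hc : S.cur r ≠ 0) (hnb : S.nb r ≠ S.ln r) :
    CInv g D (n + 1) (S.join g D r (n + 1)) k (Function.update tc r (tc r + 1)) own := by
  have hF' : IsForest g D n :=
    ⟨hF.decr.mono (by omega), hF.zero, fun v h1 h2 => hF.depth v h1 (by omega)⟩
  have hu : ∀ (f : ℕ → ℕ) (a v : ℕ), v ≤ n → Function.update f (n + 1) a v = f v :=
    fun f a v hv => Function.update_of_ne (by omega) _ _
  have hcl : ∀ v, v ≤ n → S.cl v ≤ n := by
    intro v hv
    rcases Nat.eq_zero_or_pos v with rfl | h0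
    · rw [h.cl_zero]; omega
    · have := (h.cl v h0 hv).2.1
      omega
  have hg : ∀ v, v ≤ n + 1 → g v ≤ n := by
    intro v hv
    rcases Nat.eq_zero_or_pos v with rfl | h0
    · rw [hF.decr.1]; omega
    · have := hF.decr.2 v h0 hv
      omega
  have hg0 : 1 ≤ g (n + 1) := by
    by_contra h0
    rw [show g (n + 1) = 0 by omega, h.cl_zero] at hr
    rw [← hr, h.cur_zero] at hc
    exact hc rfl
  have hgn := hg (n + 1) le_rfl
  obtain ⟨h1, -, hrr⟩ := h.cl _ hg0 hgn
  have h2 := hcl _ hgn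
  rw [hr] at h1 h2 hrr
  obtain ⟨s1, s2, s3, s4, s5, s6, s7⟩ := h.stage r h1 h2 hrr
  obtain ⟨m1, m2, m3, m4⟩ := h.M_eq h1 h2 hrr
  obtain ⟨t1, t2⟩ := h.tc_lt hF' h1 h2 hrr hc
  obtain ⟨t3, t4, t5⟩ := h.table r h1 h2 hrr
  have hlt : 3 ^ (k r - 1) + tc r < 3 ^ k r := by
    refine lt_of_le_of_ne s6 fun he => hnb ?_
    rw [s5, s4, he]
  -- One division yields the bit of the next name to be copied.
  have hcp : S.nb r / S.lo r = 2 ^ tc r := by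
    rw [s5, s3, pow_add, Nat.mul_div_cancel_left _ (Nat.two_pow_pos _)]
  have hlopos : 0 < S.lo r := by rw [s3]; exact Nat.two_pow_pos _
  have hlonb : S.lo r ≤ S.nb r := by
    rw [s5, s3]
    exact Nat.pow_le_pow_right (by norm_num) (by omega)
  have split : ∀ v, v ≤ n + 1 → v ≤ n ∨ v = n + 1 := fun v hv => by omega
  have hother : ∀ y, own y ≠ (r, k r) → S.joinAux D r (n + 1) y = S.aux y :=
    fun y hy => h.joinAux_eq hF' h1 h2 hrr hc hy
  have hslot : ∀ l, l < 3 ^ k r → ∀ m, m < 3 ^ k r → 2 ^ l % S.M r = 2 ^ m % S.M r → l = m := by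
    intro l hl m hm he
    rw [s2] at he
    exact two_pow_mod_inj hl hm he
  -- what the array of names holds after the insertion
  have hname : ∀ l, l < 3 ^ k r → S.joinAux D r (n + 1) (S.bn r + 2 ^ l % S.M r) =
      if l = tc r ∧ 2 ^ l < S.lo r then S.aux (S.bo r + 2 ^ l % (S.M r / 3))
      else if l = 3 ^ (k r - 1) + tc r then n + 1 else S.aux (S.bn r + 2 ^ l % S.M r) := by
    intro l hl
    have b1 := (h.addr_new h1 h2 hrr (2 ^ l)).1
    rw [CS.joinAux]
    simp only [hcp, Function.update_of_ne (show S.bn r + 2 ^ l % S.M r ≠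
      S.bn r + S.M r + (D r - D (S.cur r)) by omega)]
    have e1 : ∀ m, m < 3 ^ k r → (S.bn r + 2 ^ l % S.M r = S.bn r + 2 ^ m % S.M r ↔ l = m) := by
      intro m hm
      constructor
      · intro he
        exact hslot l hl m hm (by omega)
      · rintro rfl
        rfl
    rw [s5]
    split_ifs with c1 c2 c3 c2 c3
    · obtain ⟨rfl, c2⟩ := c2
      omega
    · rw [Function.update_apply, if_pos ((e1 _ hlt).2 c3)]
    · rw [Function.update_apply, if_neg (fun he => c3 ((e1 _ hlt).1 he))]
    · rw [Function.update_apply, if_pos ((e1 _ (by omega)).2 c2.1), c2.1]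
    · rw [Function.update_apply, if_neg (fun he => c2 ?_), Function.update_apply,
        if_pos ((e1 _ hlt).2 c3)]
      have := (e1 _ (by omega)).1 he
      exact ⟨this, by rw [this]; omega⟩
    · rw [Function.update_apply, if_neg (fun he => c2 ?_), Function.update_apply,
        if_neg (fun he => c3 ((e1 _ hlt).1 he))]
      have := (e1 _ (by omega)).1 he
      exact ⟨this, by rw [this]; omega⟩
  -- exponents of bits in the cluster
  have hbit : ∀ v, 1 ≤ v → v ≤ n → S.cl v = r → ∃ l, S.bit v = 2 ^ l ∧
      l < 3 ^ (k r - 1) + tc r := by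
    intro v hv1 hv2 hv
    obtain ⟨l, e, _⟩ := h.bit_pow hv1 hv2
    have := h.lt v hv1 hv2
    rw [hv, e, s5] at this
    exact ⟨l, e, (Nat.pow_lt_pow_iff_right (by norm_num)).1 this⟩
  have hnewname : ∀ v, 1 ≤ v → v ≤ n → S.cl v = r →
      (S.bit v < S.lo r → S.bit v * S.lo r < S.nb r + S.nb r →
        S.joinAux D r (n + 1) (S.bn r + S.bit v % S.M r) = v) ∧
      (S.lo r ≤ S.bit v → S.joinAux D r (n + 1) (S.bn r + S.bit v % S.M r) = v) := by
    intro v hv1 hv2 hv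
    obtain ⟨l, e, hl⟩ := hbit v hv1 hv2 hv
    have c1 := h.old v hv1 hv2
    have c2 := h.copied v hv1 hv2
    have c3 := h.new v hv1 hv2
    rw [hv, e] at c1 c2 c3
    rw [e, hname l (by omega)]
    constructor
    · intro d1 d2
      by_cases hlt' : l = tc r
      · rw [if_pos ⟨hlt', d1⟩]
        exact c1 d1
      · rw [if_neg (fun he => hlt' he.1), if_neg (by omega)]
        refine c2 d1 ?_
        rw [s3, s5, ← mul_two, ← pow_succ, ← pow_add] at d2
        rw [s3, s5, ← pow_add]
        have := (Nat.pow_lt_pow_iff_right (by norm_num)).1 d2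
        exact Nat.pow_lt_pow_right (by norm_num) (by omega)
    · intro d1
      rw [if_neg (fun he => by omega), if_neg (by omega)]
      exact c3 d1
  constructor
  · simp only [CS.join, hu _ _ 0 (Nat.zero_le n), h.cl_zero]
  · simp only [CS.join]
    rw [Function.update_of_ne (by omega), h.cur_zero]
  · intro v hv1 hv2
    rcases split v hv2 with hv | rfl
    · simpa only [CS.join, hu _ _ v hv, hu _ _ _ (hcl v hv)] using h.cl v hv1 hv
    · simp only [CS.join, Function.update_self, hu _ _ _ h2]
      omega
  · intro v hv1 hv2
    rcases split v hv2 with hv | rfl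
    · simpa only [CS.join, hu _ _ v hv, hu _ _ _ (hg v hv2)] using h.inner v hv1 hv
    · simp only [CS.join, Function.update_self, hu _ _ _ hgn]
      intro _
      obtain ⟨l, e1, e2, e3⟩ := h.bit_pow hg0 hgn
      obtain ⟨l', e1', e2'⟩ := hbit _ hg0 hgn hr
      have hl : l = l' := Nat.pow_right_injective le_rfl (e1.symm.trans e1')
      have hmask : S.mask (g (n + 1)) < 2 ^ (3 ^ (k r - 1) + tc r) :=
        e3.trans_le (Nat.pow_le_pow_right (by norm_num) (by omega))
      refine ⟨hr, _, s5, hmask, ?_⟩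
      have := Nat.two_pow_add_eq_or_of_lt hmask 1
      rw [mul_one] at this
      rw [s5, Nat.or_comm, ← this, add_comm]
  · intro v hv1 hv2
    rcases split v hv2 with hv | rfl
    · simp only [CS.join, hu _ _ v hv, hu _ _ _ (hg v hv2)]
      intro hvr
      obtain ⟨a, b, c⟩ := h.root v hv1 hv hvr
      refine ⟨a, b, ?_⟩
      rw [Function.update_of_ne, c]
      intro he
      rw [he] at c
      exact hc c
    · simp only [CS.join, Function.update_self]
      intro he
      omega
  · intro v hv1 hv2
    rcases split v hv2 with hv | rfl
    · simp only [CS.join, hu _ _ v hv]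
      have := h.lt v hv1 hv
      by_cases he : S.cl v = r
      · rw [he] at this ⊢
        rw [Function.update_self]
        omega
      · rwa [Function.update_of_ne he]
    · simp only [CS.join, Function.update_self]
      omega
  · intro v hv1 hv2
    rcases split v hv2 with hv | rfl
    · obtain ⟨c1, _, c3⟩ := h.cl v hv1 hv
      have c4 := hcl v hv
      simp only [CS.join, hu _ _ v hv]
      rw [hother]
      · exact h.old v hv1 hv
      · rw [h.own_old _ c1 c4 c3 _ (h.addr_old c1 c4 c3 _).1]
        intro he
        rw [Prod.mk.injEq] at he
        rw [he.1] at he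
        omega
    · simp only [CS.join, Function.update_self]
      intro he
      omega
  · intro v hv1 hv2
    rcases split v hv2 with hv | rfl
    · obtain ⟨c1, _, c3⟩ := h.cl v hv1 hv
      have c4 := hcl v hv
      simp only [CS.join, hu _ _ v hv]
      by_cases he : S.cl v = r
      · rw [he, Function.update_self]
        exact (hnewname v hv1 hv he).1
      · have := (h.addr_new c1 c4 c3 (S.bit v)).1
        rw [hother, Function.update_of_ne he]
        · exact h.copied v hv1 hv
        · rw [h.own_new _ c1 c4 c3 _ (by omega)]
          simp [he]
    · simp only [CS.join, Function.update_self]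
      intro he
      omega
  · intro v hv1 hv2
    rcases split v hv2 with hv | rfl
    · obtain ⟨c1, _, c3⟩ := h.cl v hv1 hv
      have c4 := hcl v hv
      simp only [CS.join, hu _ _ v hv]
      by_cases he : S.cl v = r
      · rw [he]
        exact (hnewname v hv1 hv he).2
      · have := (h.addr_new c1 c4 c3 (S.bit v)).1
        rw [hother]
        · exact h.new v hv1 hv
        · rw [h.own_new _ c1 c4 c3 _ (by omega)]
          simp [he]
    · simp only [CS.join, Function.update_self]
      intro _
      have hp : 0 < 3 ^ (k r - 1) := by positivity
      rw [s5, hname _ hlt, if_neg (by omega), if_pos rfl]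
  · intro v hv1 hv2
    rcases split v hv2 with hv | rfl
    · simp only [CS.join, hu _ _ v hv]
      intro hvr
      by_cases he : v = r
      · subst he
        simp only [Function.update_self]
        refine ⟨s1, s2, s3, s4, ?_, by omega, s7⟩
        rw [s5, ← mul_two, ← pow_succ]
        congr 1
      · simpa only [Function.update_of_ne he] using h.stage v hv1 hv hvr
    · simp only [CS.join, Function.update_self]
      intro he
      omega
  · intro v hv1 hv2
    rcases split v hv2 with hv | rfl
    · simp only [CS.join, hu _ _ v hv]
      intro hvr
      by_cases he : v = r
      · subst he
        simp only [Function.update_self]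
        refine ⟨t1, by rw [Function.iterate_succ_apply', ← t4], fun t ht => ?_⟩
        rw [CS.joinAux, t2]
        rcases Nat.lt_or_ge t (tc v) with htt | htt
        · rw [Function.update_of_ne (by omega)]
          have q : ∀ x, S.bn v + S.M v + t ≠ S.bn v + x % S.M v := fun x => by
            have := (h.addr_new hv1 hv hvr x).1
            omega
          rw [← t5 t htt]
          split_ifs <;> simp only [Function.update_of_ne (q _)]
        · obtain rfl : t = tc v := by omega
          rw [Function.update_self, t4]
      · simp only [Function.update_of_ne he]
        obtain ⟨e1, e2, e3⟩ := h.table v hv1 hv hvr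
        refine ⟨e1, e2, fun t ht => ?_⟩
        rw [hother, e3 t ht]
        have := (h.addr_table hv1 hv hvr ht.le).1
        rw [add_assoc, h.own_new v hv1 hv hvr _ this]
        simp [he]
    · simp only [CS.join, Function.update_self]
      intro he
      omega
  · intro v hv1 hv2
    rcases split v hv2 with hv | rfl
    · simpa only [CS.join, hu _ _ v hv] using h.room v hv1 hv
    · simp only [CS.join, Function.update_self]
      intro he
      omega
  · intro v hv1 hv2
    rcases split v hv2 with hv | rfl
    · simpa only [CS.join, hu _ _ v hv] using h.own_old v hv1 hv
    · simp only [CS.join, Function.update_self]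
      intro he
      omega
  · intro v hv1 hv2
    rcases split v hv2 with hv | rfl
    · simpa only [CS.join, hu _ _ v hv] using h.own_new v hv1 hv
    · simp only [CS.join, Function.update_self]
      intro he
      omega
  · have hsp := h.space
    have e := sum_update_add (s := Finset.Icc 1 n) (r := r)
      (f := fun v => if S.cl v = v then 27 * tc v + 6 else 0)
      (f' := fun v => if S.cl v = v then 27 * Function.update tc r (tc r + 1) v + 6 else 0)
      (Finset.mem_Icc.2 ⟨h1, h2⟩) (fun v _ hv => by simp only [Function.update_of_ne hv])
    simp only [hrr, if_true, Function.update_self] at e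
    rw [sum_Icc_succ]
    have e' : ∑ v ∈ Finset.Icc 1 n, (if (S.join g D r (n + 1)).cl v = v then
        27 * Function.update tc r (tc r + 1) v + 6 else 0) =
        ∑ v ∈ Finset.Icc 1 n, (if S.cl v = v then 27 * Function.update tc r (tc r + 1) v + 6
          else 0) := by
      refine Finset.sum_congr rfl fun v hv => ?_
      rw [Finset.mem_Icc] at hv
      simp only [CS.join, hu _ _ v hv.2]
    rw [e']
    simp only [CS.join, Function.update_self]
    rw [if_neg (by omega)]
    omega

end Insert

end

section

/-! ### The program -/

infixr:60 ";;" => Stmt.seq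

/-- The rows of the tables, from the value `A[i]` in register 10, for `i > 1`. -/
def rowCode : Stmt :=
  .op .sub 11 3 5 ;; .ld 12 0 11 ;; .op .add 12 12 5 ;; .ld 13 3 12 ;; .op .add 13 13 5 ;;
  .ld 14 4 12 ;; .ld 15 5 12 ;; .ld 16 0 12 ;;
  -- `or` followed by `xor` with the same bit clears it. Below, `xor` serves as a test for equality,
  -- and `or` of a register with itself as a copy.
  .ite 16 (.const 17 0) (.ld 17 4 16 ;; .op .shl 17 5 17 ;; .op .or 15 15 17 ;;
    .op .xor 15 15 17) ;;
  .op .shl 17 5 14 ;; .op .or 15 15 17 ;; .op .xor 18 10 12 ;;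
  .ite 18 (.ld 19 7 12 ;; .ld 20 8 12) (.op .add 14 14 5 ;; .op .or 19 3 3 ;; .op .or 20 12 12)

@[simp] theorem St.set_reg (σ : St) (r v s : ℕ) :
    (σ.set r v).reg s = if s = r then v else σ.reg s := by
  simp [St.set, Function.update_apply]

@[simp] theorem St.set_col (σ : St) (r v : ℕ) : (σ.set r v).col = σ.col := rfl

@[simp] theorem St.put_reg (σ : St) (k m v : ℕ) : (σ.put k m v).reg = σ.reg := rfl

@[simp] theorem St.put_col (σ : St) (k m v j : ℕ) :
    (σ.put k m v).col j = if j = k then Function.update (σ.col k) m v else σ.col j := by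
  simp [St.put, Function.update_apply]

/-- The first `m` rows of the tables are in the columns `0, …, 8`. -/
structure Rows (A : ℕ → ℕ) (m : ℕ) (c : ℕ → ℕ → ℕ) : Prop where
  val : ∀ v, 1 ≤ v → v ≤ m → c 0 v = A v ∧ c 1 v = letterAt A v ∧ c 2 v = lettersT A v ∧
    c 3 v = depthT A v ∧ c 5 v = candBits A v ∧ c 6 v = queryT A v
  depth : ∀ v ≤ m, c 4 v = depthS A v
  run : ∀ v ≤ m, c 7 v = runEnd A v
  father : ∀ v ≤ m, c 8 v = fatherS A v

/-- Words of `b` bits and indices up to `N` suffice for arrays of length `n`. -/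
structure Large (n b N : ℕ) : Prop where
  index : 27 * (n + 1) ≤ N
  word : N < 2 ^ b
  square : 2 * (4 * n ^ 2) ^ 5 < 2 ^ b

theorem xor_eq_zero (x y : ℕ) : x ^^^ y = 0 ↔ x = y := by
  constructor
  · intro h
    have : x ^^^ (x ^^^ y) = x := by rw [h, Nat.xor_zero]
    rw [← Nat.xor_assoc, Nat.xor_self, Nat.zero_xor] at this
    exact this.symm
  · rintro rfl
    exact Nat.xor_self x

/-! ### Bounds on the table entries, and the code for a row -/

variable {A : ℕ → ℕ} {n m b N : ℕ} {β : Type*} {x : ℕ → β} {Q : St → Prop} {σ : St}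

theorem depthT_le (h : Decr (father A) n) {v : ℕ} (hv : v ≤ n) : depthT A v ≤ v := by
  induction v using Nat.strong_induction_on with
  | _ v ih =>
    rcases Nat.eq_zero_or_pos v with rfl | h0
    · rw [depthT_zero]
    · have := h.2 v h0 hv
      have := ih _ this (by omega)
      rw [depthT_eq h h0 hv]
      omega

theorem depthS_le (h : Decr (father A) n) {v : ℕ} (hv : v ≤ n) : depthS A v ≤ v := by
  induction v using Nat.strong_induction_on with
  | _ v ih =>
    rcases Nat.eq_zero_or_pos v with rfl | h0
    · rw [depthS_zero]
    · have := (decr_fatherS h).2 v h0 hv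
      have := ih _ this (by omega)
      rw [depthS_fatherS h h0 hv]
      omega

theorem lettersT_le (h : Decr (father A) n) {v : ℕ} (hv : v ≤ n) : lettersT A v ≤ v := by
  induction v using Nat.strong_induction_on with
  | _ v ih =>
    rcases Nat.eq_zero_or_pos v with rfl | h0
    · rw [lettersT_zero]
    · have := h.2 v h0 hv
      have := ih _ this (by omega)
      rw [lettersT_eq h h0 hv]
      split_ifs <;> omega

/-- The height of T' is logarithmic, so a shift by a depth in T' does not leave the word. -/
theorem PathWord.two_pow_depthS_lt (hx : PathWord A x m) (hm : m ≤ n) (hL : Large n b N) {v : ℕ}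
    (hv : v ≤ m) : 2 ^ depthS A v < 2 ^ b := by
  rcases Nat.eq_zero_or_pos v with rfl | h0
  · have := hL.word
    have := hL.index
    rw [depthS_zero]
    omega
  · have h1 := hx.two_pow_depthS_le h0 hv
    have h2 : 4 * v ^ 2 ≤ 4 * n ^ 2 := by
      have := Nat.pow_le_pow_left (hv.trans hm) 2
      omega
    have h3 : 4 * n ^ 2 ≤ (4 * n ^ 2) ^ 5 := Nat.le_self_pow (by omega) _
    have := hL.square
    omega

theorem rowCode_wp (hx : PathWord A x m) (h1 : 1 ≤ m) (hm : m + 1 ≤ n) (hL : Large n b N)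
    (hR : Rows A m σ.col) (r3 : σ.reg 3 = m + 1) (r5 : σ.reg 5 = 1) (r10 : σ.reg 10 = A (m + 1))
    (hQ : ∀ σ', σ'.col = σ.col → σ'.reg 0 = σ.reg 0 → σ'.reg 2 = σ.reg 2 → σ'.reg 3 = m + 1 →
      σ'.reg 4 = σ.reg 4 → σ'.reg 5 = 1 → σ'.reg 10 = A (m + 1) →
      σ'.reg 12 = father A (m + 1) → σ'.reg 13 = depthT A (m + 1) →
      σ'.reg 14 = depthS A (m + 1) → σ'.reg 15 = candBits A (m + 1) →
      σ'.reg 18 = A (m + 1) ^^^ father A (m + 1) →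
      σ'.reg 19 = runEnd A (m + 1) → σ'.reg 20 = fatherS A (m + 1) → Q σ') :
    rowCode.wp b N Q σ := by
  have hd := hx.decr
  have hf0 := hd.2 (m + 1) (by omega) le_rfl
  have hf1 := father_pos A (i := m + 1) (by omega)
  have e1 := (hR.val m h1 le_rfl).1
  have e2 := father_of_two_le A (i := m + 1) (by omega)
  rw [Nat.add_sub_cancel] at e2
  obtain ⟨f1, -, f3, f4, f5, -⟩ := hR.val _ hf1 (by omega)
  have f6 := hR.depth (father A (m + 1)) (by omega)
  have f7 := hR.run (father A (m + 1)) (by omega)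
  have f8 := hR.father (father A (m + 1)) (by omega)
  have hi := hL.index
  have hw := hL.word
  have b1 := depthT_le hd (v := father A (m + 1)) (by omega)
  have b2 := depthS_le hd (v := father A (m + 1)) (by omega)
  have b3 := hx.two_pow_depthS_lt (by omega) hL (v := father A (m + 1)) (by omega)
  have hA := hx.lt (father A (m + 1)) hf1 (by omega)
  have b4 := hx.two_pow_depthS_lt (by omega) hL (v := A (father A (m + 1))) (by omega)
  have f9 := hR.depth (A (father A (m + 1))) (by omega)
  have g1 := depthT_eq hd (v := m + 1) (by omega) le_rfl
  have g2 := depthS_eq hd (v := m + 1) (by omega) le_rfl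
  have g3 := candBits_eq hd (v := m + 1) (by omega) le_rfl
  have g4 := runEnd_eq hd (v := m + 1) (by omega) le_rfl
  have g5 := fatherS_eq hd (v := m + 1) (by omega) le_rfl
  simp only [rowCode, Stmt.wp, St.set_reg, St.set_col, WordOp.eval, WordOp.Fine, r3, r5, r10,
    Nat.reduceEqDiff, if_true, if_false, Nat.add_sub_cancel, e1, ← e2, f1, f4, f5, f6, f7, f8,
    xor_eq_zero, Nat.shiftLeft_eq, one_mul, f9]
  have g6 : depthS A (m + 1) ≤ N := (depthS_le hd (by omega)).trans (by omega)
  have g7 := Nat.two_pow_pos b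
  split_ifs with c1 c2 c2 <;> simp only [c1, c2, if_true, if_false] at g2 g3 g4 g5 <;>
    (repeat' apply And.intro) <;> (try omega) <;> (try trivial) <;> apply hQ <;>
    simp [r3, r5, r10, g1, g2, g3, g4, g5, setBit, clearBit, Nat.or_self]

end

section

/-! ### The level ancestor query -/

variable {A : ℕ → ℕ} {n m b N : ℕ} {β : Type*} {x : ℕ → β} {Q : St → Prop} {σ : St}
  {k tc : ℕ → ℕ} {own : ℕ → ℕ × ℕ}

/-- The clusters are in the columns `9, …, 19`, the first free cell is in register 4. -/
def St.clusters (σ : St) : CS where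
  cl := σ.col 9
  mask := σ.col 10
  bit := σ.col 11
  nb := σ.col 12
  M := σ.col 13
  lo := σ.col 14
  ln := σ.col 15
  bo := σ.col 16
  bn := σ.col 17
  cur := σ.col 18
  aux := σ.col 19
  free := σ.reg 4

theorem PathWord.isForest (hx : PathWord A x m) : IsForest (fatherS A) (depthS A) (m + 1) :=
  ⟨decr_fatherS hx.decr, depthS_zero, fun _ h1 h2 => depthS_fatherS hx.decr h1 h2⟩

theorem IsForest.mono {g D : ℕ → ℕ} (hF : IsForest g D (m + 1)) : IsForest g D m :=
  ⟨hF.decr.mono (by omega), hF.zero, fun v h1 h2 => hF.depth v h1 (by omega)⟩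

/-- If the value is not the father of `i`, then it is accepted if and only if it is above `i` in
`T'` and the bit of a candidate. -/
theorem accepted_iff_child {S : CS} (hx : PathWord A x m)
    (hS : CInv (fatherS A) (depthS A) m S k tc own) (h1 : 1 ≤ m) (h0 : A (m + 1) ≠ 0)
    (hlt : A (m + 1) < m + 1) (hne : A (m + 1) ≠ father A (m + 1)) :
    let u := S.child (fatherS A) (depthS A) (father A (m + 1)) (A (m + 1))
    (Accepted A (m + 1) ↔ fatherS A u = A (m + 1) ∧
      (candBits A (m + 1)).testBit (depthS A (A (m + 1))) = true) ∧
    (fatherS A u = A (m + 1) → queryT A (m + 1) = runEnd A u) := by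
  intro u
  have hd := hx.decr
  have hF := hx.isForest.mono
  have hf0 := hd.2 (m + 1) (by omega) le_rfl
  have hf1 := father_pos A (i := m + 1) (by omega)
  obtain ⟨c1, c2⟩ := hS.child_spec hF hf1 (by omega) (a := A (m + 1)) (by omega) (by omega)
  have key : fatherS A u = A (m + 1) → 1 ≤ u ∧ u ≤ m ∧ Reach (father A) (father A (m + 1)) (runEnd A u) ∧
      queryT A (m + 1) = runEnd A u := by
    intro hu
    have hu0 : u ≠ 0 := by
      intro hz
      rw [hz, fatherS_zero] at hu
      omega
    have hr : Reach (fatherS A) (father A (m + 1)) u := by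
      rcases c1 with h | h
      · exact absurd h hu0
      · exact h
    have hum := hF.decr.reach_le (n := m) (by omega) hr
    obtain ⟨a1, a2, a3, -⟩ := runEnd_spec hd (v := u) (by omega) (by omega)
    have hrr := (reach_of_fatherS hd (by omega) hr).trans a1
    refine ⟨by omega, by omega, hrr, ?_⟩
    rw [queryT_of_ne_zero (by omega) h0, ← hu, fatherS]
    exact levelAncestor_eq hd le_rfl hrr.head a2
  refine ⟨⟨fun hA => ?_, fun ⟨hu, hb⟩ => ?_⟩, fun hu => (key hu).2.2.2⟩
  · unfold Accepted at hA
    rw [if_neg (by omega)] at hA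
    simp only [h0, false_or] at hA
    obtain ⟨-, e1, e2, e3⟩ := hA
    refine ⟨(c2 ?_).2, e3⟩
    have hr : Reach (father A) (m + 1) (queryT A (m + 1)) := by
      rw [queryT_of_ne_zero (by omega) h0]
      exact ⟨_, rfl⟩
    generalize queryT A (m + 1) = j at *
    rcases reach_iff.1 hr with rfl | hr
    · exact absurd e1 hne
    have hjm := hd.reach_le (n := m + 1) (by omega) hr
    have hj2 : 2 ≤ j := by
      by_contra hc
      rw [father_of_le_one A (by omega)] at e1
      omega
    -- If `j` had the letter of its father, both would have the same depth in T', which the test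
    -- excludes. So `j` ends a run, and the path in T' meets this run.
    have hAj : A j ≠ father A j := by
      intro he
      have := depthS_eq hd hj2 (by omega)
      rw [if_pos he, ← e1] at this
      rcases e2 with e2 | e2
      · omega
      · exact e2 this
    obtain ⟨w, w1, w2⟩ := exists_runEnd_eq hd hf1 (by omega) hj2 hr hAj
    have h := w1.father
    have e : fatherS A w = A (m + 1) := by rw [fatherS, w2, ← e1]
    rwa [e] at h
  · obtain ⟨k1, k2, k3, k4⟩ := key hu
    obtain ⟨a1, a2, a3, a4, a5⟩ := runEnd_spec hd (v := u) k1 (by omega)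
    unfold Accepted
    rw [if_neg (by omega), k4]
    refine Or.inr ⟨hlt, hu.symm, Or.inr ?_, hb⟩
    have := depthS_fatherS hd k1 (by omega)
    rw [a4, this, hu]
    omega

/-- Exponents of bits are bounded by five times the depth of the cluster root; this is the origin of
the fifth power in `Large`. -/
theorem CInv.ln_le {S : CS} (hx : PathWord A x m) (hS : CInv (fatherS A) (depthS A) m S k tc own)
    (hm : m ≤ n) {r : ℕ} (h1 : 1 ≤ r) (h2 : r ≤ m) (hr : S.cl r = r) :
    S.ln r ≤ (4 * n ^ 2) ^ 5 := by
  obtain ⟨-, -, -, s4, -, -, s7⟩ := hS.stage r h1 h2 hr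
  rw [s4]
  calc 2 ^ 3 ^ k r ≤ 2 ^ (5 * depthS A r) := Nat.pow_le_pow_right (by norm_num) s7
    _ = (2 ^ depthS A r) ^ 5 := by rw [mul_comm, pow_mul]
    _ ≤ (4 * r ^ 2) ^ 5 := Nat.pow_le_pow_left (hx.two_pow_depthS_le h1 h2) 5
    _ ≤ (4 * n ^ 2) ^ 5 := Nat.pow_le_pow_left
        (Nat.mul_le_mul_left 4 (Nat.pow_le_pow_left (h2.trans hm) 2)) 5

theorem CInv.nb_le {S : CS} (hS : CInv (fatherS A) (depthS A) m S k tc own)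
    {r : ℕ} (h1 : 1 ≤ r) (h2 : r ≤ m) (hr : S.cl r = r) : S.nb r ≤ S.ln r := by
  obtain ⟨-, -, -, s4, s5, s6, -⟩ := hS.stage r h1 h2 hr
  rw [s4, s5]
  exact Nat.pow_le_pow_right (by norm_num) s6

/-- The vertex from which the son of `a` is searched, in register 29, its cluster in register 26. -/
def startCode : Stmt :=
  .ld 25 9 10 ;; .ld 26 9 12 ;; .ld 27 4 10 ;; .op .add 28 27 5 ;; .op .or 29 12 12 ;;
  .op .xor 30 25 26 ;;
  .ite 30 (.const 31 0) (.ld 31 4 26 ;; .op .sub 31 31 28 ;;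
    .ite 31 (.const 31 0) (.ld 29 8 26 ;; .ld 26 9 29))

theorem startCode_wp (hx : PathWord A x m) (hm : m ≤ n) (hL : Large n b N)
    (hR : Rows A m σ.col) (hS : CInv (fatherS A) (depthS A) m σ.clusters k tc own)
    {f a : ℕ} (hf1 : 1 ≤ f) (hf2 : f ≤ m) (ha1 : 1 ≤ a) (ha2 : a ≤ m)
    (r5 : σ.reg 5 = 1) (r10 : σ.reg 10 = a) (r12 : σ.reg 12 = f)
    (hQ : ∀ σ', σ'.col = σ.col → (∀ r < 25, σ'.reg r = σ.reg r) →
      σ'.reg 25 = σ.clusters.cl a →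
      σ'.reg 26 = σ.clusters.cl (σ.clusters.start (fatherS A) (depthS A) f a) →
      σ'.reg 27 = depthS A a → σ'.reg 28 = depthS A a + 1 →
      σ'.reg 29 = σ.clusters.start (fatherS A) (depthS A) f a → Q σ') :
    startCode.wp b N Q σ := by
  have hi := hL.index
  have hw := hL.word
  have hpow := Nat.two_pow_pos b
  have d1 := hR.depth a ha2
  have d2 := depthS_le hx.decr (v := a) (by omega)
  obtain ⟨c1, c2, c3⟩ := hS.cl f hf1 hf2
  have c1' : 1 ≤ σ.col 9 f := c1
  have c2' : σ.col 9 f ≤ f := c2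
  have d3 := hR.depth (σ.col 9 f) (by omega)
  have d4 := hR.father (σ.col 9 f) (by omega)
  have d5 := hx.isForest.decr.2 _ c1 (by omega)
  have d5' : fatherS A (σ.col 9 f) < σ.col 9 f := d5
  simp only [startCode, Stmt.wp, St.set_reg, St.set_col, WordOp.eval, WordOp.Fine, r5, r10, r12,
    Nat.reduceEqDiff, if_true, if_false, xor_eq_zero, d1, d3, d4, Nat.sub_eq_zero_iff_le]
  split_ifs with e1 e2 <;>
    (repeat' apply And.intro) <;> (try omega) <;> (try trivial) <;> apply hQ <;>
    first
      | (intro r hr; simp [show r ≠ 25 by omega, show r ≠ 26 by omega, show r ≠ 27 by omega,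
          show r ≠ 28 by omega, show r ≠ 29 by omega, show r ≠ 30 by omega,
          show r ≠ 31 by omega])
      | (simp [Nat.or_self, CS.start, St.clusters, e1]; done)
      | simp [Nat.or_self, CS.start, St.clusters, e1, Nat.not_lt.2 e2]
      | simp [Nat.or_self, CS.start, St.clusters, e1, Nat.lt_of_not_le e2]

/-- The son of `a` on the path, in register 34. -/
def childCode : Stmt :=
  .op .xor 30 25 26 ;;
  .ite 30
    (.ld 32 10 29 ;; .ld 33 11 10 ;; .op .add 33 33 33 ;; .op .div 32 32 33 ;;
      .ite 32 (.const 34 0)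
        (.op .sub 35 32 5 ;; .op .and 35 32 35 ;; .op .xor 35 32 35 ;; .op .mul 35 35 33 ;;
          .ld 36 14 26 ;; .ld 37 13 26 ;; .op .sub 38 36 35 ;;
          .ite 38
            (.op .mod 39 35 37 ;; .ld 40 17 26 ;; .op .add 40 40 39 ;; .ld 34 19 40)
            (.const 41 3 ;; .op .div 37 37 41 ;; .op .mod 39 35 37 ;; .ld 40 16 26 ;;
              .op .add 40 40 39 ;; .ld 34 19 40)))
    (.ld 31 4 26 ;; .op .sub 32 31 28 ;;
      .ite 32 (.op .or 34 26 26)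
        (.ld 40 17 26 ;; .ld 37 13 26 ;; .op .add 40 40 37 ;; .op .add 40 40 32 ;; .ld 34 19 40))

theorem childCode_wp (hx : PathWord A x m) (hm : m ≤ n) (hL : Large n b N)
    (hR : Rows A m σ.col) (hS : CInv (fatherS A) (depthS A) m σ.clusters k tc own)
    {v a : ℕ} (hv1 : 1 ≤ v) (hv2 : v ≤ m) (ha1 : 1 ≤ a) (ha2 : a ≤ m)
    (hfull : σ.clusters.cl a ≠ σ.clusters.cl v →
      depthS A a + 1 < depthS A (σ.clusters.cl v) → σ.clusters.cur (σ.clusters.cl v) = 0)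
    (r5 : σ.reg 5 = 1) (r10 : σ.reg 10 = a) (r25 : σ.reg 25 = σ.clusters.cl a)
    (r26 : σ.reg 26 = σ.clusters.cl v) (r28 : σ.reg 28 = depthS A a + 1) (r29 : σ.reg 29 = v)
    (hQ : ∀ σ', σ'.col = σ.col → (∀ r < 30, σ'.reg r = σ.reg r) →
      σ'.reg 34 = σ.clusters.childFrom (depthS A) v a → Q σ') :
    childCode.wp b N Q σ := by
  have hi := hL.index
  have hw := hL.word
  have hsq := hL.square
  have hpow := Nat.two_pow_pos b
  have hF := hx.isForest.mono
  obtain ⟨c1, c2, c3⟩ := hS.cl v hv1 hv2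
  obtain ⟨q1, q2, q3⟩ := hS.cl a ha1 ha2
  have hfree : σ.clusters.free ≤ 27 * m := by
    have := hS.space
    omega
  have hba := hS.lt a ha1 ha2
  have hnb := hS.nb_le q1 (by omega) q3
  have hln := hS.ln_le hx hm q1 (by omega) q3
  have d3 := hR.depth (σ.clusters.cl v) (by omega)
  have hx1 := fun y => (hS.addr_new c1 (by omega) c3 y).2
  have hx2 := fun y => (hS.addr_old c1 (by omega) c3 y).2
  have hch := (hS.exists_child hF hv1 hv2 ha1 ha2 · |>.2)
  have htab : σ.clusters.cl a ≠ σ.clusters.cl v →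
      depthS A a + 1 < depthS A (σ.clusters.cl v) →
      σ.clusters.bn (σ.clusters.cl v) + σ.clusters.M (σ.clusters.cl v) +
        (depthS A (σ.clusters.cl v) - (depthS A a + 1)) < σ.clusters.free := by
    intro h1 h2
    have hcur := hfull h1 h2
    obtain ⟨t1, t2, -⟩ := hS.table _ c1 (by omega) c3
    have e1 := hF.iterate (v := σ.clusters.cl v) (by omega) (tc (σ.clusters.cl v))
    rw [← t2, hcur, depthS_zero] at e1
    exact (hS.addr_table c1 (by omega) c3 (by omega)).2
  -- The product is the bit of a vertex of the cluster, hence below `nb`.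
  have hbit : σ.clusters.cl a = σ.clusters.cl v →
      σ.clusters.mask v / (2 * σ.clusters.bit a) ≠ 0 →
      lowBit (σ.clusters.mask v / (2 * σ.clusters.bit a)) * (2 * σ.clusters.bit a) < 2 ^ b := by
    intro h1 h2
    obtain ⟨u, u1, u2, u3, u4, -⟩ := hch h1 h2
    have hu := hF.decr.reach_le hv2 u2
    have := hS.lt u u1 (by omega)
    rw [u3] at this
    have h3 := hS.nb_le c1 (by omega) c3
    have h4 := hS.ln_le hx hm c1 (by omega) c3
    omega
  rw [show σ.clusters.free = σ.reg 4 from rfl] at hfree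
  have em : σ.col 10 = σ.clusters.mask := rfl
  have eb : σ.col 11 = σ.clusters.bit := rfl
  have eM : σ.col 13 = σ.clusters.M := rfl
  have elo : σ.col 14 = σ.clusters.lo := rfl
  have ebo : σ.col 16 = σ.clusters.bo := rfl
  have ebn : σ.col 17 = σ.clusters.bn := rfl
  have ea : σ.col 19 = σ.clusters.aux := rfl
  have ef : σ.clusters.free = σ.reg 4 := rfl
  have hlb : ∀ y, y ^^^ (y &&& (y - 1)) = lowBit y := fun y => rfl
  generalize hG : σ.clusters = S at *
  simp only [childCode, Stmt.wp, St.set_reg, St.set_col, WordOp.eval, WordOp.Fine, r5, r10, r25,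
    r26, r28, r29, em, eb, eM, elo, ebo, ebn, ea, d3, ← two_mul, hlb,
    Nat.reduceEqDiff, if_true, if_false, xor_eq_zero, Nat.sub_eq_zero_iff_le]
  have frame : ∀ r < 30, r ≠ 30 ∧ r ≠ 31 ∧ r ≠ 32 ∧ r ≠ 33 ∧ r ≠ 34 ∧ r ≠ 35 ∧ r ≠ 36 ∧ r ≠ 37 ∧
      r ≠ 38 ∧ r ≠ 39 ∧ r ≠ 40 ∧ r ≠ 41 := fun r hr => by omega
  split_ifs with e1 e2 e3 e4
  · refine ⟨trivial, by omega, by omega, by omega, trivial, hpow, hQ _ rfl (fun r hr => ?_) ?_⟩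
    · simp [frame r hr]
    · simp [CS.childFrom, e1, e2]
  · have := hx1 (lowBit (S.mask v / (2 * S.bit a)) * (2 * S.bit a))
    refine ⟨trivial, by omega, by omega, by omega, trivial, trivial, trivial, trivial,
      hbit e1 e2, by omega, by omega, trivial, trivial, by omega, by omega, by omega,
      hQ _ rfl (fun r hr => ?_) ?_⟩
    · simp [frame r hr]
    · simp [CS.childFrom, e1, e2, CS.lookup, e3, Nat.not_lt.2 e3]
  · have := hx2 (lowBit (S.mask v / (2 * S.bit a)) * (2 * S.bit a))
    refine ⟨trivial, by omega, by omega, by omega, trivial, trivial, trivial, trivial,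
      hbit e1 e2, by omega, by omega, trivial, by omega, trivial, trivial, by omega, by omega,
      by omega, hQ _ rfl (fun r hr => ?_) ?_⟩
    · simp [frame r hr]
    · simp [CS.childFrom, e1, e2, CS.lookup, Nat.lt_of_not_le e3]
  · refine ⟨trivial, by omega, trivial, trivial, hQ _ rfl (fun r hr => ?_) ?_⟩
    · simp [frame r hr]
    · simp [CS.childFrom, e1, e4, Nat.or_self]
  · have := htab e1 (by omega)
    refine ⟨trivial, by omega, trivial, by omega, by omega, by omega, by omega, by omega,
      hQ _ rfl (fun r hr => ?_) ?_⟩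
    · simp [frame r hr]
    · simp [CS.childFrom, e1, e4]

end

section

/-! ### Validation of a value -/

variable {A : ℕ → ℕ} {n m b N : ℕ} {β : Type*} {x : ℕ → β} {Q : St → Prop} {σ : St}
  {k tc : ℕ → ℕ} {own : ℕ → ℕ × ℕ}

/-- The father is always a candidate, and the query goes up zero levels; this case needs no
clusters. -/
theorem accepted_of_eq_father (hx : PathWord A x m) (h1 : 1 ≤ m)
    (he : A (m + 1) = father A (m + 1)) :
    Accepted A (m + 1) ∧ queryT A (m + 1) = m + 1 := by
  have hd := hx.decr
  have hf0 := hd.2 (m + 1) (by omega) le_rfl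
  have hf1 := father_pos A (i := m + 1) (by omega)
  have hq : queryT A (m + 1) = m + 1 := by
    rw [queryT_of_ne_zero (by omega) (by omega), he]
    exact levelAncestor_eq hd le_rfl (Reach.refl _ _) (by omega)
  refine ⟨?_, hq⟩
  unfold Accepted
  rw [if_neg (by omega), hq, candBits_eq hd (by omega) le_rfl, he]
  exact Or.inr ⟨hf0, rfl, Or.inl rfl, by simp [testBit_setBit]⟩

theorem shiftRight_and_one (y e : ℕ) : (y >>> e) &&& 1 = 0 ↔ y.testBit e = false := by
  rw [Nat.testBit, Nat.and_comm]
  simp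

/-- The tests for the son of `A[i]` in register 34, and the answer of the level ancestor query. -/
def acceptCode : Stmt :=
  .ld 42 8 34 ;; .op .xor 42 42 10 ;;
  .ite 42
    (.op .shr 43 15 27 ;; .op .and 43 43 5 ;; .ite 43 (.const 0 0) (.ld 23 7 34))
    (.const 0 0)

/-- The number of letters, the letter, and the answer of the level ancestor query in the registers
21, 22 and 23, or the error. -/
def lettersCode : Stmt :=
  .ld 21 2 12 ;;
  .ite 10 (.op .add 21 21 5 ;; .op .or 22 21 21 ;; .const 23 0)
    (.op .sub 24 3 10 ;;
      .ite 24 (.const 0 0)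
        (.ld 22 1 10 ;; .ite 18 (.op .or 23 3 3) (startCode ;; childCode ;; acceptCode)))

/-- The value `0`, values that are too large and the father are settled at once. In the remaining
case the son found in T' replaces the level ancestor in T, by `accepted_iff_child`. -/
theorem lettersCode_wp (hx : PathWord A x m) (h1 : 1 ≤ m) (hm : m + 1 ≤ n) (hL : Large n b N)
    (hR : Rows A m σ.col) (hS : CInv (fatherS A) (depthS A) m σ.clusters k tc own)
    (r3 : σ.reg 3 = m + 1) (r5 : σ.reg 5 = 1) (r10 : σ.reg 10 = A (m + 1))
    (r12 : σ.reg 12 = father A (m + 1)) (r15 : σ.reg 15 = candBits A (m + 1))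
    (r18 : σ.reg 18 = A (m + 1) ^^^ father A (m + 1))
    (hQ : ∀ σ', σ'.col = σ.col → (∀ r, 1 ≤ r → r ≤ 20 → σ'.reg r = σ.reg r) →
      (Accepted A (m + 1) → σ'.reg 0 = σ.reg 0 ∧ σ'.reg 21 = lettersT A (m + 1) ∧
        σ'.reg 22 = letterAt A (m + 1) ∧ σ'.reg 23 = queryT A (m + 1)) →
      (¬ Accepted A (m + 1) → σ'.reg 0 = 0) → Q σ') :
    lettersCode.wp b N Q σ := by
  have hi := hL.index
  have hw := hL.word
  have hpow := Nat.two_pow_pos b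
  have hd := hx.decr
  have hf0 := hd.2 (m + 1) (by omega) le_rfl
  have hf1 := father_pos A (i := m + 1) (by omega)
  obtain ⟨-, -, f2, -⟩ := hR.val _ hf1 (by omega)
  have f3 := lettersT_le hd (v := father A (m + 1)) (by omega)
  have f4 := lettersT_eq hd (v := m + 1) (by omega) le_rfl
  simp only [lettersCode, Stmt.wp, St.set_reg, St.set_col, WordOp.eval, WordOp.Fine, r3, r5, r10,
    r12, r18, Nat.reduceEqDiff, if_true, if_false, xor_eq_zero, Nat.sub_eq_zero_iff_le, f2]
  have frame : ∀ r, 1 ≤ r → r ≤ 20 → r ≠ 0 ∧ r ≠ 21 ∧ r ≠ 22 ∧ r ≠ 23 ∧ r ≠ 24 :=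
    fun r _ _ => by omega
  split_ifs with e1 e2 e3
  · rw [if_pos e1] at f4
    refine ⟨by omega, by omega, trivial, hpow, hQ _ rfl (fun r g1 g2 => ?_) (fun _ => ?_)
      (fun hA => absurd ?_ hA)⟩
    · simp [frame r g1 g2]
    · simp [f4, Nat.or_self, letterAt_of_eq_zero (show 1 ≤ m + 1 by omega) e1,
        queryT_of_eq_zero e1]
    · unfold Accepted
      rw [if_neg (by omega)]
      exact Or.inl e1
  · refine ⟨by omega, trivial, hpow, hQ _ rfl (fun r g1 g2 => ?_) (fun hA => ?_)
      (fun hA => ?_)⟩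
    · simp [frame r g1 g2]
    · have := hA.lt (by omega)
      omega
    · simp
  · obtain ⟨a1, a2⟩ := accepted_of_eq_father hx h1 e3
    have f5 := (hR.val (A (m + 1)) (by omega) (by omega)).2.1
    rw [if_neg e1] at f4
    refine ⟨by omega, trivial, by omega, trivial, hQ _ rfl (fun r g1 g2 => ?_) (fun _ => ?_)
      (fun hA => absurd a1 hA)⟩
    · simp [frame r g1 g2]
    · simp [f4, f5, a2, Nat.or_self, letterAt_of_ne_zero e1 (by omega)]
  · have f5 := (hR.val (A (m + 1)) (by omega) (by omega)).2.1
    rw [if_neg e1] at f4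
    refine ⟨by omega, trivial, by omega, ?_⟩
    obtain ⟨c1, -⟩ := hS.child_spec hx.isForest.mono hf1 (by omega) (a := A (m + 1)) (by omega)
      (by omega)
    obtain ⟨s1, s2, -, -, s5⟩ := hS.start_spec hx.isForest.mono hf1 (by omega) (a := A (m + 1))
      (by omega) (by omega)
    obtain ⟨t1, t2⟩ := accepted_iff_child hx hS h1 e1 (by omega) e3
    have c2 : σ.clusters.child (fatherS A) (depthS A) (father A (m + 1)) (A (m + 1)) ≤ m := by
      rcases c1 with h | h
      · omega
      · exact (hx.isForest.mono.decr.reach_le (by omega) h).trans (by omega)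
    have g8 := hR.father _ c2
    have g7 := hR.run _ c2
    refine startCode_wp hx (by omega) hL (by exact hR) (by exact hS) hf1 (by omega)
      (a := A (m + 1)) (by omega) (by omega) (by simp [r5]) (by simp [r10]) (by simp [r12]) ?_
    intro σ₁ k1 k2 k3 k4 k5 k6 k7
    simp only [St.set_col] at k1
    have k8 : σ₁.clusters = σ.clusters := by
      simp [St.clusters, k1, k2 4]
    refine childCode_wp hx (by omega) hL (by rw [k1]; exact hR) (by rw [k8]; exact hS) s1 s2
      (a := A (m + 1)) (by omega) (by omega) (by rw [k8]; exact s5) (by simp [k2, r5])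
      (by simp [k2, r10]) (by rw [k8]; exact k3) (by rw [k8]; exact k4) k6 k7 ?_
    intro σ₂ l1 l2 l3
    rw [k8] at l3
    change σ₂.reg 34 = σ.clusters.child (fatherS A) (depthS A) (father A (m + 1)) (A (m + 1)) at l3
    generalize σ.clusters.child (fatherS A) (depthS A) (father A (m + 1)) (A (m + 1)) = u at *
    have r5' : σ₂.reg 5 = 1 := by simp [l2, k2, r5]
    have r10' : σ₂.reg 10 = A (m + 1) := by simp [l2, k2, r10]
    have r15' : σ₂.reg 15 = candBits A (m + 1) := by simp [l2, k2, r15]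
    have r21' : σ₂.reg 21 = lettersT A (father A (m + 1)) := by simp [l2, k2]
    have r22' : σ₂.reg 22 = letterAt A (A (m + 1)) := by simp [l2, k2, f5]
    have r0' : σ₂.reg 0 = σ.reg 0 := by simp [l2, k2]
    have r27' : σ₂.reg 27 = depthS A (A (m + 1)) := by rw [l2 27 (by omega), k5]
    have ec : σ₂.col = σ.col := l1.trans k1
    have er : ∀ r, 1 ≤ r → r ≤ 20 → σ₂.reg r = σ.reg r := fun r q1 q2 => by
      rw [l2 r (by omega), k2 r (by omega)]
      simp [frame r q1 q2]
    have frame' : ∀ r, 1 ≤ r → r ≤ 20 → r ≠ 42 ∧ r ≠ 43 := fun r _ _ => by omega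
    simp only [acceptCode, Stmt.wp, St.set_reg, St.set_col, WordOp.eval, WordOp.Fine, r5', r10',
      r15', r27', l3, ec, g8, g7, Nat.reduceEqDiff, if_true, if_false, xor_eq_zero,
      shiftRight_and_one]
    split_ifs with p1 p2
    · refine ⟨by omega, trivial, trivial, trivial, hpow, hQ _ ec (fun r q1 q2 => ?_) (fun hA => ?_)
        (fun hA => ?_)⟩
      · simp [frame r q1 q2, frame' r q1 q2, er r q1 q2]
      · have := (t1.1 hA).2
        rw [p2] at this
        cases this
      · simp
    · refine ⟨by omega, trivial, trivial, trivial, by omega, hQ _ ec (fun r q1 q2 => ?_)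
        (fun hA => ?_) (fun hA => absurd (t1.2 ⟨p1, by simpa using p2⟩) hA)⟩
      · simp [frame r q1 q2, frame' r q1 q2, er r q1 q2]
      · simp [r0', r21', r22', f4, t2 p1, letterAt_of_ne_zero e1 (show A (m + 1) < m + 1 by omega)]
    · refine ⟨by omega, trivial, hpow, hQ _ ec (fun r q1 q2 => ?_) (fun hA => ?_)
        (fun hA => ?_)⟩
      · simp [frame r q1 q2, frame' r q1 q2, er r q1 q2]
      · exact absurd (t1.1 hA).1 p1
      · simp

end

section

/-! ### Storing the results -/

variable {A : ℕ → ℕ} {n m b N : ℕ} {β : Type*} {x : ℕ → β} {Q : St → Prop} {σ : St}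
  {k tc : ℕ → ℕ} {own : ℕ → ℕ × ℕ}

/-- The values for position `i` are in the registers. -/
structure RowRegs (A : ℕ → ℕ) (i : ℕ) (r : ℕ → ℕ) : Prop where
  val : r 10 = A i
  letter : r 22 = letterAt A i
  letters : r 21 = lettersT A i
  depthT : r 13 = depthT A i
  depthS : r 14 = depthS A i
  cand : r 15 = candBits A i
  query : r 23 = queryT A i
  run : r 19 = runEnd A i
  father : r 20 = fatherS A i

/-- The values for position 1, or the error. -/
def firstCode : Stmt :=
  .ite 10
    (.const 22 1 ;; .const 21 1 ;; .const 13 1 ;; .const 14 1 ;; .const 15 0 ;; .const 23 0 ;;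
      .const 19 1 ;; .const 20 0)
    (.const 0 0)

theorem firstCode_wp (hL : Large n b N) (r10 : σ.reg 10 = A 1)
    (hQ : ∀ σ', σ'.col = σ.col → (∀ r, 1 ≤ r → r ≤ 5 → σ'.reg r = σ.reg r) →
      (Accepted A 1 → σ'.reg 0 = σ.reg 0 ∧ RowRegs A 1 σ'.reg) →
      (¬ Accepted A 1 → σ'.reg 0 = 0) → Q σ') :
    firstCode.wp b N Q σ := by
  have hi := hL.index
  have hw := hL.word
  have frame : ∀ r, 1 ≤ r → r ≤ 5 → r ≠ 0 ∧ r ≠ 22 ∧ r ≠ 21 ∧ r ≠ 13 ∧ r ≠ 14 ∧ r ≠ 15 ∧ r ≠ 23 ∧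
    r ≠ 19 ∧ r ≠ 20 := fun r _ _ => by omega
  simp only [firstCode, Stmt.wp, r10]
  split_ifs with h0
  · have hd : Decr (BorderArray.father A) 1 :=
      decr_father (n := 0) fun i _ _ => by omega
    have e0 : BorderArray.father A 1 = 0 := father_of_le_one A le_rfl
    have e1 : lettersT A 1 = 1 := by
      rw [lettersT_eq hd le_rfl le_rfl, if_pos h0, e0, lettersT_zero]
    refine ⟨by omega, by omega, by omega, by omega, by omega, by omega, by omega, by omega,
      hQ _ rfl (fun r g1 g2 => ?_) (fun _ => ⟨by simp, ?_⟩) (fun h => absurd ?_ h)⟩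
    · simp [frame r g1 g2]
    · constructor <;>
        simp [r10, e0, e1, letterAt_of_eq_zero le_rfl h0, BorderArray.depthT_eq hd le_rfl le_rfl,
          BorderArray.depthT_zero,
          depthS_one, candBits_of_le_one, queryT_of_eq_zero h0, runEnd_one, fatherS_one]
    · simpa [Accepted] using h0
  · refine ⟨by omega, hQ _ rfl (fun r g1 g2 => ?_) (fun h => absurd ?_ h0) (fun _ => by simp)⟩
    · simp [frame r g1 g2]
    · simpa [Accepted] using h

/-- The next row of the tables, the last letter and the size of the alphabet. -/
def storeCode : Stmt :=
  .st 0 3 10 ;; .st 1 3 22 ;; .st 2 3 21 ;; .st 3 3 13 ;; .st 4 3 14 ;; .st 5 3 15 ;; .st 6 3 23 ;;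
  .st 7 3 19 ;; .st 8 3 20 ;; .op .sub 24 21 2 ;; .op .add 2 2 24 ;; .op .or 1 22 22

theorem storeCode_wp (hx : PathWord A x m) (hm : m + 1 ≤ n) (hL : Large n b N)
    (hR : Rows A m σ.col) (hr : RowRegs A (m + 1) σ.reg) (r2 : σ.reg 2 = maxLetters A m)
    (r3 : σ.reg 3 = m + 1)
    (hQ : ∀ σ', (∀ j, 9 ≤ j → σ'.col j = σ.col j) → Rows A (m + 1) σ'.col →
      σ'.reg 0 = σ.reg 0 → σ'.reg 1 = letterAt A (m + 1) → σ'.reg 2 = maxLetters A (m + 1) →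
      (∀ r, 3 ≤ r → r ≤ 20 → σ'.reg r = σ.reg r) → Q σ') :
    storeCode.wp b N Q σ := by
  have hi := hL.index
  have hw := hL.word
  have hd := hx.decr
  have e1 := lettersT_le hd (v := m + 1) le_rfl
  have e2 : maxLetters A m ≤ m :=
    maxLetters_le fun i _ h2 => (lettersT_le hd (by omega)).trans h2
  -- Truncated subtraction followed by addition computes the maximum.
  have e3 : maxLetters A m + (lettersT A (m + 1) - maxLetters A m) = maxLetters A (m + 1) := by
    rw [maxLetters]
    omega
  have e4 : maxLetters A (m + 1) ≤ m + 1 := by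
    rw [maxLetters]
    omega
  simp only [storeCode, Stmt.wp, St.set_reg, St.put_reg, WordOp.eval, WordOp.Fine, r2, r3,
    hr.val, hr.letter, hr.letters, hr.depthT, hr.depthS, hr.cand, hr.query, hr.run, hr.father,
    Nat.reduceEqDiff, if_true, if_false, e3]
  refine ⟨by omega, by omega, by omega, by omega, by omega, by omega, by omega, by omega, by omega,
    trivial, by omega, trivial, hQ _ (fun j hj => ?_) ⟨fun v h1 h2 => ?_, fun v h2 => ?_,
      fun v h2 => ?_, fun v h2 => ?_⟩ ?_ ?_ ?_ (fun r h1 h2 => ?_)⟩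
  · simp [show j ≠ 0 ∧ j ≠ 1 ∧ j ≠ 2 ∧ j ≠ 3 ∧ j ≠ 4 ∧ j ≠ 5 ∧ j ≠ 6 ∧ j ≠ 7 ∧ j ≠ 8 by omega]
  · rcases Nat.lt_or_ge v (m + 1) with hv | hv
    · have := hR.val v h1 (by omega)
      simpa [Function.update_of_ne hv.ne] using this
    · obtain rfl : v = m + 1 := by omega
      simp
  · rcases Nat.lt_or_ge v (m + 1) with hv | hv
    · simpa [Function.update_of_ne hv.ne] using hR.depth v (by omega)
    · obtain rfl : v = m + 1 := by omega
      simp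
  · rcases Nat.lt_or_ge v (m + 1) with hv | hv
    · simpa [Function.update_of_ne hv.ne] using hR.run v (by omega)
    · obtain rfl : v = m + 1 := by omega
      simp
  · rcases Nat.lt_or_ge v (m + 1) with hv | hv
    · simpa [Function.update_of_ne hv.ne] using hR.father v (by omega)
    · obtain rfl : v = m + 1 := by omega
      simp
  · simp
  · simp
  · simp
  · simp [show r ≠ 1 ∧ r ≠ 2 ∧ r ≠ 24 by omega]

/-- A new cluster with the root in register 3. -/
def newCode : Stmt :=
  .st 9 3 3 ;; .st 10 3 5 ;; .st 11 3 5 ;; .const 27 2 ;; .st 12 3 27 ;; .st 14 3 27 ;;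
  .const 27 9 ;; .st 13 3 27 ;; .const 27 8 ;; .st 15 3 27 ;; .st 16 3 4 ;;
  .const 27 3 ;; .op .add 28 4 27 ;; .st 17 3 28 ;; .st 18 3 3 ;; .op .add 28 4 5 ;;
  .st 19 28 3 ;; .const 27 21 ;; .op .add 4 4 27

theorem newCode_wp (hm : m + 1 ≤ n) (hL : Large n b N) (hf : σ.clusters.free ≤ 27 * m)
    (r3 : σ.reg 3 = m + 1) (r5 : σ.reg 5 = 1)
    (hQ : ∀ σ', (∀ j < 9, σ'.col j = σ.col j) → (∀ r < 20, r ≠ 4 → σ'.reg r = σ.reg r) →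
      σ'.clusters = σ.clusters.newCluster (m + 1) → Q σ') :
    newCode.wp b N Q σ := by
  have hi := hL.index
  have hw := hL.word
  have r4 : σ.reg 4 ≤ 27 * m := hf
  simp only [newCode, Stmt.wp, St.set_reg, St.put_reg, WordOp.eval, WordOp.Fine, r3, r5,
    Nat.reduceEqDiff, if_true, if_false]
  (repeat' apply And.intro)
  all_goals try omega
  apply hQ
  · intro j hj
    simp [show j ≠ 9 ∧ j ≠ 10 ∧ j ≠ 11 ∧ j ≠ 12 ∧ j ≠ 13 ∧ j ≠ 14 ∧ j ≠ 15 ∧ j ≠ 16 ∧ j ≠ 17 ∧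
      j ≠ 18 ∧ j ≠ 19 by omega]
  · intro r hr h4
    simp [h4, show r ≠ 27 ∧ r ≠ 28 by omega]
  · simp [St.clusters, CS.newCluster]

/-- The cluster in register 25 grows; its old size is in register 28. -/
def growCode : Stmt :=
  .ld 30 17 25 ;; .st 16 25 30 ;; .ld 31 13 25 ;; .const 32 3 ;; .op .mul 31 32 31 ;;
  .st 13 25 31 ;; .st 17 25 4 ;; .op .add 31 31 31 ;; .op .add 4 4 31 ;; .st 14 25 28 ;;
  .op .mul 33 28 28 ;; .op .mul 33 33 28 ;; .st 15 25 33 ;; .st 18 25 25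

/-- The invariant is assumed for the cluster after its growth: applied to the new `ln`, the cube of
the old one, its bound shows that the products fit into a word. -/
theorem growCode_wp (hx : PathWord A x m) (hm : m + 1 ≤ n) (hL : Large n b N) {r : ℕ}
    (hS : CInv (fatherS A) (depthS A) m (σ.clusters.grow r) k tc own)
    (h1 : 1 ≤ r) (h2 : r ≤ m) (hr : σ.clusters.cl r = r) (hln : 1 ≤ σ.clusters.ln r)
    (r25 : σ.reg 25 = r) (r28 : σ.reg 28 = σ.clusters.ln r)
    (hQ : ∀ σ', (∀ j < 9, σ'.col j = σ.col j) → (∀ s < 30, s ≠ 4 → σ'.reg s = σ.reg s) →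
      σ'.clusters = σ.clusters.grow r → Q σ') :
    growCode.wp b N Q σ := by
  have hi := hL.index
  have hw := hL.word
  have hsq := hL.square
  have hfree : (σ.clusters.grow r).free ≤ 27 * m := by
    have := hS.space
    omega
  have hl := hS.ln_le hx (show m ≤ n by omega) h1 h2 hr
  simp only [CS.grow, Function.update_self] at hfree hl
  have hl2 : σ.clusters.ln r * σ.clusters.ln r ≤
      σ.clusters.ln r * σ.clusters.ln r * σ.clusters.ln r := Nat.le_mul_of_pos_right _ hln
  have eM : σ.col 13 = σ.clusters.M := rfl
  have ebn : σ.col 17 = σ.clusters.bn := rfl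
  have ef : σ.reg 4 = σ.clusters.free := rfl
  simp only [growCode, Stmt.wp, St.set_reg, St.put_reg, St.set_col, St.put_col, WordOp.eval,
    WordOp.Fine, r25, r28, eM, ebn, ef, Nat.reduceEqDiff, if_true, if_false]
  (repeat' apply And.intro)
  all_goals try omega
  apply hQ
  · intro j hj
    simp [show j ≠ 13 ∧ j ≠ 14 ∧ j ≠ 15 ∧ j ≠ 16 ∧ j ≠ 17 ∧ j ≠ 18 by omega]
  · intro s hs h4
    simp [h4, show s ≠ 30 ∧ s ≠ 31 ∧ s ≠ 32 ∧ s ≠ 33 by omega]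
  · simp [St.clusters, CS.grow, two_mul]

/-- The vertex in register 3 joins the cluster in register 25. -/
def joinCode : Stmt :=
  .ld 26 18 25 ;; .ld 27 12 25 ;; .ld 28 14 25 ;; .ld 29 13 25 ;; .ld 30 17 25 ;; .ld 31 16 25 ;;
  .op .mod 32 27 29 ;; .op .add 32 30 32 ;; .op .div 33 27 28 ;; .op .sub 34 28 33 ;;
  -- Register 34 is zero when `lo ≤ nb / lo`; then no old names are left to be copied.
  .ite 34 (.st 19 32 3)
    (.const 35 3 ;; .op .div 35 29 35 ;; .op .mod 35 33 35 ;; .op .add 35 31 35 ;; .ld 36 19 35 ;;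
      .op .mod 37 33 29 ;; .op .add 37 30 37 ;; .st 19 32 3 ;; .st 19 37 36) ;;
  .ld 38 4 25 ;; .ld 39 4 26 ;; .op .sub 38 38 39 ;; .op .add 39 30 29 ;; .op .add 39 39 38 ;;
  .st 19 39 26 ;; .ld 40 10 20 ;; .op .or 40 40 27 ;; .st 9 3 25 ;; .st 10 3 40 ;; .st 11 3 27 ;;
  .op .add 41 27 27 ;; .st 12 25 41 ;; .ld 42 8 26 ;; .st 18 25 42

theorem joinCode_wp (hx : PathWord A x m) (hm : m + 1 ≤ n) (hL : Large n b N) {r : ℕ}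
    (hR : Rows A (m + 1) σ.col)
    (hS : CInv (fatherS A) (depthS A) m σ.clusters k tc own)
    (h1 : 1 ≤ r) (h2 : r ≤ m) (hr : σ.clusters.cl r = r) (hc : σ.clusters.cur r ≠ 0)
    (r3 : σ.reg 3 = m + 1) (r20 : σ.reg 20 = fatherS A (m + 1)) (r25 : σ.reg 25 = r)
    (hQ : ∀ σ', (∀ j < 9, σ'.col j = σ.col j) → (∀ s < 20, σ'.reg s = σ.reg s) →
      σ'.clusters = σ.clusters.join (fatherS A) (depthS A) r (m + 1) → Q σ') :
    joinCode.wp b N Q σ := by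
  have hi := hL.index
  have hw := hL.word
  have hsq := hL.square
  have hF := hx.isForest.mono
  have hfree : σ.clusters.free ≤ 27 * m := by
    have := hS.space
    omega
  have hnb := hS.nb_le h1 h2 hr
  have hl := hS.ln_le hx (show m ≤ n by omega) h1 h2 hr
  have hcur : σ.clusters.cur r ≤ m := by
    rw [(hS.table r h1 h2 hr).2.1]
    exact (hF.decr.iterate_le h2 _).trans h2
  have hp := hx.isForest.decr.2 (m + 1) (by omega) le_rfl
  have a1 := (hS.addr_new h1 h2 hr (σ.clusters.nb r)).2
  have a2 := (hS.addr_new h1 h2 hr (σ.clusters.nb r / σ.clusters.lo r)).2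
  have a3 := (hS.addr_old h1 h2 hr (σ.clusters.nb r / σ.clusters.lo r)).2
  have a4 := (hS.addr_table h1 h2 hr le_rfl).2
  rw [← (hS.tc_lt hF h1 h2 hr hc).2] at a4
  have d1 := hR.depth r (by omega)
  have d2 := hR.depth (σ.clusters.cur r) (by omega)
  have d3 := hR.father (σ.clusters.cur r) (by omega)
  have em : σ.col 10 = σ.clusters.mask := rfl
  have en : σ.col 12 = σ.clusters.nb := rfl
  have eM : σ.col 13 = σ.clusters.M := rfl
  have elo : σ.col 14 = σ.clusters.lo := rfl
  have ebo : σ.col 16 = σ.clusters.bo := rfl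
  have ebn : σ.col 17 = σ.clusters.bn := rfl
  have ecur : σ.col 18 = σ.clusters.cur := rfl
  have ea : σ.col 19 = σ.clusters.aux := rfl
  have efr : σ.clusters.free = σ.reg 4 := rfl
  have ecl : σ.clusters.cl = σ.col 9 := rfl
  have eb : σ.clusters.bit = σ.col 11 := rfl
  have eln : σ.clusters.ln = σ.col 15 := rfl
  generalize hG : σ.clusters = S at *
  simp only [joinCode, Stmt.wp, St.set_reg, St.put_reg, St.set_col, St.put_col, WordOp.eval,
    WordOp.Fine, r3, r20, r25, em, en, eM, elo, ebo, ebn, ecur, ea, d1, d2, d3,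
    Nat.reduceEqDiff, if_true, if_false]
  have frame : ∀ s < 20, s ≠ 26 ∧ s ≠ 27 ∧ s ≠ 28 ∧ s ≠ 29 ∧ s ≠ 30 ∧ s ≠ 31 ∧ s ≠ 32 ∧ s ≠ 33 ∧
      s ≠ 34 ∧ s ≠ 35 ∧ s ≠ 36 ∧ s ≠ 37 ∧ s ≠ 38 ∧ s ≠ 39 ∧ s ≠ 40 ∧ s ≠ 41 ∧ s ≠ 42 :=
    fun s hs => by omega
  split_ifs with e1
  · (repeat' apply And.intro) <;> (try omega) <;> (try trivial)
    apply hQ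
    · intro j hj
      simp [show j ≠ 9 ∧ j ≠ 10 ∧ j ≠ 11 ∧ j ≠ 12 ∧ j ≠ 18 ∧ j ≠ 19 by omega]
    · intro s hs
      simp [frame s hs]
    · simp [St.clusters, CS.join, CS.joinAux, e1, efr, ecl, eb, eln, em, en, eM, elo, ebo, ebn,
        ecur, ea]
  · (repeat' apply And.intro) <;> (try omega) <;> (try trivial)
    apply hQ
    · intro j hj
      simp [show j ≠ 9 ∧ j ≠ 10 ∧ j ≠ 11 ∧ j ≠ 12 ∧ j ≠ 18 ∧ j ≠ 19 by omega]
    · intro s hs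
      simp [frame s hs]
    · simp [St.clusters, CS.join, CS.joinAux, e1, efr, ecl, eb, eln, em, en, eM, elo, ebo, ebn,
        ecur, ea]

/-- Insertion of the vertex in register 3, with its father in register 20, into the clusters. -/
def insertCode : Stmt :=
  .ld 25 9 20 ;; .ld 26 18 25 ;;
  .ite 26 newCode
    (.ld 27 12 25 ;; .ld 28 15 25 ;; .op .xor 29 27 28 ;; .ite 29 growCode (.const 30 0) ;;
      joinCode)

theorem insertCode_wp (hx : PathWord A x m) (hm : m + 1 ≤ n) (hL : Large n b N)
    (hR : Rows A (m + 1) σ.col)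
    (hS : CInv (fatherS A) (depthS A) m σ.clusters k tc own)
    (r3 : σ.reg 3 = m + 1) (r5 : σ.reg 5 = 1) (r20 : σ.reg 20 = fatherS A (m + 1))
    (hQ : ∀ σ', (∀ j < 9, σ'.col j = σ.col j) → (∀ s < 20, s ≠ 4 → σ'.reg s = σ.reg s) →
      (∃ k tc own, CInv (fatherS A) (depthS A) (m + 1) σ'.clusters k tc own) → Q σ') :
    insertCode.wp b N Q σ := by
  have hi := hL.index
  have hw := hL.word
  have hF := hx.isForest
  have hfree : σ.clusters.free ≤ 27 * m := by
    have := hS.space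
    omega
  have hp := hF.decr.2 (m + 1) (by omega) le_rfl
  have hcl : σ.clusters.cl (fatherS A (m + 1)) ≤ m := by
    rcases Nat.eq_zero_or_pos (fatherS A (m + 1)) with h0 | h0
    · rw [h0, hS.cl_zero]
      omega
    · have := (hS.cl _ h0 (by omega)).2.1
      omega
  have ecl : σ.col 9 = σ.clusters.cl := rfl
  have en : σ.col 12 = σ.clusters.nb := rfl
  have eln : σ.col 15 = σ.clusters.ln := rfl
  have ecur : σ.col 18 = σ.clusters.cur := rfl
  simp only [insertCode, Stmt.wp, St.set_reg, St.set_col, WordOp.eval, WordOp.Fine, r20, ecl, en,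
    eln, ecur, Nat.reduceEqDiff, if_true, if_false, xor_eq_zero]
  split_ifs with e1 e2
  · refine ⟨by omega, by omega, newCode_wp hm hL (by exact hfree) (by simp [r3]) (by simp [r5])
      fun σ' q1 q2 q3 => hQ σ' (by simpa using q1) (fun s hs h4 => ?_) ?_⟩
    · rw [q2 s hs h4]
      simp [show s ≠ 25 ∧ s ≠ 26 by omega]
    · rw [q3]
      exact ⟨_, _, _, hS.newCluster hF e1⟩
  all_goals
    have h0 : 1 ≤ fatherS A (m + 1) := by
      by_contra hc
      rw [show fatherS A (m + 1) = 0 by omega, hS.cl_zero, hS.cur_zero] at e1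
      exact e1 rfl
    obtain ⟨c1, c2, c3⟩ := hS.cl _ h0 (by omega)
  · have hS' := hS.grow hF.mono c1 hcl c3 e1 e2
    -- A number of at least 2 is smaller than its cube, so after growing there is room for the
    -- vertex.
    have hln : 2 ≤ σ.clusters.ln (σ.clusters.cl (fatherS A (m + 1))) := by
      rw [(hS.stage _ c1 hcl c3).2.2.2.1]
      exact Nat.le_self_pow (by positivity) 2
    refine ⟨by omega, by omega, by omega, by omega, trivial, growCode_wp hx hm hL (by exact hS') c1
      hcl c3 (Nat.le_of_succ_le hln) (by simp) (by simp [St.clusters]) fun σ₁ p1 p2 p3 => ?_⟩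
    change σ₁.clusters = σ.clusters.grow _ at p3
    have hR' : Rows A (m + 1) σ₁.col := by
      refine ⟨fun v h1 h2 => ?_, fun v h2 => ?_, fun v h2 => ?_, fun v h2 => ?_⟩ <;>
        simp only [p1 0 (by omega), p1 1 (by omega), p1 2 (by omega), p1 3 (by omega),
          p1 4 (by omega), p1 5 (by omega), p1 6 (by omega), p1 7 (by omega), p1 8 (by omega)]
      · exact hR.val v h1 h2
      · exact hR.depth v h2
      · exact hR.run v h2
      · exact hR.father v h2
    generalize hr : σ.clusters.cl (fatherS A (m + 1)) = r at *
    refine joinCode_wp hx hm hL hR' (by rw [p3]; exact hS') c1 hcl (by rw [p3]; exact c3)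
      (by rw [p3]; simp only [CS.grow, Function.update_self]; omega)
      (by rw [p2 3 (by omega) (by omega)]; simp [r3]) (by rw [p2 20 (by omega) (by omega)]; simp [r20])
      (by rw [p2 25 (by omega) (by omega)]; simp) fun σ' q1 q2 q3 => hQ σ' (fun j hj => ?_)
      (fun s hs h4 => ?_) ?_
    · rw [q1 j hj, p1 j hj]
      rfl
    · rw [q2 s hs, p2 s (by omega) h4]
      simp [show s ≠ 25 ∧ s ≠ 26 ∧ s ≠ 27 ∧ s ≠ 28 ∧ s ≠ 29 by omega]
    · rw [q3, p3]
      refine ⟨_, _, _, hS'.join hF hr (by simp only [CS.grow, Function.update_self]; omega) ?_⟩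
      simp only [CS.grow, Function.update_self, e2]
      have : σ.clusters.ln r * 1 < σ.clusters.ln r * (σ.clusters.ln r * σ.clusters.ln r) :=
        Nat.mul_lt_mul_of_pos_left (by nlinarith) (by omega)
      rw [mul_assoc]
      omega
  · refine ⟨by omega, by omega, by omega, by omega, trivial, by omega, ?_⟩
    refine joinCode_wp hx hm hL (by exact hR) (by exact hS) c1 hcl c3 e1 (by simp [r3])
      (by simp [r20]) (by simp) fun σ' q1 q2 q3 => hQ σ' (fun j hj => ?_) (fun s hs h4 => ?_) ?_
    · rw [q1 j hj]
      rfl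
    · rw [q2 s hs]
      simp [show s ≠ 25 ∧ s ≠ 26 ∧ s ≠ 27 ∧ s ≠ 28 ∧ s ≠ 29 ∧ s ≠ 30 by omega]
    · rw [q3]
      exact ⟨_, _, _, hS.join hF rfl e1 e2⟩

end

section

/-! ### The main loop -/

variable {A : ℕ → ℕ} {n m b N : ℕ} {Q : St → Prop} {σ : St}

/-- The treatment of the value in register 10. -/
def body : Stmt :=
  -- After an error the flag in register 0 stays zero, and each further phase does only a dummy
  -- assignment.
  .ite 0 (.const 6 0)
    (.op .add 3 3 5 ;; .op .sub 11 3 5 ;; .ite 11 firstCode (rowCode ;; lettersCode) ;;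
      .ite 0 (.const 6 0) (storeCode ;; insertCode))

/-- The state of the machine after `k` values. -/
def Rep (A : ℕ → ℕ) (k : ℕ) (σ : St) : Prop :=
  ((∀ i, 1 ≤ i → i ≤ k → Accepted A i) ∧ σ.reg 0 = 1 ∧ σ.reg 1 = letterAt A k ∧
    σ.reg 2 = maxLetters A k ∧ σ.reg 3 = k ∧ σ.reg 5 = 1 ∧ Rows A k σ.col ∧
    ∃ s tc own, CInv (fatherS A) (depthS A) k σ.clusters s tc own) ∨
  (¬ (∀ i, 1 ≤ i → i ≤ k → Accepted A i) ∧ σ.reg 0 = 0)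

theorem rep_zero (h : ∀ r, σ.reg r = if r = 0 ∨ r = 5 then 1 else 0) (hc : σ.col = 0) :
    Rep A 0 σ := by
  refine Or.inl ⟨fun i h1 h2 => by omega, by simp [h], by simp [h, letterAt_zero],
    by simp [h, maxLetters], by simp [h], by simp [h],
    ⟨fun v h1 h2 => by omega, fun v hv => ?_, fun v hv => ?_, fun v hv => ?_⟩, 0, 0, 0, ?_⟩
  · obtain rfl : v = 0 := by omega
    simp [hc, depthS_zero]
  · obtain rfl : v = 0 := by omega
    simp [hc, runEnd_zero]
  · obtain rfl : v = 0 := by omega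
    simp [hc, fatherS_zero]
  · constructor
    · simp [St.clusters, hc]
    · simp [St.clusters, hc]
    case space => simp [St.clusters, h]
    all_goals
      intro v h1 h2
      omega

theorem store_insert_wp {β : Type*} {x : ℕ → β} {s tc : ℕ → ℕ} {own : ℕ → ℕ × ℕ}
    (hx : PathWord A x m) (hm : m + 1 ≤ n) (hL : Large n b N)
    (hR : Rows A m σ.col) (hS : CInv (fatherS A) (depthS A) m σ.clusters s tc own)
    (hA : ∀ i, 1 ≤ i → i ≤ m + 1 → Accepted A i) (hr : RowRegs A (m + 1) σ.reg)
    (r0 : σ.reg 0 = 1) (r2 : σ.reg 2 = maxLetters A m) (r3 : σ.reg 3 = m + 1)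
    (r5 : σ.reg 5 = 1) : (storeCode ;; insertCode).wp b N (Rep A (m + 1)) σ := by
  refine storeCode_wp hx hm hL hR hr r2 r3 fun σ₁ p1 p2 p3 p4 p5 p6 => ?_
  have hS₁ : σ₁.clusters = σ.clusters := by
    simp only [St.clusters, p1 9 (by omega), p1 10 (by omega), p1 11 (by omega),
      p1 12 (by omega), p1 13 (by omega), p1 14 (by omega), p1 15 (by omega), p1 16 (by omega),
      p1 17 (by omega), p1 18 (by omega), p1 19 (by omega), p6 4 (by omega) (by omega)]
  refine insertCode_wp hx hm hL p2 (by rw [hS₁]; exact hS)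
    (by rw [p6 3 (by omega) (by omega), r3]) (by rw [p6 5 (by omega) (by omega), r5])
    (by rw [p6 20 (by omega) (by omega), hr.father]) fun σ₂ q1 q2 q3 => Or.inl ⟨hA, ?_, ?_, ?_,
      ?_, ?_, ?_, q3⟩
  · rw [q2 0 (by omega) (by omega), p3, r0]
  · rw [q2 1 (by omega) (by omega), p4]
  · rw [q2 2 (by omega) (by omega), p5]
  · rw [q2 3 (by omega) (by omega), p6 3 (by omega) (by omega), r3]
  · rw [q2 5 (by omega) (by omega), p6 5 (by omega) (by omega), r5]
  · refine ⟨fun v h1 h2 => ?_, fun v h2 => ?_, fun v h2 => ?_, fun v h2 => ?_⟩ <;>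
      simp only [q1 0 (by omega), q1 1 (by omega), q1 2 (by omega), q1 3 (by omega),
        q1 4 (by omega), q1 5 (by omega), q1 6 (by omega), q1 7 (by omega), q1 8 (by omega)]
    · exact p2.val v h1 h2
    · exact p2.depth v h2
    · exact p2.run v h2
    · exact p2.father v h2

theorem body_wp (hm : m + 1 ≤ n) (hL : Large n b N) (h : Rep A m σ) (r10 : σ.reg 10 = A (m + 1)) :
    body.wp b N (Rep A (m + 1)) σ := by
  have hi := hL.index
  have hw := hL.word
  have hpow := Nat.two_pow_pos b
  rcases h with ⟨hA, r0, -, r2, r3, r5, hR, s, tc, own, hS⟩ | ⟨hA, r0⟩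
  swap
  · simp only [body, Stmt.wp, r0, if_true]
    exact ⟨hpow, Or.inr ⟨fun h => hA fun i h1 h2 => h i h1 (by omega), by simp [r0]⟩⟩
  have hx := (pathWord_letterAt hA).1
  have hall : ∀ {i}, Accepted A (m + 1) → 1 ≤ i → i ≤ m + 1 → Accepted A i := by
    intro i h h1 h2
    rcases Nat.lt_or_ge i (m + 1) with hi | hi
    · exact hA i h1 (by omega)
    · obtain rfl : i = m + 1 := by omega
      exact h
  -- the end of the body, from the results of the tests
  have hend : ∀ σ' : St, σ'.col = σ.col → σ'.reg 2 = maxLetters A m → σ'.reg 3 = m + 1 →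
      σ'.reg 4 = σ.reg 4 → σ'.reg 5 = 1 →
      (Accepted A (m + 1) → σ'.reg 0 = 1 ∧ RowRegs A (m + 1) σ'.reg) →
      (¬ Accepted A (m + 1) → σ'.reg 0 = 0) →
      (Stmt.ite 0 (.const 6 0) (storeCode ;; insertCode)).wp b N (Rep A (m + 1)) σ' := by
    intro σ' q1 q2 q3 q4 q5 q6 q7
    have hS' : σ'.clusters = σ.clusters := by simp only [St.clusters, q1, q4]
    rw [Stmt.wp]
    by_cases hacc : Accepted A (m + 1)
    · obtain ⟨e0, hr⟩ := q6 hacc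
      rw [if_neg (by omega)]
      exact store_insert_wp hx hm hL (by rw [q1]; exact hR) (by rw [hS']; exact hS)
        (fun i => hall hacc) hr e0 q2 q3 q5
    · have e0 := q7 hacc
      rw [if_pos e0]
      exact ⟨hpow, Or.inr ⟨fun h => hacc (h _ (by omega) le_rfl), by simp [e0]⟩⟩
  simp only [body, Stmt.wp, r0, Nat.one_ne_zero, if_false, St.set_reg, WordOp.eval, WordOp.Fine, r3,
    r5, Nat.reduceEqDiff, if_true, Nat.add_sub_cancel]
  refine ⟨by omega, trivial, ?_⟩
  split_ifs with h0
  · subst h0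
    refine firstCode_wp (A := A) hL (by simp [r10]) fun σ' p1 p2 p3 p4 => ?_
    have := hend σ' p1 (by simp [p2, r2]) (by simp [p2]) (by simp [p2]) (by simp [p2, r5])
      (fun h => ⟨by simp [(p3 h).1, r0], (p3 h).2⟩) p4
    simpa only [Stmt.wp] using this
  · refine rowCode_wp hx (by omega) hm hL (by exact hR) (by simp) (by simp [r5]) (by simp [r10])
      fun σ₁ p1 p2 p3 p4 p5 p6 p7 p8 p9 p10 p11 p12 p13 p14 => ?_
    simp only [St.set_col] at p1
    have hS₁ : σ₁.clusters = σ.clusters := by simp [St.clusters, p1, p5]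
    refine lettersCode_wp hx (by omega) hm hL (by rw [p1]; exact hR) (by rw [hS₁]; exact hS) p4 p6
      p7 p8 p11 p12 fun σ' q1 q2 q3 q4 => ?_
    have := hend σ' (q1.trans p1) (by simp [q2, p3, r2]) (by simp [q2, p4]) (by simp [q2, p5])
      (by simp [q2, p6]) (fun h => ?_) q4
    · simpa only [Stmt.wp] using this
    · obtain ⟨t0, t1, t2, t3⟩ := q3 h
      refine ⟨by simp [t0, p2, r0], ?_, t2, t1, ?_, ?_, ?_, t3, ?_, ?_⟩
      · rw [q2 10 (by omega) (by omega), p7]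
      · rw [q2 13 (by omega) (by omega), p9]
      · rw [q2 14 (by omega) (by omega), p10]
      · rw [q2 15 (by omega) (by omega), p11]
      · rw [q2 19 (by omega) (by omega), p13]
      · rw [q2 20 (by omega) (by omega), p14]

theorem body_wf : body.wf = true := by decide

/-- With `n < 2 ^ L`, the largest number `2 * (4 * n ^ 2) ^ 5 = 2 ^ 11 * n ^ 10` needs at most `11 +
10 * L ≤ 21 * L` bits. The factor 561 leaves room for the addresses, which are below `20 * (27 * (n
+ 1) + 1)`. -/
theorem large_of_log_le (h : 21 * (Nat.log 2 n + 1) ≤ b) :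
    Large n b (27 * (n + 1)) ∧ 561 * (n + 1) ≤ 2 ^ b := by
  have h1 : n < 2 ^ (Nat.log 2 n + 1) := Nat.lt_pow_succ_log_self (by norm_num) n
  have hL : 1 ≤ Nat.log 2 n + 1 := by omega
  generalize Nat.log 2 n + 1 = L at h h1 hL
  have h2 : 2 ^ (21 * L) ≤ 2 ^ b := Nat.pow_le_pow_right (by norm_num) h
  have h3 : 2 ^ (10 + L) ≤ 2 ^ (21 * L) := Nat.pow_le_pow_right (by norm_num) (by omega)
  have h4 : 2 ^ (11 + L * 10) ≤ 2 ^ (21 * L) := Nat.pow_le_pow_right (by norm_num) (by omega)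
  have h5 : n ^ 10 < (2 ^ L) ^ 10 := Nat.pow_lt_pow_left h1 (by norm_num)
  rw [pow_add] at h3 h4
  rw [← pow_mul] at h5
  have h6 : 2 * (4 * n ^ 2) ^ 5 = 2 ^ 11 * n ^ 10 := by ring
  exact ⟨⟨le_rfl, by omega, by omega⟩, by omega⟩

end

section

/-! ### The run of the whole program -/

variable {A : ℕ → ℕ} {n k b : ℕ}

/-- Validate-π-RAM. -/
def program : List Instr :=
  [.const 0 1, .const 5 1, .read 10] ++ body.compile 3 ++ [.const 60 0, .jumpZero 60 2]

theorem program_read : program[2]? = some (.read 10) := rfl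

theorem program_end : program[3 + body.size]? = some (.const 60 0) ∧
    program[3 + body.size + 1]? = some (.jumpZero 60 2) := by
  have e : (([.const 0 1, .const 5 1, .read 10] : List Instr) ++ body.compile 3).length = 3 + body.size := by
    simp [Stmt.length_compile]
    omega
  rw [program, ← e]
  refine ⟨?_, ?_⟩
  · rw [List.getElem?_append_right le_rfl, Nat.sub_self]
    rfl
  · rw [List.getElem?_append_right (by omega), Nat.add_sub_cancel_left]
    rfl

/-- The machine is ready to read the value after `A[k]`. -/
def Ready (A : ℕ → ℕ) (k : ℕ) (c : Config) : Prop :=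
  c.pc = 2 ∧ c.pos = k ∧ ∃ σ, Sim c σ ∧ Rep A k σ

theorem run_phase (hb : 21 * (Nat.log 2 n + 1) ≤ b) (hk : k < n) (hA : A (k + 1) < 2 ^ b)
    {c : Config} (hf : c.Fits b) (hc : Ready A k c) :
    ∃ t c', 1 ≤ t ∧ t ≤ body.size + 3 ∧ Run program A b (561 * (n + 1)) c t c' ∧
      Ready A (k + 1) c' := by
  obtain ⟨hL, hX⟩ := large_of_log_le hb
  obtain ⟨hpc, hpos, σ, hsim, hrep⟩ := hc
  have r1 := run_read (A := A) (X := 561 * (n + 1)) (c := c) (by rw [hpc]; exact program_read) hf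
    (by rw [hpos]; exact hA)
  have hs1 := hsim.set 10 (A (c.pos + 1)) (c.pc + 1) (c.pos + 1)
  have hrep1 : Rep A k (σ.set 10 (A (c.pos + 1))) := by
    have hcl : (σ.set 10 (A (c.pos + 1))).clusters = σ.clusters := by simp [St.clusters]
    rcases hrep with ⟨h0, h1, h2, h3, h4, h5, h6, h7⟩ | ⟨h0, h1⟩
    · exact Or.inl ⟨h0, by simp [h1], by simp [h2], by simp [h3], by simp [h4], by simp [h5], h6,
        by rw [hcl]; exact h7⟩
    · exact Or.inr ⟨h0, by simp [h1]⟩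
  have hcode : CodeAt program 3 (body.compile 3) :=
    codeAt_append [.const 0 1, .const 5 1, .read 10] (body.compile 3) [.const 60 0, .jumpZero 60 2]
  obtain ⟨t, c2, σ2, ht, r2, p2, q2, s2, w2⟩ := Stmt.wp_sound (P := program) (A := A)
    (N := 27 * (n + 1)) (X := 561 * (n + 1)) (by omega) hX body body_wf hcode hs1 (by simp [hpc])
    r1.fits (body_wp (by omega) hL hrep1 (by simp [hpos]))
  obtain ⟨e1, e2⟩ := program_end
  rw [← p2] at e1 e2
  have r3 := run_const (A := A) (X := 561 * (n + 1)) e1 r2.fits (Nat.two_pow_pos b)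
  have r4 := run_jumpZero (A := A) (X := 561 * (n + 1))
    (c := { c2 with pc := c2.pc + 1, reg := Function.update c2.reg 60 0 }) e2 r3.fits
  simp only [Function.update_self, if_true] at r4
  exact ⟨_, _, by omega, by omega, r1.trans (r2.trans (r3.trans r4)), rfl, by simp [q2, hpos], σ2,
    s2.scratch _ _ _ _ le_rfl, w2⟩

theorem run_start (hb : 21 * (Nat.log 2 n + 1) ≤ b) :
    ∃ c, Run program A b (561 * (n + 1)) Config.init 2 c ∧ Ready A 0 c := by
  obtain ⟨hL, hX⟩ := large_of_log_le hb
  have hf : Config.init.Fits b :=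
    ⟨fun _ => Nat.two_pow_pos b, fun _ => Nat.two_pow_pos b⟩
  have h1 : 1 < 2 ^ b := by omega
  have r1 := run_const (P := program) (A := A) (X := 561 * (n + 1)) (c := Config.init) (r := 0)
    (v := 1) rfl hf h1
  have r2 := run_const (P := program) (A := A) (X := 561 * (n + 1)) (r := 5) (v := 1) rfl r1.fits h1
  refine ⟨_, r1.trans r2, rfl, rfl, ⟨Function.update (Function.update 0 0 1) 5 1, 0⟩,
    ⟨fun r _ => rfl, fun x => rfl⟩, rep_zero (fun r => ?_) rfl⟩
  simp only [Function.update_apply]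
  split_ifs <;> first | rfl | omega

/-- With 20 columns the row of `i` starts at address `20 * i`, and its first seven cells are the
promised values; the other columns are internal. -/
theorem Ready.holds {c : Config} (h : Ready A k c) : c.Holds 20 (validate A k) := by
  obtain ⟨-, -, σ, ⟨hr, hm⟩, hrep⟩ := h
  rcases validate_spec A k with ⟨hA, s, hs, hag⟩ | ⟨hA, hs⟩
  · rcases hrep with ⟨-, h0, h1, h2, -, -, hR, -⟩ | ⟨h0, -⟩
    swap
    · exact absurd hA h0
    rw [hs]
    have hrow : ∀ i j, j < 20 → c.mem (20 * i + j) = σ.col j i := fun i j hj => by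
      rw [hm, show (20 * i + j) % 20 = j by omega, show (20 * i + j) / 20 = i by omega]
    refine ⟨by rw [hr 0 (by omega), h0], ?_, by rw [hr 2 (by omega), h2, hag.maxAlph],
      fun i i1 i2 => ?_⟩
    · rw [hr 1 (by omega), h1, hag.len]
      rcases Nat.eq_zero_or_pos k with rfl | hk
      · rw [hag.zero.2.1, letterAt_zero]
      · rw [(hag.val k hk le_rfl).2.1]
    · rw [hag.len] at i2
      obtain ⟨v0, v1, v2, v3, v4, v5, v6⟩ := hag.val i i1 i2
      obtain ⟨w0, w1, w2, w3, w5, w6⟩ := hR.val i i1 i2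
      rw [v0, v1, v2, v3, v4, v5, v6, ← w0, ← w1, ← w2, ← w3, ← hR.depth i i2, ← w5, ← w6,
        ← hrow i 0 (by omega), ← hrow i 1 (by omega), ← hrow i 2 (by omega),
        ← hrow i 3 (by omega), ← hrow i 4 (by omega), ← hrow i 5 (by omega),
        ← hrow i 6 (by omega)]
      rfl
  · rcases hrep with ⟨h0, -⟩ | ⟨-, h0⟩
    · exact absurd h0 hA
    · rw [hs]
      exact (hr 0 (by omega)).trans h0

theorem exists_times (hb : 21 * (Nat.log 2 n + 1) ≤ b)
    (hA : ∀ i, 1 ≤ i → i ≤ n → A i < 2 ^ b) (hk : k ≤ n) :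
    ∃ T : ℕ → ℕ, T 0 = 2 ∧ (∀ j < k, T j < T (j + 1) ∧ T (j + 1) ≤ T j + (body.size + 3)) ∧
      (∀ j ≤ k, Ready A j (configAt program A (T j))) ∧
      Run program A b (561 * (n + 1)) Config.init (T k) (configAt program A (T k)) := by
  induction k with
  | zero =>
    obtain ⟨c, hr, hc⟩ := run_start (A := A) hb
    have e : configAt program A 2 = c := hr.spec.1
    refine ⟨fun _ => 2, rfl, fun j hj => by omega, fun j hj => ?_, by rw [e]; exact hr⟩
    obtain rfl : j = 0 := by omega
    rw [e]
    exact hc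
  | succ k ih =>
    obtain ⟨T, h0, h1, h2, h3⟩ := ih (by omega)
    obtain ⟨t, c, t1, t2, hr, hc⟩ := run_phase hb (by omega) (hA (k + 1) (by omega) hk) h3.fits
      (h2 k le_rfl)
    have hr' := h3.trans hr
    have e : configAt program A (T k + t) = c := hr'.spec.1
    have hT : ∀ j ≤ k, Function.update T (k + 1) (T k + t) j = T j := fun j hj =>
      Function.update_of_ne (by omega) _ _
    refine ⟨Function.update T (k + 1) (T k + t), by rw [hT 0 (by omega), h0], fun j hj => ?_,
      fun j hj => ?_, ?_⟩
    · rcases Nat.lt_or_ge j k with hjk | hjk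
      · rw [hT j (by omega), hT (j + 1) (by omega)]
        exact h1 j hjk
      · obtain rfl : j = k := by omega
        rw [hT j le_rfl, Function.update_self]
        omega
    · rcases Nat.lt_or_ge j (k + 1) with hjk | hjk
      · rw [hT j (by omega)]
        exact h2 j (by omega)
      · obtain rfl : j = k + 1 := by omega
        rw [Function.update_self, e]
        exact hc
    · rw [Function.update_self, e]
      exact hr'

theorem runsValidate_program {C : ℕ} (hC : body.size + 561 ≤ C) (hb : C * (Nat.log 2 n + 1) ≤ b)
    (hA : ∀ i, 1 ≤ i → i ≤ n → A i < 2 ^ b) : RunsValidate program C 20 A n b := by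
  have hb' : 21 * (Nat.log 2 n + 1) ≤ b := (Nat.mul_le_mul_right _ (by omega)).trans hb
  obtain ⟨T, h0, h1, h2, h3⟩ := exists_times hb' hA le_rfl
  obtain ⟨-, s2, s3⟩ := h3.spec
  generalize body.size = s at hC h1
  have hT : ∀ j ≤ n, T j ≤ C * (j + 1) := by
    intro j hj
    induction j with
    | zero => omega
    | succ j ih =>
      have := (h1 j (by omega)).2
      have := ih (by omega)
      rw [mul_add, mul_one]
      omega
  refine ⟨T, fun k hk => ⟨(h2 k hk).2.1, ⟨10, ?_⟩, (h2 k hk).holds⟩, by omega, fun k hk => ?_,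
    hT n le_rfl, fun t ht y hy => (s2 t ht y hy).trans_le (Nat.mul_le_mul_right _ (by omega)), s3⟩
  · rw [(h2 k hk).1]
    exact program_read
  · have := h1 k hk
    omega

end

end BorderArray

theorem mainTheorem2 :
    -- online, the algorithm accepts exactly the valid border arrays
    (∀ (A : ℕ → ℕ) (n : ℕ),
      (BorderArray.validate A n).isSome = true ↔ BorderArray.IsBorderArray A n) ∧
    -- it computes a word over an alphabet of minimal size, and its tables are as intended
    (∀ (A : ℕ → ℕ) (n : ℕ) (s : BorderArray.Tables), BorderArray.validate A n = some s →
      BorderArray.IsFailureArray s.word A n ∧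
      (∀ x ∈ s.word, 1 ≤ x ∧ x ≤ s.maxAlph) ∧
      IsLeast (BorderArray.alphabetSizes A n) s.maxAlph ∧
      BorderArray.IsDepth (BorderArray.father A) s.d n ∧
      BorderArray.IsDepth (BorderArray.strongFather s.word) s.d' n ∧
      (∀ i, 1 ≤ i → i ≤ n → ∀ e : ℕ, (s.Bcand i).testBit e = true ↔
        ∃ c, 0 < c ∧ BorderArray.IsCandidate A i c ∧ s.d' c = e)) ∧
    -- it runs on the unit-cost RAM with words of `Θ(log n)` bits, with constant delay, in linear
    -- total time, with a linear number of words
    (∃ (P : List BorderArray.Instr) (C q : ℕ), ∀ (A : ℕ → ℕ) (n b : ℕ),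
      C * (Nat.log 2 n + 1) ≤ b → (∀ i, 1 ≤ i → i ≤ n → A i < 2 ^ b) →
      BorderArray.RunsValidate P C q A n b) := by
  refine ⟨BorderArray.validate_isSome_iff, fun _ _ _ hs => BorderArray.validate_tables hs, ?_⟩
  -- One constant covers the delay, at most `body.size + 3`, the factor 561 for the addresses and
  -- the factor 21 for the word length.
  obtain ⟨C, hC⟩ : ∃ C, BorderArray.body.size + 561 ≤ C := ⟨_, le_rfl⟩
  exact ⟨BorderArray.program, C, 20, fun _ _ _ => BorderArray.runsValidate_program hC⟩
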